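/- **Setting.** Let $d\ge 1$, $E=\{\{x,y\}:x\ne y\in\mathbb Z^d\}$, $\Omega=[0,\infty]^E$ with its product topology and Borel σ-algebra. For $\omega\in\Omega$ write $\omega_{x,z}=\omega(\{x,x+z\})$ for $z\neq0$, $\omega_{x,0}=0$, and $(\tau_x\omega)_{y,z}=\omega_{x+y,z}$. Let $\mathbb P$ be a probability measure on $\Omega$, stationary and ergodic under the shifts $(\tau_x)_{x\in\mathbb Z^d}$, with $\mathbb E[\sum_z\omega_{0,z}|z|^2]<\infty$. Assume moreover that for some $l\in\mathbb N$ there are, for each neighbour $y$ of $0$, a collection $\Gamma_l(\{0,y\})$ of pairwise edge-disjoint nearest-neighbour paths from $0$ to $y$ of length at most $l$, such that $\nu_l^\omega(0)=\sum_{|y|=1}\min_{\gamma\in\Gamma_l(\{0,y\})}\sum_{e\in\gamma}\omega(e)^{-1}$ satisfies $\mathbb E[\nu^\omega_l(0)]<\infty$. **Spaces.** $L^2_{\rm cov}$ is the space of measurable $\varphi:\Omega\times\mathbb Z^d\to\mathbb R$ with $\varphi(\omega,x+z)-\varphi(\omega,x)=\varphi(\tau_x\omega,z)$ and $\|\varphi\|^2=\mathbb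 E[\sum_z\omega_{0,z}\varphi(\omega,z)^2]<\infty$, with the corresponding scalar product. A local function is a bounded continuous function on $\Omega$ depending on finitely many edges; $Dg(\omega,z)=g(\tau_z\omega)-g(\omega)$. $L^2_{\rm pot}$ is the closure of $\{Dg: g\text{ local}\}$ in $L^2_{\rm cov}$ and $L^2_{\rm sol}$ its orthogonal complement in $L^2_{\rm cov}$. Fix countable sets $\Phi_{\rm sol}\subset L^2_{\rm sol}$ and $\Phi_{\rm pot}\subset\{Dg: g\text{ local}\}$ whose linear spans are dense in $L^2_{\rm sol}$ and $L^2_{\rm pot}$, and put $\Phi=\Phi_{\rm sol}\cup\Phi_{\rm pot}\cup\{z_1,\dots,z_d\}\cup\{1\}$. **Typical realizations.** Let $Q=(-1,1)^d$. $\omega$ is *typical* ($\omega\in\Omega_\Phi$) if $\sum_z\omega_{x,z}|z|^2<\infty$ for all $x$, if $$\lim_{\varepsilon\to0}\varepsilon^d\sum_{x\in\mathbb Z^d,\ \varepsilon x\in Q}v(\varepsilon x)f(\tau_x\omega)=\mathbb E[f]\int_Q v\,dx\qquad\text{for all }v\in C(\overline Q)$$ holds for each of the functions $f(\omega)=\sum_z\omega_{0,z}\varphi(\omega,z)$,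 $f(\omega)=\sum_z\omega_{0,z}\varphi(\omega,z)\psi(\omega,z)$ ($\varphi,\psi\in\Phi$) and $f(\omega)=\sum_{z\notin Z}\omega_{0,z}|z|^2$ ($Z\subset\mathbb Z^d$ finite), and if $\sum_z\omega_{x,z}b(\tau_x\omega,z)=0$ for all $b\in\Phi_{\rm sol}$ and $x\in\mathbb Z^d$. **Lattice functions.** For $0<\varepsilon\le1$ and $u:\varepsilon\mathbb Z^d\to\mathbb R$ put $\partial^\varepsilon_zu(x)=\varepsilon^{-1}(u(x+\varepsilon z)-u(x))$ and $\mathcal E^\varepsilon_\omega(u)=\frac{\varepsilon^d}{2}\sum_{x,z\in\mathbb Z^d}\omega_{x,z}(\partial_z^\varepsilon u(\varepsilon x))^2$, and let $\mathcal R_\varepsilon^*u=\sum_{y\in\varepsilon\mathbb Z^d}u(y)\mathbf 1_{y+(-\varepsilon/2,\varepsilon/2]^d}$. The *uniform Poincaré inequality* holds at $\omega$ if there is $C(\omega)<\infty$ with $\varepsilon^d\sum_{x}u(\varepsilon x)^2\le C(\omega)\,\mathcal E^\varepsilon_\omega(u)$ for all $0<\varepsilon\le1$ and all $u$ supported in $Q_\varepsilon=Q\cap\varepsilon\mathbb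 Z^d$. The *compact embedding* holds at $\omega$ if every sequence $u^\varepsilon$ ($\varepsilon^{-1}\in\mathbb N$, $\varepsilon\to0$) with supports in $Q_\varepsilon$ and $\sup_\varepsilon\mathcal E_\omega^\varepsilon(u^\varepsilon)<\infty$ has a subsequence along which $\mathcal R_\varepsilon^*u^\varepsilon$ converges strongly in $L^2(\mathbb R^d)$. A sequence $w_\varepsilon:\varepsilon\mathbb Z^d\times\mathbb Z^d\to\mathbb R$ *two-scale converges* (at $\omega$) to $w\in L^2(\mathbb R^d;L^2_{\rm cov})$, written $w_\varepsilon\stackrel{2s}{\rightharpoonup}w$, if for all $v\in C_c^\infty(\mathbb R^d)$ and $\varphi\in\Phi$ $$\varepsilon^d\sum_{x\in\mathbb Z^d}v(\varepsilon x)\sum_{z\in\mathbb Z^d}\omega_{x,z}w_\varepsilon(\varepsilon x,z)\varphi(\tau_x\omega,z)\ \longrightarrow\ \int_{\mathbb R^d}v(x)\,\mathbb E\Big[\sum_{z}\omega_{0,z}w(x,\omega,z)\varphi(\omega,z)\Big]dx .$$ **Lemma (two-scale convergence of gradients).** For $\mathbb P$-almost every $\omega$ (the exceptional null set does not depend on the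 functions $u^\varepsilon$ below) the following holds. If $\omega$ is typical and the uniform Poincaré inequality holds at $\omega$, and if, for $\varepsilon$ ranging over a null sequence in $(0,1]$, $u^\varepsilon:\varepsilon\mathbb Z^d\to\mathbb R$ are supported in $Q_\varepsilon$ with $$\sup_\varepsilon\Big(\varepsilon^d\sum_{x\in\mathbb Z^d}\sum_{z\in\mathbb Z^d}\omega_{x,z}\big(\partial^\varepsilon_zu^\varepsilon(\varepsilon x)\big)^2+\|u^\varepsilon\|_\infty\Big)<\infty,$$ then there are a subsequence $\varepsilon'$, $u\in H^1_0(Q)$ (extended by $0$, together with its gradient) and $v\in L^2(\mathbb R^d;L^2_{\rm pot})$ such that, as $\varepsilon'\to0$, $$\mathcal R^*_{\varepsilon'}u^{\varepsilon'}\rightharpoonup u\ \text{ weakly in }L^2(\mathbb R^d),\qquad \partial_z^{\varepsilon'}u^{\varepsilon'}\stackrel{2s}{\rightharpoonup}\nabla u(x)\cdot z+v(x,\omega,z).$$ If in addition the compact embedding holds at $\omega$, then $\mathcal R^*_{\varepsilon'}u^{\varepsilon'}\to u$ strongly in $L^2(\mathbb R^d)$. -/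

import Mathlib

open MeasureTheory Filter Topology
open scoped ENNReal NNReal

noncomputable section

namespace RCM

/-! ### Environments on the complete graph over the integer lattice -/

/-- The vertex set `ℤ^d`. -/
abbrev Lat (d : ℕ) : Type := Fin d → ℤ

/-- Euclidean space `ℝ^d`. -/
abbrev Sp (d : ℕ) : Type := EuclideanSpace ℝ (Fin d)

/-- All undirected edges `{x, y}` with `x ≠ y`. -/
abbrev Edge (d : ℕ) : Type := {e : Sym2 (Lat d) // ¬ e.IsDiag}

/-- Environments `ω ∈ [0, ∞]^E`, with the product topology and the product Borel σ-algebra. -/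
abbrev Env (d : ℕ) : Type := Edge d → ℝ≥0∞

variable {d : ℕ}

open Classical in
/-- The conductance of an unordered pair of vertices (zero if the two vertices coincide). -/
def pairCond (ω : Env d) (e : Sym2 (Lat d)) : ℝ≥0∞ :=
  if h : e.IsDiag then 0 else ω ⟨e, h⟩

/-- `ω_{x,z}`, the conductance of the edge `{x, x + z}` (zero if `z = 0`). -/
def cond (ω : Env d) (x z : Lat d) : ℝ≥0∞ := pairCond ω s(x, x + z)

/-- Translation of an edge by `x`. -/
def Edge.shift (x : Lat d) (e : Edge d) : Edge d :=
  ⟨e.1.map (fun y => x + y), fun h =>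
    e.2 ((Sym2.isDiag_map (add_right_injective x)).1 h)⟩

/-- The translation `τ_x` of environments, `(τ_x ω)_{y,z} = ω_{x+y,z}`. -/
def shift (x : Lat d) (ω : Env d) : Env d := fun e => ω (Edge.shift x e)

theorem cond_shift (x y z : Lat d) (ω : Env d) : cond (shift x ω) y z = cond ω (x + y) z := by
  have hm : Sym2.map (fun y => x + y) s(y, y + z) = s(x + y, x + y + z) := by
    simp [add_assoc]
  unfold cond pairCond
  by_cases hz : z = 0
  · simp [hz]
  · rw [dif_neg (by simpa using hz), dif_neg (by simpa using hz)]
    exact congrArg ω (Subtype.ext hm)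

/-- The squared Euclidean length `|z|²`. -/
def sqLen (z : Lat d) : ℝ := ∑ i, (z i : ℝ) ^ 2

/-! ### Assumptions on the law of the environment -/

/-- The law is invariant under all translations. -/
def Stationary (P : Measure (Env d)) : Prop :=
  ∀ x : Lat d, MeasurePreserving (shift x) P P

/-- Every event that is invariant under all translations has probability zero or one. -/
def ShiftErgodic (P : Measure (Env d)) : Prop :=
  ∀ A : Set (Env d), MeasurableSet A → (∀ x : Lat d, shift x ⁻¹' A = A) → P A = 0 ∨ P A = 1

/-- `𝔼[∑_z ω_{0,z} |z|²] < ∞`. -/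
def UpperMoment (P : Measure (Env d)) : Prop :=
  ∫⁻ ω, ∑' z : Lat d, cond ω 0 z * ENNReal.ofReal (sqLen z) ∂P < ∞

/-- The nearest-neighbour graph `(ℤ^d, E_d)`. -/
def nnGraph (d : ℕ) : SimpleGraph (Lat d) where
  Adj x y := ∑ i, |x i - y i| = 1
  symm := ⟨fun x y h => by simpa only [abs_sub_comm] using h⟩
  loopless := ⟨fun x h => by simp at h⟩

open Classical in
/-- `min_{γ ∈ Γ} ∑_{e ∈ γ} ω(e)⁻¹` over a collection `Γ` of nearest-neighbour paths from `x` to `y`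
(`∞` if `Γ` is empty). -/
def pathResistance (ω : Env d) {x y : Lat d} (Γ : Set ((nnGraph d).Walk x y)) : ℝ≥0∞ :=
  ⨅ γ ∈ Γ, ∑ e ∈ γ.edges.toFinset, (pairCond ω e)⁻¹

/-- There are a finite length `l` and, for every nearest-neighbour edge `{0, y}` at the origin,
a collection `Γ y` of pairwise edge-disjoint nearest-neighbour paths of length at most `l` between
`0` and `y`, such that `ν_l^ω(0) = ∑_y min_{γ ∈ Γ y} ∑_{e ∈ γ} ω(e)⁻¹` has finite expectation. -/
def LowerMoment (P : Measure (Env d)) : Prop :=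
  ∃ (l : ℕ) (Γ : (y : (nnGraph d).neighborSet 0) → Set ((nnGraph d).Walk 0 y.1)),
    (∀ y, ∀ γ ∈ Γ y, γ.length ≤ l) ∧
    (∀ y, (Γ y).Pairwise fun γ γ' => γ.edges.Disjoint γ'.edges) ∧
    ∫⁻ ω, ∑' y, pathResistance ω (Γ y) ∂P < ∞

/-! ### Shift covariant functions -/

/-- Functions `φ(ω, z)`. -/
abbrev Field (d : ℕ) : Type := Env d → Lat d → ℝ

/-- `‖φ‖² = 𝔼[∑_z ω_{0,z} φ(ω,z)²]`. -/
def covNormSq (P : Measure (Env d)) (φ : Field d) : ℝ≥0∞ :=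
  ∫⁻ ω, ∑' z, cond ω 0 z * ENNReal.ofReal (φ ω z ^ 2) ∂P

/-- `∑_z ω_{0,z} φ(ω,z) ψ(ω,z)`. -/
def density (φ ψ : Field d) (ω : Env d) : ℝ :=
  ∑' z, (cond ω 0 z).toReal * (φ ω z * ψ ω z)

/-- `⟨φ, ψ⟩ = 𝔼[∑_z ω_{0,z} φ(ω,z) ψ(ω,z)]`. -/
def covInner (P : Measure (Env d)) (φ ψ : Field d) : ℝ := ∫ ω, density φ ψ ω ∂P

/-- `φ ∈ L²_cov`: measurable, shift covariant and of finite norm. -/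
structure MemCov (P : Measure (Env d)) (φ : Field d) : Prop where
  measurable : ∀ z, Measurable fun ω => φ ω z
  covariant : ∀ (ω : Env d) (x z : Lat d), φ ω (x + z) - φ ω x = φ (shift x ω) z
  norm_lt_top : covNormSq P φ < ∞

/-- Local functions: bounded, continuous, depending on finitely many edges. -/
structure IsLocal (g : Env d → ℝ) : Prop where
  bounded : ∃ C : ℝ, ∀ ω, |g ω| ≤ C
  continuous : Continuous g
  dependsOn : ∃ s : Finset (Edge d), DependsOn g (s : Set (Edge d))

/-- `D g (ω, z) = g(τ_z ω) - g(ω)`. -/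
def grad (g : Env d → ℝ) : Field d := fun ω z => g (shift z ω) - g ω

/-- `φ ∈ L²_pot`, the closure in `L²_cov` of the gradients of local functions. -/
def MemPot (P : Measure (Env d)) (φ : Field d) : Prop :=
  MemCov P φ ∧ ∀ δ : ℝ≥0∞, 0 < δ → ∃ g, IsLocal g ∧ covNormSq P (φ - grad g) < δ

/-- `φ ∈ L²_sol`, the orthogonal complement of `L²_pot` in `L²_cov`. -/
def MemSol (P : Measure (Env d)) (φ : Field d) : Prop :=
  MemCov P φ ∧ ∀ ψ, MemPot P ψ → covInner P φ ψ = 0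

/-- Joint measurability in `(x, ω)`, `f(x) ∈ X` for a.e. `x`, and `∫ ‖f(x)‖² dx < ∞`; with
`X = MemCov P` this is `L²(ℝ^d; L²_cov)`, with `X = MemPot P` it is `L²(ℝ^d; L²_pot)`. -/
structure MemBochner (P : Measure (Env d)) (X : Field d → Prop) (f : Sp d → Field d) : Prop where
  measurable : ∀ z, Measurable fun p : Sp d × Env d => f p.1 p.2 z
  mem : ∀ᵐ x, X (f x)
  norm_lt_top : ∫⁻ x, covNormSq P (f x) < ∞

/-! ### The test family and the typical realizations -/

/-- The coordinate function `z_i`. -/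
def coordField (i : Fin d) : Field d := fun _ z => (z i : ℝ)

/-- Countable sets `Φ_sol ⊆ L²_sol` and `Φ_pot ⊆ {D g : g local}` with dense linear span in
`L²_sol` and in `L²_pot`, respectively. -/
structure IsTestFamily (P : Measure (Env d)) (Φsol Φpot : Set (Field d)) : Prop where
  countable_sol : Φsol.Countable
  countable_pot : Φpot.Countable
  sol_mem : ∀ b ∈ Φsol, MemSol P b
  pot_mem : ∀ φ ∈ Φpot, ∃ g, IsLocal g ∧ φ = grad g
  sol_dense : ∀ b, MemSol P b → ∀ δ : ℝ≥0∞, 0 < δ →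
    ∃ b' ∈ Submodule.span ℝ Φsol, covNormSq P (b - b') < δ
  pot_dense : ∀ φ, MemPot P φ → ∀ δ : ℝ≥0∞, 0 < δ →
    ∃ φ' ∈ Submodule.span ℝ Φpot, covNormSq P (φ - φ') < δ

/-- `Φ`, consisting of `Φ_sol`, `Φ_pot`, the coordinates `z_1, …, z_d` and the constant `1`. -/
def testSet (Φsol Φpot : Set (Field d)) : Set (Field d) :=
  Φsol ∪ Φpot ∪ Set.range coordField ∪ {fun _ _ => 1}

/-- The cube `Q = (-1, 1)^d`. -/
def cube (d : ℕ) : Set (Sp d) := {x | ∀ i, |x i| < 1}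

/-- The point `ε x` of the rescaled lattice `ε ℤ^d`. -/
def scaled (ε : ℝ) (x : Lat d) : Sp d := WithLp.toLp 2 fun i => ε * (x i : ℝ)

open Classical in
/-- The ergodic averages of `f` along `ω` converge: for all `v ∈ C(Q̄)`,
`ε^d ∑_{x : ε x ∈ Q} v(ε x) f(τ_x ω) → 𝔼[f] ∫_Q v` as `ε → 0`. -/
def ErgodicLimit (P : Measure (Env d)) (f : Env d → ℝ) (ω : Env d) : Prop :=
  ∀ v : Sp d → ℝ, ContinuousOn v (closure (cube d)) →
    Tendsto
      (fun ε : ℝ => ε ^ d *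
        ∑' x : Lat d, if scaled ε x ∈ cube d then v (scaled ε x) * f (shift x ω) else 0)
      (𝓝[>] 0) (𝓝 ((∫ ω', f ω' ∂P) * ∫ x in cube d, v x))

open Classical in
/-- The typical realizations `Ω_Φ`. -/
structure Typical (P : Measure (Env d)) (Φsol Φpot : Set (Field d)) (ω : Env d) : Prop where
  finite : ∀ x, ∑' z, cond ω x z * ENNReal.ofReal (sqLen z) < ∞
  erg_single : ∀ φ ∈ testSet Φsol Φpot, ErgodicLimit P (density φ fun _ _ => 1) ω
  erg_product : ∀ φ ∈ testSet Φsol Φpot, ∀ ψ ∈ testSet Φsol Φpot, ErgodicLimit P (density φ ψ) ω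
  erg_tail : ∀ Z : Finset (Lat d),
    ErgodicLimit P (fun ω' => ∑' z, if z ∈ Z then 0 else (cond ω' 0 z).toReal * sqLen z) ω
  div_free : ∀ b ∈ Φsol, ∀ x, ∑' z, (cond ω x z).toReal * b (shift x ω) z = 0

/-! ### Functions on the rescaled lattice

A function on `ε ℤ^d` is represented by `U : Lat d → ℝ`, where `U x` is its value at `ε x`. -/

/-- The discrete derivative `∂_z^ε u (ε x)`. -/
def discDeriv (ε : ℝ) (U : Lat d → ℝ) (x z : Lat d) : ℝ := (U (x + z) - U x) / ε

/-- The support of the function lies in `Q ∩ ε ℤ^d`. -/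
def SuppInCube (ε : ℝ) (U : Lat d → ℝ) : Prop := ∀ x, U x ≠ 0 → scaled ε x ∈ cube d

/-- `ε^d ∑_x ∑_z ω_{x,z} (∂_z^ε u (ε x))²`. -/
def gradEnergy (ω : Env d) (ε : ℝ) (U : Lat d → ℝ) : ℝ≥0∞ :=
  ENNReal.ofReal (ε ^ d) * ∑' x, ∑' z, cond ω x z * ENNReal.ofReal (discDeriv ε U x z ^ 2)

/-- The Dirichlet energy `⟨u, -L_ω^ε u⟩ = (ε^d / 2) ∑_x ∑_z ω_{x,z} (∂_z^ε u (ε x))²` of the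
operator `(L_ω^ε u)(ε x) = ε⁻² ∑_z ω_{x,z} (u(ε x + ε z) - u(ε x))`. -/
def dirichletEnergy (ω : Env d) (ε : ℝ) (U : Lat d → ℝ) : ℝ≥0∞ := gradEnergy ω ε U / 2

/-- The uniform Poincaré inequality: `ε^d ∑_x u(ε x)² ≤ C(ω) ⟨u, -L_ω^ε u⟩` for all `0 < ε ≤ 1` and
all `u` supported in `Q ∩ ε ℤ^d`. -/
def UniformPoincare (ω : Env d) : Prop :=
  ∃ C : ℝ≥0, ∀ ε : ℝ, 0 < ε → ε ≤ 1 → ∀ U : Lat d → ℝ, SuppInCube ε U →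
    ENNReal.ofReal (ε ^ d) * ∑' x, ENNReal.ofReal (U x ^ 2) ≤ C * dirichletEnergy ω ε U

/-- The half-open cell `ε z + (-ε/2, ε/2]^d`. -/
def cell (ε : ℝ) (z : Lat d) : Set (Sp d) :=
  {x | ∀ i, x i - ε * (z i : ℝ) ∈ Set.Ioc (-(ε / 2)) (ε / 2)}

/-- `R_ε^* u = ∑_z u(ε z) 1_{cell(ε z)}`, the piecewise constant interpolation. -/
def interp (ε : ℝ) (U : Lat d → ℝ) (x : Sp d) : ℝ :=
  ∑' z, U z * (cell ε z).indicator (fun _ => 1) x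

/-- The compact embedding at `ω`: every sequence with `ε⁻¹ ∈ ℕ`, `ε → 0`, supports in
`Q ∩ ε ℤ^d` and bounded Dirichlet energies has a subsequence along which `R_ε^* u^ε` converges
strongly in `L²(ℝ^d)`. -/
def CompactEmbedding (ω : Env d) : Prop :=
  ∀ (n : ℕ → ℕ) (U : ℕ → Lat d → ℝ),
    (∀ k, 1 ≤ n k) → Tendsto n atTop atTop →
    (∀ k, SuppInCube (1 / (n k : ℝ)) (U k)) →
    (∃ C : ℝ≥0, ∀ k, dirichletEnergy ω (1 / (n k : ℝ)) (U k) ≤ C) →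
    ∃ (σ : ℕ → ℕ) (u : Sp d → ℝ), StrictMono σ ∧ MemLp u 2 ∧
      Tendsto (fun k => eLpNorm (interp (1 / (n (σ k) : ℝ)) (U (σ k)) - u) 2 volume)
        atTop (𝓝 0)

/-! ### Limit notions -/

/-- `u ∈ H¹₀(Q)` with gradient `G`, both extended by zero: `(u, G)` is the limit in `L²` of
`(f_k, ∇ f_k)` for smooth `f_k` with compact support inside `Q`. -/
def IsH10 (u : Sp d → ℝ) (G : Sp d → Sp d) : Prop :=
  MemLp u 2 ∧ MemLp G 2 ∧
  ∃ f : ℕ → Sp d → ℝ,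
    (∀ k, ContDiff ℝ (⊤ : ℕ∞) (f k) ∧ HasCompactSupport (f k) ∧ tsupport (f k) ⊆ cube d) ∧
    Tendsto (fun k => eLpNorm (f k - u) 2 volume) atTop (𝓝 0) ∧
    Tendsto (fun k => eLpNorm (gradient (f k) - G) 2 volume) atTop (𝓝 0)

/-- Weak convergence in `L²(ℝ^d)`. -/
def WeakL2 (f : ℕ → Sp d → ℝ) (u : Sp d → ℝ) : Prop :=
  ∀ g : Sp d → ℝ, MemLp g 2 → Tendsto (fun k => ∫ x, f k x * g x) atTop (𝓝 (∫ x, u x * g x))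

/-- Weak two-scale convergence at `ω`, along the sequence `ε_k`, of `W k x z = w_{ε_k}(ε_k x, z)` to
`w ∈ L²(ℝ^d; L²_cov)`. -/
def TwoScale (P : Measure (Env d)) (Φ : Set (Field d)) (ω : Env d) (ε : ℕ → ℝ)
    (W : ℕ → Lat d → Lat d → ℝ) (w : Sp d → Field d) : Prop :=
  MemBochner P (MemCov P) w ∧
  ∀ v : Sp d → ℝ, ContDiff ℝ (⊤ : ℕ∞) v → HasCompactSupport v → ∀ φ ∈ Φ,
    Tendsto
      (fun k => ε k ^ d * ∑' x, v (scaled (ε k) x) *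
        ∑' z, (cond ω x z).toReal * (W k x z * φ (shift x ω) z))
      atTop (𝓝 (∫ x, v x * covInner P (w x) φ))

end RCM

end

/-!
The lattice functions are bounded and supported in a bounded set, so their interpolations have a
weak limit `u` in `L²` along a subsequence (`exists_weakL2_limit`). For the two-scale limit of the
discrete gradients, the Cauchy-Schwarz inequality bounds their pairing with a combination
`∑ c_j v_j(x) φ_j(ω, z)` of products of test functions and fields by the square root of the energy
times that of an average over `Q` of `∑ c_j c_k v_j v_k (φ_j, φ_k)(τ_x ω)`. For typical `ω` this
average converges to the squared norm of the combination in `L²(Q; L²_cov)`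
(`eventually_abs_sum_pairing_le`; the edges leaving `Q` are negligible by `tendsto_boundary_zero`).
Hence the pairings converge along a subsequence to those with some square integrable function
`w(x, ω, z)` (`exists_weak_limit`, `exists_pairing_limit`).

To identify `w`, test with `v(x) b(ω, z)` for a solenoidal field `b`. Summation by parts moves the
discrete derivative to `v` (`pairing_eq_of_div_free`), and Taylor expansion leaves the sums
`ε^d ∑ u^ε(εx) ∂_i v(εx) f(τ_x ω)` with `f = ∑_z ω_{0,z} z_i b(ω, z)`. Here `f` may be replaced by
its mean although `u^ε` is not continuous: by ergodicity, `f` minus its mean is approximated in `L¹`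
by coboundaries of bounded functions (`exists_cobdry_approx`), by the maximal inequality the
approximation holds along almost every realization (`ae_cobdryApprox`), and sums against
coboundaries vanish in the limit because the nearest-neighbour differences of `u^ε` do so in `L¹`
(`tsum_abs_diff_le`). The last point is where the integrability of the path resistance enters: it
controls these differences by the energy and a factor `ε`. It follows that
`∫ w · (v b) = -∑_i ⟨z_i, b⟩ ∫ u ∂_i v` (`tendsto_pairing_sol`).

A linear field `ξ · z` that is orthogonal to all solenoidal fields is potential, and then `ξ = 0`,
since gradients have mean zero. So the vectors `(⟨z_i, b⟩)_i` span `ℝ^d`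
(`exists_dual_combination`), and `u` has a weak gradient in `L²`, which is a combination of sections
of `w`. The function `w - ∇u · z` is orthogonal to all `v b`, hence it agrees with a potential field
`V` as far as pairings with covariant fields are concerned (`exists_gradient_decomposition`). Here
elements of the closed span of gradients need covariant representatives, which exist because the
edges of positive conductance connect the lattice (`exists_covariant_limit`). The test field `1` is
not covariant; against it both sides vanish by antisymmetry (`tendsto_pairing_one`,
`MemCov.covInner_one`).

The function `u` vanishes outside the closed cube, and a dilation followed by a mollification
approximates it by smooth functions with compact support in `Q` (`isH10_of_weak_gradient`). Finally,
the compact embedding, available along `ε⁻¹ ∈ ℕ`, applies to all `ε` after a dilation by a factor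
close to one (`tendsto_interp_of_compactEmbedding`).
-/

noncomputable section

namespace RCM

variable {d : ℕ}

/-! ### Translations, conductances and boxes -/

theorem shift_shift (x y : Lat d) (ω : Env d) : shift x (shift y ω) = shift (y + x) ω := by
  funext e
  refine congrArg ω (Subtype.ext ?_)
  simp only [Edge.shift, Sym2.map_map]
  congr 1
  funext z
  simp [add_assoc]

@[simp] theorem shift_zero (ω : Env d) : shift 0 ω = ω := by
  funext e
  refine congrArg ω (Subtype.ext ?_)
  simp [Edge.shift]

theorem cond_shift_zero (x z : Lat d) (ω : Env d) : cond (shift x ω) 0 z = cond ω x z := by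
  rw [cond_shift, add_zero]

@[simp] theorem cond_zero_right (ω : Env d) (x : Lat d) : cond ω x 0 = 0 := by
  simp [cond, pairCond]

theorem cond_neg (ω : Env d) (x z : Lat d) : cond ω (x + z) (-z) = cond ω x z := by
  simp [cond, Sym2.eq_swap]

theorem pairCond_mk (ω : Env d) (x y : Lat d) : pairCond ω s(x, y) = cond ω x (y - x) := by
  simp [cond]

theorem measurable_pairCond (e : Sym2 (Lat d)) : Measurable fun ω : Env d => pairCond ω e := by
  unfold pairCond
  split_ifs with h
  · exact measurable_const
  · exact measurable_pi_apply _

theorem measurable_cond (x z : Lat d) : Measurable fun ω : Env d => cond ω x z :=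
  measurable_pairCond _

theorem measurable_shift (x : Lat d) : Measurable (shift x : Env d → Env d) :=
  measurable_pi_lambda _ fun _ => measurable_pi_apply _

theorem sqLen_nonneg (z : Lat d) : 0 ≤ sqLen z := Finset.sum_nonneg fun _ _ => sq_nonneg _

theorem one_le_sqLen {z : Lat d} (hz : z ≠ 0) : 1 ≤ sqLen z := by
  obtain ⟨i, hi⟩ := Function.ne_iff.1 hz
  have h1 : (1 : ℝ) ≤ (z i : ℝ) ^ 2 := by
    have : (1 : ℤ) ≤ (z i) ^ 2 := by
      have : 0 < (z i) ^ 2 := by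
        have := sq_pos_of_ne_zero (a := z i) (by simpa using hi)
        exact this
      omega
    exact_mod_cast this
  exact h1.trans (Finset.single_le_sum (f := fun i => (z i : ℝ) ^ 2)
    (fun _ _ => sq_nonneg _) (Finset.mem_univ i))

theorem sq_coord_le_sqLen (z : Lat d) (i : Fin d) : (z i : ℝ) ^ 2 ≤ sqLen z :=
  Finset.single_le_sum (f := fun i => (z i : ℝ) ^ 2) (fun _ _ => sq_nonneg _) (Finset.mem_univ i)

/-- The discrete cube `{-N, …, N}^d`. -/
def box (d N : ℕ) : Finset (Lat d) := Finset.Icc (fun _ => -(N : ℤ)) (fun _ => (N : ℤ))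

theorem mem_box {N : ℕ} {x : Lat d} : x ∈ box d N ↔ ∀ i, |x i| ≤ N := by
  simp only [box, Finset.mem_Icc, Pi.le_def, abs_le]
  exact ⟨fun h i => ⟨h.1 i, h.2 i⟩, fun h => ⟨fun i => (h i).1, fun i => (h i).2⟩⟩

theorem card_box (N : ℕ) : (box d N).card = (2 * N + 1) ^ d := by
  simp only [box, Pi.card_Icc, Int.card_Icc, Finset.prod_const, Finset.card_univ, Fintype.card_fin]
  congr 1
  omega

theorem box_card_pos (N : ℕ) : 0 < (box d N).card := by
  rw [card_box]; positivity

theorem card_box_mul_le (k N : ℕ) (hk : 1 ≤ k) :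
    (box d (k * N)).card ≤ k ^ d * (box d N).card := by
  rw [card_box, card_box, ← mul_pow]
  gcongr
  nlinarith

theorem add_mem_box {M N : ℕ} {x y : Lat d} (hx : x ∈ box d M) (hy : y ∈ box d N) :
    x + y ∈ box d (M + N) := by
  rw [mem_box] at *
  intro i
  have := abs_add_le (x i) (y i)
  have h1 := hx i
  have h2 := hy i
  push_cast
  simp only [Pi.add_apply]
  omega

theorem dist_le_iff_sub_mem_box {N : ℕ} {x y : Lat d} : dist x y ≤ N ↔ x - y ∈ box d N := by
  rw [dist_pi_le_iff (by positivity), mem_box]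
  refine forall_congr' fun i => ?_
  rw [Int.dist_eq, Pi.sub_apply, ← Int.cast_sub, ← Int.cast_abs]
  exact_mod_cast Iff.rfl

/-! ### The maximal inequality -/

/-- Counting form of the maximal inequality, obtained from the Vitali covering lemma in the lattice
with the supremum metric, whose closed balls are the boxes. -/
theorem sum_indicator_exceed_le (F : Lat d → ℝ≥0∞) (t : ℝ≥0∞) (M : ℕ) (E : Finset (Lat d))
    (hE : E ⊆ box d M)
    (h : ∀ x ∈ E, ∃ N ≤ M, t * (box d N).card ≤ ∑ y ∈ box d N, F (x + y)) :
    t * E.card ≤ 5 ^ d * ∑ y ∈ box d (2 * M), F y := by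
  classical
  choose! r hrM hr using h
  obtain ⟨u, huE, hdisj, hcov⟩ := Vitali.exists_disjoint_subfamily_covering_enlargement_closedBall
    (E : Set (Lat d)) (fun x => x) (fun x => (r x : ℝ)) M (fun a ha => by exact_mod_cast hrM a ha)
    5 (by norm_num)
  have hfin : u.Finite := E.finite_toSet.subset huE
  lift u to Finset (Lat d) using hfin
  let B : ℕ → Lat d → Finset (Lat d) := fun N b => (box d N).map (addLeftEmbedding b)
  have hmemB : ∀ N b y, y ∈ B N b ↔ dist y b ≤ N := by
    intro N b y
    rw [dist_le_iff_sub_mem_box]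
    simp only [B, Finset.mem_map, addLeftEmbedding_apply]
    constructor
    · rintro ⟨a, ha, rfl⟩; simpa using ha
    · intro hy; exact ⟨_, hy, by abel⟩
  have hcard : ∀ N b, (B N b).card = (box d N).card := fun N b => Finset.card_map _
  -- by the covering lemma, the fivefold enlargements of the disjoint boxes cover `E`
  have h1 : E ⊆ u.biUnion fun b => B (5 * r b) b := by
    intro x hx
    obtain ⟨b, hb, hsub⟩ := hcov x hx
    have hx' : x ∈ Metric.closedBall b (5 * r b) :=
      hsub (Metric.mem_closedBall_self (by positivity))
    refine Finset.mem_biUnion.2 ⟨b, hb, (hmemB _ _ _).2 ?_⟩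
    simpa using hx'
  have h2 : (E.card : ℝ≥0∞) ≤ ∑ b ∈ u, 5 ^ d * ((box d (r b)).card : ℝ≥0∞) := by
    have : E.card ≤ ∑ b ∈ u, 5 ^ d * (box d (r b)).card :=
      (Finset.card_le_card h1).trans (Finset.card_biUnion_le.trans (Finset.sum_le_sum fun b _ => by
        rw [hcard]; exact card_box_mul_le 5 _ (by norm_num)))
    exact_mod_cast this
  -- the disjoint boxes have centre in `box d M` and radius at most `M`
  have h3 : ∑ b ∈ u, ∑ y ∈ B (r b) b, F y ≤ ∑ y ∈ box d (2 * M), F y := by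
    rw [← Finset.sum_biUnion]
    · refine Finset.sum_le_sum_of_subset fun y hy => ?_
      obtain ⟨b, hb, hyb⟩ := Finset.mem_biUnion.1 hy
      have hb' : b ∈ box d M := hE (huE hb)
      rw [hmemB, dist_le_iff_sub_mem_box] at hyb
      have := add_mem_box hb' hyb
      rw [add_sub_cancel] at this
      rw [mem_box] at this ⊢
      intro i
      have h4 := this i
      have h5 := hrM b (huE hb)
      push_cast at h4 ⊢
      omega
    · intro a ha b hb hab
      have := hdisj ha hb hab
      rw [Function.onFun, Finset.disjoint_left]
      intro y hya hyb
      rw [hmemB] at hya hyb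
      exact Set.disjoint_left.1 this (Metric.mem_closedBall.2 hya) (Metric.mem_closedBall.2 hyb)
  calc t * E.card ≤ t * ∑ b ∈ u, 5 ^ d * ((box d (r b)).card : ℝ≥0∞) := by gcongr
    _ = 5 ^ d * ∑ b ∈ u, t * ((box d (r b)).card : ℝ≥0∞) := by
        rw [← Finset.mul_sum, ← Finset.mul_sum]; ring
    _ ≤ 5 ^ d * ∑ b ∈ u, ∑ y ∈ B (r b) b, F y := by
        gcongr with b hb
        refine (hr b (huE hb)).trans (le_of_eq ?_)
        simp [B, Finset.sum_map]
    _ ≤ _ := by gcongr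

variable {P : Measure (Env d)}

theorem lintegral_comp_shift (hstat : Stationary P) {f : Env d → ℝ≥0∞} (hf : Measurable f)
    (x : Lat d) : ∫⁻ ω, f (shift x ω) ∂P = ∫⁻ ω, f ω ∂P :=
  (hstat x).lintegral_comp hf

/-- The weak type maximal inequality for averages over boxes. -/
theorem mul_measure_exceed_le (hstat : Stationary P) {f : Env d → ℝ≥0∞} (hf : Measurable f)
    (t : ℝ≥0∞) :
    t * P {ω | ∃ N, t * (box d N).card < ∑ x ∈ box d N, f (shift x ω)} ≤ 10 ^ d * ∫⁻ ω, f ω ∂P := by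
  classical
  -- only radii up to `M`; the bound is uniform in `M`
  let A : ℕ → Set (Env d) := fun M =>
    {ω | ∃ N ≤ M, t * (box d N).card < ∑ x ∈ box d N, f (shift x ω)}
  have hmf : ∀ N, Measurable fun ω => ∑ x ∈ box d N, f (shift x ω) := fun N =>
    Finset.measurable_sum _ fun x _ => hf.comp (measurable_shift x)
  have hA : ∀ M, MeasurableSet (A M) := fun M => by
    have : A M = ⋃ N ∈ Set.Iic M, {ω | t * (box d N).card < ∑ x ∈ box d N, f (shift x ω)} := by
      ext ω; simp [A]
    rw [this]
    exact MeasurableSet.biUnion (Set.to_countable _) fun N _ =>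
      measurableSet_lt measurable_const (hmf N)
  have hU : {ω | ∃ N, t * (box d N).card < ∑ x ∈ box d N, f (shift x ω)} = ⋃ M, A M := by
    ext ω
    simp only [A, Set.mem_ofPred_eq, Set.mem_iUnion]
    exact ⟨fun ⟨N, h⟩ => ⟨N, N, le_rfl, h⟩, fun ⟨_, N, _, h⟩ => ⟨N, h⟩⟩
  have hmono : Monotone A := fun M M' h ω ⟨N, hN, h'⟩ => ⟨N, hN.trans h, h'⟩
  rw [hU, hmono.measure_iUnion, ENNReal.mul_iSup]
  refine iSup_le fun M => ?_
  -- the counting inequality along the orbit of `ω`, to be integrated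
  have hpt : ∀ ω, t * ∑ x ∈ box d M, (A M).indicator 1 (shift x ω) ≤
      5 ^ d * ∑ y ∈ box d (2 * M), f (shift y ω) := by
    intro ω
    have : (∑ x ∈ box d M, (A M).indicator (1 : Env d → ℝ≥0∞) (shift x ω)) =
        ((box d M).filter fun x => shift x ω ∈ A M).card := by
      rw [Finset.card_filter]
      push_cast
      exact Finset.sum_congr rfl fun x _ => by simp [Set.indicator_apply]
    rw [this]
    refine sum_indicator_exceed_le _ t M _ (Finset.filter_subset _ _) fun x hx => ?_
    obtain ⟨N, hN, h⟩ := (Finset.mem_filter.1 hx).2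
    refine ⟨N, hN, h.le.trans (le_of_eq ?_)⟩
    simp_rw [shift_shift]
  have hint := lintegral_mono (μ := P) hpt
  have hAm : Measurable ((A M).indicator (1 : Env d → ℝ≥0∞)) := measurable_one.indicator (hA M)
  have hAs : ∀ x : Lat d, Measurable fun ω => (A M).indicator (1 : Env d → ℝ≥0∞) (shift x ω) :=
    fun x => hAm.comp (measurable_shift x)
  have hfs : ∀ x : Lat d, Measurable fun ω => f (shift x ω) := fun x => hf.comp (measurable_shift x)
  rw [lintegral_const_mul _ (Finset.measurable_sum _ fun x _ => hAs x),
    lintegral_const_mul _ (hmf _), lintegral_finsetSum _ fun x _ => hAs x,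
    lintegral_finsetSum _ fun x _ => hfs x] at hint
  simp_rw [lintegral_comp_shift hstat hAm, lintegral_comp_shift hstat hf] at hint
  rw [lintegral_indicator_one (hA M)] at hint
  simp only [Finset.sum_const, nsmul_eq_mul] at hint
  -- the boxes of radius `2 * M` and `M` have comparable volume, so division by the latter is
  -- harmless
  have hc : ((box d (2 * M)).card : ℝ≥0∞) ≤ 2 ^ d * (box d M).card := by
    exact_mod_cast card_box_mul_le 2 M (by norm_num)
  have h0 : ((box d M).card : ℝ≥0∞) ≠ 0 := by exact_mod_cast (box_card_pos M).ne'
  refine (ENNReal.mul_le_mul_iff_right h0 (ENNReal.natCast_ne_top _)).1 ?_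
  calc ((box d M).card : ℝ≥0∞) * (t * P (A M)) = t * ((box d M).card * P (A M)) := by ring
    _ ≤ 5 ^ d * ((box d (2 * M)).card * ∫⁻ ω, f ω ∂P) := hint
    _ ≤ 5 ^ d * (2 ^ d * (box d M).card * ∫⁻ ω, f ω ∂P) := by gcongr
    _ = (box d M).card * (10 ^ d * ∫⁻ ω, f ω ∂P) := by
        rw [show (10 : ℝ≥0∞) = 5 * 2 by norm_num, mul_pow]; ring

/-- If the family `f` contains functions of arbitrarily small integral, then almost surely it
contains, for every `δ`, a function all of whose box averages are at most `δ`. -/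
theorem ae_exists_forall_sum_box_le {ι : Type*} (hstat : Stationary P)
    (f : ι → Env d → ℝ≥0∞) (hf : ∀ j, Measurable (f j))
    (hinf : ∀ η : ℝ≥0∞, 0 < η → ∃ j, ∫⁻ ω, f j ω ∂P < η) :
    ∀ᵐ ω ∂P, ∀ δ : ℝ≥0∞, 0 < δ →
      ∃ j, ∀ N, ∑ x ∈ box d N, f j (shift x ω) ≤ δ * (box d N).card := by
  have key : ∀ m : ℕ, ∀ᵐ ω ∂P,
      ∃ j, ∀ N, ∑ x ∈ box d N, f j (shift x ω) ≤ (m + 1 : ℝ≥0∞)⁻¹ * (box d N).card := by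
    intro m
    have hm0 : (m + 1 : ℝ≥0∞)⁻¹ ≠ 0 := ENNReal.inv_ne_zero.2 (by finiteness)
    have hmt : (m + 1 : ℝ≥0∞)⁻¹ ≠ ∞ := ENNReal.inv_ne_top.2 (by positivity)
    rw [ae_iff]
    by_contra hne
    have hpos : 0 < (m + 1 : ℝ≥0∞)⁻¹ * P {ω | ¬ ∃ j, ∀ N, ∑ x ∈ box d N, f j (shift x ω) ≤
        (m + 1 : ℝ≥0∞)⁻¹ * (box d N).card} := ENNReal.mul_pos hm0 hne
    have hq : 0 < ((m + 1 : ℝ≥0∞)⁻¹ * P {ω | ¬ ∃ j, ∀ N, ∑ x ∈ box d N, f j (shift x ω) ≤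
        (m + 1 : ℝ≥0∞)⁻¹ * (box d N).card}) / 10 ^ d :=
      ENNReal.div_pos hpos.ne' (by finiteness)
    obtain ⟨j, hj⟩ := hinf _ hq
    have h1 := mul_measure_exceed_le hstat (hf j) (m + 1 : ℝ≥0∞)⁻¹
    have h2 : (m + 1 : ℝ≥0∞)⁻¹ * P {ω | ¬ ∃ j, ∀ N, ∑ x ∈ box d N, f j (shift x ω) ≤
        (m + 1 : ℝ≥0∞)⁻¹ * (box d N).card} ≤ 10 ^ d * ∫⁻ ω, f j ω ∂P := by
      refine le_trans (mul_le_mul' le_rfl (measure_mono ?_)) h1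
      intro ω hω
      simp only [Set.mem_ofPred_eq, not_exists, not_forall, not_le] at hω
      exact hω j
    rw [ENNReal.lt_div_iff_mul_lt (by simp) (by simp)] at hj
    exact absurd (h2.trans_lt (by rwa [mul_comm])) (lt_irrefl _)
  filter_upwards [ae_all_iff.2 key] with ω hω δ hδ
  obtain ⟨m, hm⟩ := ENNReal.exists_inv_nat_lt hδ.ne'
  obtain ⟨j, hj⟩ := hω m
  refine ⟨j, fun N => (hj N).trans ?_⟩
  gcongr
  refine le_trans ?_ hm.le
  gcongr
  exact le_self_add

/-- The box averages of an integrable function are almost surely bounded: apply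
`ae_exists_forall_sum_box_le` to small multiples of the function. -/
theorem ae_exists_forall_sum_box_le_of_lt_top (hstat : Stationary P)
    {f : Env d → ℝ≥0∞} (hf : Measurable f) (hfin : ∫⁻ ω, f ω ∂P < ∞) :
    ∀ᵐ ω ∂P, ∃ C : ℝ≥0, ∀ N, ∑ x ∈ box d N, f (shift x ω) ≤ C * (box d N).card := by
  have := ae_exists_forall_sum_box_le hstat (fun (j : ℕ) ω => (j + 1 : ℝ≥0∞)⁻¹ * f ω)
    (fun j => hf.const_mul _) (fun η hη => by
      have hη' : (η / (∫⁻ ω, f ω ∂P + 1)) ≠ 0 :=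
        (ENNReal.div_pos hη.ne' (by finiteness)).ne'
      obtain ⟨m, hm⟩ := ENNReal.exists_inv_nat_lt hη'
      refine ⟨m, ?_⟩
      rw [lintegral_const_mul _ hf]
      have hm' : (m + 1 : ℝ≥0∞)⁻¹ < η / (∫⁻ ω, f ω ∂P + 1) :=
        lt_of_le_of_lt (by gcongr; exact le_self_add) hm
      rw [ENNReal.lt_div_iff_mul_lt (by left; simp) (by left; finiteness)] at hm'
      refine lt_of_le_of_lt ?_ hm'
      gcongr
      exact le_self_add)
  filter_upwards [this] with ω hω
  obtain ⟨j, hj⟩ := hω 1 one_pos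
  refine ⟨j + 1, fun N => ?_⟩
  have := hj N
  rw [← Finset.mul_sum, one_mul] at this
  have h0 : (j + 1 : ℝ≥0∞) ≠ 0 := by positivity
  rw [mul_comm, ← div_eq_mul_inv, ENNReal.div_le_iff h0 (by finiteness)] at this
  push_cast
  rwa [mul_comm]

/-! ### Density of coboundaries -/

theorem ae_forall_shift (hstat : Stationary P) {p : Env d → Prop} (h : ∀ᵐ ω ∂P, p ω) :
    ∀ᵐ ω ∂P, ∀ x, p (shift x ω) :=
  ae_all_iff.2 fun x => (hstat x).quasiMeasurePreserving.ae h

/-- A function that is almost surely invariant under translations is almost surely constant; the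
invariance of its level sets has to be made strict first. -/
theorem exists_ae_eq_const_of_invariant [IsProbabilityMeasure P]
    (herg : ShiftErgodic P) {h : Env d → ℝ} (hm : Measurable h)
    (hinv : ∀ x, (fun ω => h (shift x ω)) =ᵐ[P] h) : ∃ c, h =ᵐ[P] fun _ => c := by
  refine Filter.exists_eventuallyEq_const_of_forall_separating MeasurableSet fun U hU => ?_
  -- a strictly invariant event that almost surely agrees with `h ∈ U`
  let A : Set (Env d) := {ω | ∀ x, h (shift x ω) ∈ U}
  have hA : MeasurableSet A := by
    have : A = ⋂ x, (fun ω => h (shift x ω)) ⁻¹' U := by ext; simp [A]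
    rw [this]
    exact MeasurableSet.iInter fun x => (hm.comp (measurable_shift x)) hU
  have hAinv : ∀ y, shift y ⁻¹' A = A := by
    intro y
    ext ω
    simp only [A, Set.mem_preimage, Set.mem_ofPred_eq, shift_shift]
    exact ⟨fun H x => by simpa using H (x - y), fun H x => H _⟩
  have hae : ∀ᵐ ω ∂P, (ω ∈ A ↔ h ω ∈ U) := by
    filter_upwards [ae_all_iff.2 hinv] with ω hω
    simp only [A, Set.mem_ofPred_eq, hω, forall_const]
  rcases herg A hA hAinv with h0 | h1
  · right
    filter_upwards [hae, measure_eq_zero_iff_ae_notMem.1 h0] with ω h1 h2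
    rwa [← h1]
  · left
    filter_upwards [hae, (prob_compl_eq_zero_iff hA).2 h1] with ω h1 h2
    rw [← h1]
    simpa using h2

/-- The sum of the coboundaries `g_i ∘ τ_{e_i} - g_i`. -/
def cobdry (g : Fin d → Env d → ℝ) (ω : Env d) : ℝ :=
  ∑ i, (g i (shift (Pi.single i 1) ω) - g i ω)

/-- Families of bounded measurable functions indexed by the directions. -/
structure BddFamily (g : Fin d → Env d → ℝ) : Prop where
  measurable : ∀ i, Measurable (g i)
  bounded : ∃ K : ℝ, ∀ i ω, |g i ω| ≤ K

theorem BddFamily.measurable_cobdry {g : Fin d → Env d → ℝ} (hg : BddFamily g) :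
    Measurable (cobdry g) :=
  Finset.measurable_sum _ fun i _ =>
    ((hg.measurable i).comp (measurable_shift _)).sub (hg.measurable i)

theorem BddFamily.memLp_cobdry [IsFiniteMeasure P] {g : Fin d → Env d → ℝ} (hg : BddFamily g)
    (p : ℝ≥0∞) : MemLp (cobdry g) p P := by
  obtain ⟨K, hK⟩ := hg.bounded
  refine MemLp.of_bound hg.measurable_cobdry.aestronglyMeasurable (∑ _i : Fin d, (K + K)) ?_
  refine Eventually.of_forall fun ω => ?_
  refine (norm_sum_le _ _).trans (Finset.sum_le_sum fun i _ => ?_)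
  exact (norm_sub_le _ _).trans (add_le_add (hK _ _) (hK _ _))

/-- The subspace of `L²` consisting of the coboundaries of bounded functions. -/
def cobdrySpace (P : Measure (Env d)) : Submodule ℝ (Lp ℝ 2 P) where
  carrier := {h | ∃ g, BddFamily g ∧ h =ᵐ[P] cobdry g}
  add_mem' := by
    rintro h h' ⟨g, hg, hh⟩ ⟨g', hg', hh'⟩
    obtain ⟨K, hK⟩ := hg.bounded
    obtain ⟨K', hK'⟩ := hg'.bounded
    refine ⟨fun i ω => g i ω + g' i ω, ⟨fun i => (hg.measurable i).add (hg'.measurable i),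
      K + K', fun i ω => (abs_add_le _ _).trans (add_le_add (hK _ _) (hK' _ _))⟩, ?_⟩
    filter_upwards [Lp.coeFn_add h h', hh, hh'] with ω h1 h2 h3
    rw [h1, Pi.add_apply, h2, h3, cobdry, cobdry, cobdry, ← Finset.sum_add_distrib]
    exact Finset.sum_congr rfl fun i _ => by ring
  zero_mem' := ⟨fun _ _ => 0, ⟨fun _ => measurable_const, 0, by simp⟩, by
    filter_upwards [Lp.coeFn_zero ℝ 2 P] with ω h1
    rw [h1]; simp [cobdry]⟩
  smul_mem' := by
    rintro c h ⟨g, hg, hh⟩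
    obtain ⟨K, hK⟩ := hg.bounded
    refine ⟨fun i ω => c * g i ω, ⟨fun i => (hg.measurable i).const_mul _, |c| * K, fun i ω => by
      rw [abs_mul]; gcongr; exact hK _ _⟩, ?_⟩
    filter_upwards [Lp.coeFn_smul c h, hh] with ω h1 h2
    rw [h1, Pi.smul_apply, h2, cobdry, cobdry, smul_eq_mul, Finset.mul_sum]
    exact Finset.sum_congr rfl fun i _ => by ring

/-- A function orthogonal to the coboundaries is invariant, by testing with the coboundaries of
indicator functions. -/
theorem ae_eq_comp_shift_of_mem_orthogonal [IsProbabilityMeasure P] (hstat : Stationary P)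
    {h : Lp ℝ 2 P} (hh : h ∈ (cobdrySpace P)ᗮ) (i : Fin d) :
    (fun ω => h (shift (Pi.single i 1) ω)) =ᵐ[P] h := by
  set e : Lat d := Pi.single i 1
  have hint : Integrable h P := (Lp.memLp h).integrable (by norm_num)
  -- the coboundary of the indicator function of `s` in the direction `i` is orthogonal to `h`
  have key : ∀ s, MeasurableSet s → ∫ ω in s, h (shift (-e) ω) ∂P = ∫ ω in s, h ω ∂P := by
    intro s hs
    let g : Fin d → Env d → ℝ := fun j => if j = i then s.indicator 1 else 0
    have hg : BddFamily g := by
      refine ⟨fun j => ?_, 1, fun j ω => ?_⟩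
      · by_cases hj : j = i
        · simp only [g, hj, if_true]; exact measurable_one.indicator hs
        · simp only [g, hj, if_false]; exact measurable_zero
      · by_cases hj : j = i
        · simp only [g, hj, if_true]; by_cases hω : ω ∈ s <;> simp [hω]
        · simp [g, hj]
    have hcob : cobdry g = fun ω => s.indicator 1 (shift e ω) - s.indicator 1 ω := by
      funext ω
      rw [cobdry, Finset.sum_eq_single i]
      · simp [g, e]
      · intro j _ hj; simp [g, hj]
      · simp
    have hmem : (hg.memLp_cobdry (P := P) 2).toLp _ ∈ cobdrySpace P :=
      ⟨g, hg, (hg.memLp_cobdry 2).coeFn_toLp⟩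
    have h0 := (Submodule.mem_orthogonal _ _).1 hh _ hmem
    rw [L2.inner_def] at h0
    have h1 : ∫ ω, h ω * (s.indicator 1 (shift e ω) - s.indicator 1 ω) ∂P = 0 := by
      rw [← h0]
      refine integral_congr_ae ?_
      filter_upwards [(hg.memLp_cobdry (P := P) 2).coeFn_toLp] with ω hω
      rw [hω, hcob]
      simp
    have hi1 : Integrable (fun ω => h ω * s.indicator 1 ω) P := by
      have := hint.indicator hs
      refine this.congr (Eventually.of_forall fun ω => ?_)
      by_cases hω : ω ∈ s <;> simp [hω]
    have hi2 : Integrable (fun ω => h ω * s.indicator 1 (shift e ω)) P := by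
      have := hint.indicator (measurable_shift e hs)
      refine this.congr (Eventually.of_forall fun ω => ?_)
      by_cases hω : shift e ω ∈ s <;> simp [hω]
    simp_rw [mul_sub] at h1
    rw [integral_sub hi2 hi1, sub_eq_zero] at h1
    have h2 : ∫ ω, h ω * s.indicator 1 ω ∂P = ∫ ω in s, h ω ∂P := by
      rw [← integral_indicator hs]
      refine integral_congr_ae (Eventually.of_forall fun ω => ?_)
      by_cases hω : ω ∈ s <;> simp [hω]
    have h3 : ∫ ω, h ω * s.indicator 1 (shift e ω) ∂P = ∫ ω in s, h (shift (-e) ω) ∂P := by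
      rw [← integral_indicator hs]
      have hmp := (hstat (-e))
      have hF : AEStronglyMeasurable (fun ω => h ω * s.indicator 1 (shift e ω))
          (P.map (shift (-e))) := by
        rw [hmp.map_eq]; exact hi2.aestronglyMeasurable
      have := integral_map hmp.measurable.aemeasurable hF
      rw [hmp.map_eq] at this
      rw [this]
      refine integral_congr_ae (Eventually.of_forall fun ω => ?_)
      simp only [shift_shift, neg_add_cancel, shift_zero]
      by_cases hω : ω ∈ s <;> simp [hω]
    rw [← h2, ← h1, h3]
  have hint' : Integrable (fun ω => h (shift (-e) ω)) P :=
    (hstat (-e)).integrable_comp_of_integrable hint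
  have hae : (fun ω => h (shift (-e) ω)) =ᵐ[P] h :=
    hint'.ae_eq_of_forall_setIntegral_eq _ _ hint fun s hs _ => key s hs
  have := (hstat e).quasiMeasurePreserving.ae_eq_comp hae
  filter_upwards [this] with ω hω
  simp only [Function.comp_apply, shift_shift, add_neg_cancel, shift_zero] at hω
  exact hω.symm

theorem exists_ae_eq_const_of_mem_orthogonal [IsProbabilityMeasure P] (hstat : Stationary P)
    (herg : ShiftErgodic P) {h : Lp ℝ 2 P} (hh : h ∈ (cobdrySpace P)ᗮ) :
    ∃ c : ℝ, h =ᵐ[P] fun _ => c := by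
  have hall : ∀ x : Lat d, (fun ω => h (shift x ω)) =ᵐ[P] h := by
    -- the translations that leave `h` invariant form a group containing the unit vectors
    let G : AddSubgroup (Lat d) :=
      { carrier := {x | (fun ω => h (shift x ω)) =ᵐ[P] h}
        zero_mem' := by simp
        add_mem' := by
          intro x y hx hy
          have := (hstat x).quasiMeasurePreserving.ae_eq_comp hy
          change _ =ᵐ[P] _
          have hx' : _ =ᵐ[P] _ := hx
          filter_upwards [this, hx'] with ω h1 h2
          simp only [Function.comp_apply, shift_shift] at h1
          rw [h1, h2]
        neg_mem' := by
          intro x hx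
          have := (hstat (-x)).quasiMeasurePreserving.ae_eq_comp hx
          change _ =ᵐ[P] _
          filter_upwards [this] with ω h1
          simp only [Function.comp_apply, shift_shift, neg_add_cancel, shift_zero] at h1
          exact h1.symm }
    intro x
    have hx : x = ∑ i, x i • (Pi.single i 1 : Lat d) := by
      funext j
      simp [Finset.sum_apply, Pi.single_apply]
    have : x ∈ G := by
      rw [hx]
      exact sum_mem fun i _ => zsmul_mem (ae_eq_comp_shift_of_mem_orthogonal hstat hh i) _
    exact this
  obtain ⟨h', hm', hae⟩ : ∃ h' : Env d → ℝ, Measurable h' ∧ h =ᵐ[P] h' :=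
    ⟨_, (Lp.stronglyMeasurable h).measurable, EventuallyEq.rfl⟩
  obtain ⟨c, hc⟩ := exists_ae_eq_const_of_invariant herg hm' fun x => by
    filter_upwards [hall x, hae, (hstat x).quasiMeasurePreserving.ae_eq_comp hae] with ω h1 h2 h3
    simp only [Function.comp_apply] at h3
    rw [← h3, h1, h2]
  exact ⟨c, hae.trans hc⟩

/-- By ergodicity, centred functions are orthogonal to the orthogonal complement of the
coboundaries, which consists of constants. -/
theorem sub_integral_mem_closure_cobdrySpace [IsProbabilityMeasure P] (hstat : Stationary P)
    (herg : ShiftErgodic P) {s : Env d → ℝ} (hs : MemLp s 2 P)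
    (hs' : MemLp (fun ω => s ω - ∫ ω', s ω' ∂P) 2 P) :
    hs'.toLp _ ∈ (cobdrySpace P).topologicalClosure := by
  rw [← Submodule.orthogonal_orthogonal_eq_closure, Submodule.mem_orthogonal]
  intro h hh
  obtain ⟨c, hc⟩ := exists_ae_eq_const_of_mem_orthogonal hstat herg hh
  rw [L2.inner_def]
  have : ∫ ω, inner ℝ (h ω) (hs'.toLp _ ω) ∂P = ∫ ω, c * (s ω - ∫ ω', s ω' ∂P) ∂P := by
    refine integral_congr_ae ?_
    filter_upwards [hc, hs'.coeFn_toLp] with ω h1 h2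
    rw [h1, h2]
    simp [mul_comm]
  rw [this, integral_const_mul, integral_sub (hs.integrable (by norm_num)) (integrable_const _)]
  simp

/-- Up to an arbitrarily small error in `L¹`, an integrable function is its mean plus the
coboundary of bounded functions. -/
theorem exists_cobdry_approx [IsProbabilityMeasure P] (hstat : Stationary P)
    (herg : ShiftErgodic P) {f : Env d → ℝ} (hf : Integrable f P) {η : ℝ≥0∞} (hη : 0 < η) :
    ∃ g, BddFamily g ∧ ∫⁻ ω, ‖f ω - ∫ ω', f ω' ∂P - cobdry g ω‖ₑ ∂P < η := by
  have hη3 : η / 3 ≠ 0 := (ENNReal.div_pos hη.ne' (by norm_num)).ne'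
  have hf1 : MemLp f 1 P := memLp_one_iff_integrable.2 hf
  obtain ⟨s, hs, hs1⟩ := hf1.exists_simpleFunc_eLpNorm_sub_lt (by norm_num) hη3
  obtain ⟨K, hK⟩ := s.exists_forall_norm_le
  have hs2 : MemLp s 2 P := MemLp.of_bound s.aestronglyMeasurable K (Eventually.of_forall hK)
  have hs' : MemLp (fun ω => s ω - ∫ ω', s ω' ∂P) 2 P := hs2.sub (memLp_const _)
  have hcl := sub_integral_mem_closure_cobdrySpace hstat herg hs2 hs'
  obtain ⟨h, ⟨g, hg, hhg⟩, hd⟩ := EMetric.mem_closure_iff.1 hcl (η / 3) (pos_iff_ne_zero.2 hη3)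
  refine ⟨g, hg, ?_⟩
  rw [Lp.edist_def] at hd
  -- three errors: of the simple function, of its coboundary approximation, and of its mean
  have hd1 : ∫⁻ ω, ‖s ω - ∫ ω', s ω' ∂P - cobdry g ω‖ₑ ∂P < η / 3 := by
    have e1 : eLpNorm (⇑(hs'.toLp _) - ⇑h) 2 P =
        eLpNorm (fun ω => s ω - ∫ ω', s ω' ∂P - cobdry g ω) 2 P := by
      refine eLpNorm_congr_ae ?_
      filter_upwards [hs'.coeFn_toLp, hhg] with ω h1 h2
      rw [Pi.sub_apply, h1, h2]
    rw [e1] at hd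
    rw [← eLpNorm_one_eq_lintegral_enorm]
    exact (eLpNorm_le_eLpNorm_of_exponent_le (by norm_num)
      (hs'.aestronglyMeasurable.sub hg.measurable_cobdry.aestronglyMeasurable)).trans_lt hd
  have hs1' : ∫⁻ ω, ‖f ω - s ω‖ₑ ∂P < η / 3 := by
    rwa [eLpNorm_one_eq_lintegral_enorm] at hs
  have hc : ‖∫ ω', s ω' ∂P - ∫ ω', f ω' ∂P‖ₑ < η / 3 := by
    rw [← integral_sub (hs2.integrable (by norm_num)) hf]
    refine (enorm_integral_le_lintegral_enorm _).trans_lt (lt_of_eq_of_lt ?_ hs1')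
    refine lintegral_congr fun ω => ?_
    rw [← enorm_neg, neg_sub]
  calc ∫⁻ ω, ‖f ω - ∫ ω', f ω' ∂P - cobdry g ω‖ₑ ∂P
      ≤ ∫⁻ ω, (‖f ω - s ω‖ₑ + (‖s ω - ∫ ω', s ω' ∂P - cobdry g ω‖ₑ +
          ‖∫ ω', s ω' ∂P - ∫ ω', f ω' ∂P‖ₑ)) ∂P := by
        refine lintegral_mono fun ω => ?_
        have : f ω - ∫ ω', f ω' ∂P - cobdry g ω = (f ω - s ω) +
          ((s ω - ∫ ω', s ω' ∂P - cobdry g ω) + (∫ ω', s ω' ∂P - ∫ ω', f ω' ∂P)) := by ring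
        rw [this]
        exact (enorm_add_le _ _).trans (add_le_add le_rfl (enorm_add_le _ _))
    _ = ∫⁻ ω, ‖f ω - s ω‖ₑ ∂P + (∫⁻ ω, ‖s ω - ∫ ω', s ω' ∂P - cobdry g ω‖ₑ ∂P +
          ‖∫ ω', s ω' ∂P - ∫ ω', f ω' ∂P‖ₑ) := by
        rw [lintegral_add_left' (f := fun ω => ‖f ω - s ω‖ₑ)
            (hf.aestronglyMeasurable.sub s.aestronglyMeasurable).enorm,
          lintegral_add_right _ measurable_const]
        simp
    _ < η / 3 + (η / 3 + η / 3) := ENNReal.add_lt_add hs1' (ENNReal.add_lt_add hd1 hc)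
    _ = η := by rw [← add_assoc, ENNReal.add_thirds]

/-- The averages of `f` along `ω` are approximated, uniformly in the size of the box, by those of
a constant `c` plus a coboundary of bounded functions. -/
def CobdryApprox (f : Env d → ℝ) (c : ℝ) (ω : Env d) : Prop :=
  ∀ δ : ℝ, 0 < δ → ∃ g, BddFamily g ∧
    ∀ N, ∑ x ∈ box d N, |f (shift x ω) - c - cobdry g (shift x ω)| ≤ δ * (box d N).card

/-- The approximation by coboundaries in `L¹` holds along almost every realization, by the maximal
inequality applied to the error. -/
theorem ae_cobdryApprox [IsProbabilityMeasure P] (hstat : Stationary P)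
    (herg : ShiftErgodic P) {f : Env d → ℝ} (hm : Measurable f) (hf : Integrable f P) :
    ∀ᵐ ω ∂P, CobdryApprox f (∫ ω', f ω' ∂P) ω := by
  have := ae_exists_forall_sum_box_le hstat
    (fun (g : {g : Fin d → Env d → ℝ // BddFamily g}) ω => ‖f ω - ∫ ω', f ω' ∂P - cobdry g.1 ω‖ₑ)
    (fun g => ((hm.sub measurable_const).sub g.2.measurable_cobdry).enorm)
    (fun η hη => by
      obtain ⟨g, hg, h⟩ := exists_cobdry_approx hstat herg hf hη
      exact ⟨⟨g, hg⟩, h⟩)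
  filter_upwards [this] with ω hω δ hδ
  obtain ⟨⟨g, hg⟩, h⟩ := hω (ENNReal.ofReal δ) (ENNReal.ofReal_pos.2 hδ)
  refine ⟨g, hg, fun N => ?_⟩
  have h1 := h N
  simp_rw [Real.enorm_eq_ofReal_abs] at h1
  rw [← ENNReal.ofReal_sum_of_nonneg (fun _ _ => abs_nonneg _), ← ENNReal.ofReal_natCast,
    ← ENNReal.ofReal_mul hδ.le] at h1
  exact (ENNReal.ofReal_le_ofReal_iff (by positivity)).1 h1

/-! ### The covariant space as an `L²` space -/

/-- The measure `ω_{0,z} dℙ(ω)` on pairs `(ω, z)`; the norm and scalar product of `L²_cov` are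
those of `L²` of this measure. -/
def edgeMeasure (P : Measure (Env d)) : Measure (Env d × Lat d) :=
  (P.prod Measure.count).withDensity fun p => cond p.1 0 p.2

theorem measurable_uncurry {α β : Type*} [MeasurableSpace α] [MeasurableSpace β]
    {F : α → Lat d → β} (h : ∀ z, Measurable fun a => F a z) :
    Measurable fun p : α × Lat d => F p.1 p.2 :=
  measurable_from_prod_countable_left h

theorem measurable_cond_origin : Measurable fun p : Env d × Lat d => cond p.1 0 p.2 :=
  measurable_uncurry fun z => measurable_cond 0 z

instance [SFinite P] : SFinite (edgeMeasure P) := by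
  unfold edgeMeasure; infer_instance

theorem lintegral_edgeMeasure {F : Env d × Lat d → ℝ≥0∞} (hF : Measurable F) :
    ∫⁻ p, F p ∂(edgeMeasure P) = ∫⁻ ω, ∑' z, cond ω 0 z * F (ω, z) ∂P := by
  rw [edgeMeasure, lintegral_withDensity_eq_lintegral_mul _ measurable_cond_origin hF,
    lintegral_prod _ (measurable_cond_origin.mul hF).aemeasurable]
  simp [lintegral_count]

theorem ae_edgeMeasure_of_ae {p : Env d × Lat d → Prop}
    (h : ∀ᵐ ω ∂P, ∀ z, p (ω, z)) : ∀ᵐ q ∂(edgeMeasure P), p q := by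
  have h1 : ∀ᵐ q ∂(P.prod (Measure.count : Measure (Lat d))), ∀ z, p (q.1, z) :=
    Measure.quasiMeasurePreserving_fst.ae h
  exact (withDensity_absolutelyContinuous _ _).ae_le (h1.mono fun q hq => hq q.2)

theorem ae_of_ae_edgeMeasure {p : Env d × Lat d → Prop}
    (h : ∀ᵐ q ∂(edgeMeasure P), p q) : ∀ᵐ ω ∂P, ∀ z, cond ω 0 z ≠ 0 → p (ω, z) := by
  rw [edgeMeasure, ae_withDensity_iff measurable_cond_origin] at h
  filter_upwards [Measure.ae_ae_of_ae_prod h] with ω hω z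
  exact (Measure.ae_count_iff.1 hω) z

theorem covNormSq_eq_lintegral {φ : Field d}
    (hφ : ∀ z, Measurable fun ω => φ ω z) :
    covNormSq P φ = ∫⁻ p, ENNReal.ofReal (φ p.1 p.2 ^ 2) ∂(edgeMeasure P) := by
  rw [lintegral_edgeMeasure ((measurable_uncurry hφ).pow_const 2).ennreal_ofReal]
  rfl

theorem ofReal_sq_eq (a : ℝ) : ENNReal.ofReal (a ^ 2) = ‖a‖ₑ ^ (2 : ℝ) := by
  rw [Real.enorm_eq_ofReal_abs, ENNReal.rpow_two, ← ENNReal.ofReal_pow (abs_nonneg _), sq_abs]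

theorem eLpNorm_two_sq {α : Type*} [MeasurableSpace α] (μ : Measure α) (f : α → ℝ) :
    eLpNorm f 2 μ ^ 2 = ∫⁻ x, ENNReal.ofReal (f x ^ 2) ∂μ := by
  simp_rw [ofReal_sq_eq]
  rw [eLpNorm_eq_lintegral_rpow_enorm_toReal (by norm_num) (by norm_num)]
  simp only [ENNReal.toReal_ofNat]
  rw [← ENNReal.rpow_natCast, ← ENNReal.rpow_mul]
  simp

theorem covNormSq_eq_eLpNorm {φ : Field d}
    (hφ : ∀ z, Measurable fun ω => φ ω z) :
    covNormSq P φ = eLpNorm (fun p : Env d × Lat d => φ p.1 p.2) 2 (edgeMeasure P) ^ 2 := by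
  rw [covNormSq_eq_lintegral hφ, eLpNorm_two_sq]

theorem memLp_of_covNormSq_lt_top {φ : Field d}
    (hφ : ∀ z, Measurable fun ω => φ ω z) (h : covNormSq P φ < ∞) :
    MemLp (fun p : Env d × Lat d => φ p.1 p.2) 2 (edgeMeasure P) := by
  refine ⟨(measurable_uncurry hφ).aestronglyMeasurable, ?_⟩
  rw [covNormSq_eq_eLpNorm hφ] at h
  by_contra hne
  rw [not_lt, top_le_iff] at hne
  simp [hne] at h

theorem MemCov.memLp {φ : Field d} (hφ : MemCov P φ) :
    MemLp (fun p : Env d × Lat d => φ p.1 p.2) 2 (edgeMeasure P) :=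
  memLp_of_covNormSq_lt_top hφ.measurable hφ.norm_lt_top

theorem measurable_tsum_cond_mul {F : Env d → Lat d → ℝ≥0∞} (hF : ∀ z, Measurable fun ω => F ω z) :
    Measurable fun ω => ∑' z, cond ω 0 z * F ω z :=
  Measurable.tsum fun z => (measurable_cond 0 z).mul (hF z)

theorem lintegral_tsum_cond_lt_top (hmom : UpperMoment P) :
    ∫⁻ ω, ∑' z, cond ω 0 z ∂P < ∞ := by
  refine (lintegral_mono fun ω => ?_).trans_lt hmom
  refine ENNReal.tsum_le_tsum fun z => ?_
  by_cases hz : z = 0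
  · simp [hz]
  · calc cond ω 0 z = cond ω 0 z * 1 := (mul_one _).symm
      _ ≤ _ := by
        gcongr
        rw [← ENNReal.ofReal_one]
        exact ENNReal.ofReal_le_ofReal (one_le_sqLen hz)

theorem isFiniteMeasure_edgeMeasure (hmom : UpperMoment P) :
    IsFiniteMeasure (edgeMeasure P) := by
  refine ⟨?_⟩
  have := lintegral_edgeMeasure (P := P) (F := fun _ => 1) measurable_const
  rw [lintegral_one] at this
  rw [this]
  simpa using lintegral_tsum_cond_lt_top hmom

theorem ae_cond_lt_top (hmom : UpperMoment P) (hstat : Stationary P) :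
    ∀ᵐ ω ∂P, ∀ x z, cond ω x z < ∞ := by
  have h0 : ∀ᵐ ω ∂P, ∀ z, cond ω 0 z < ∞ := by
    have hm : Measurable fun ω : Env d => ∑' z, cond ω 0 z :=
      Measurable.tsum fun z => measurable_cond 0 z
    filter_upwards [ae_lt_top hm (lintegral_tsum_cond_lt_top hmom).ne] with ω hω z
    exact (ENNReal.le_tsum z).trans_lt hω
  filter_upwards [ae_forall_shift hstat h0] with ω hω x z
  rw [← cond_shift_zero]
  exact hω x z

theorem integral_edgeMeasure [SFinite P] (hmom : UpperMoment P) (hstat : Stationary P)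
    {F : Env d × Lat d → ℝ} (hF : Integrable F (edgeMeasure P)) :
    ∫ p, F p ∂(edgeMeasure P) = ∫ ω, ∑' z, (cond ω 0 z).toReal * F (ω, z) ∂P := by
  have hlt : ∀ᵐ q ∂(P.prod (Measure.count : Measure (Lat d))), cond q.1 0 q.2 < ∞ :=
    Measure.quasiMeasurePreserving_fst.ae (p := fun ω => ∀ z, cond ω 0 z < ∞)
      ((ae_cond_lt_top hmom hstat).mono fun ω h => h 0) |>.mono fun q hq => hq q.2
  have hint := (integrable_withDensity_iff_integrable_smul' measurable_cond_origin hlt).1 hF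
  rw [edgeMeasure, integral_withDensity_eq_integral_toReal_smul measurable_cond_origin hlt,
    integral_prod _ hint]
  refine integral_congr_ae ?_
  filter_upwards [hint.prod_right_ae] with ω hω
  rw [integral_countable hω]
  simp [Measure.real]

theorem integrable_tsum_of_integrable_edgeMeasure [SFinite P] (hmom : UpperMoment P)
    (hstat : Stationary P) {F : Env d × Lat d → ℝ} (hF : Integrable F (edgeMeasure P)) :
    Integrable (fun ω => ∑' z, (cond ω 0 z).toReal * F (ω, z)) P := by
  have hlt : ∀ᵐ q ∂(P.prod (Measure.count : Measure (Lat d))), cond q.1 0 q.2 < ∞ :=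
    Measure.quasiMeasurePreserving_fst.ae (p := fun ω => ∀ z, cond ω 0 z < ∞)
      ((ae_cond_lt_top hmom hstat).mono fun ω h => h 0) |>.mono fun q hq => hq q.2
  have hint := (integrable_withDensity_iff_integrable_smul' measurable_cond_origin hlt).1 hF
  refine hint.integral_prod_left.congr ?_
  filter_upwards [hint.prod_right_ae] with ω hω
  rw [integral_countable hω]
  simp [Measure.real]

theorem covInner_eq_integral [SFinite P] (hmom : UpperMoment P) (hstat : Stationary P)
    {φ ψ : Field d} (hφ : MemLp (fun p : Env d × Lat d => φ p.1 p.2) 2 (edgeMeasure P))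
    (hψ : MemLp (fun p : Env d × Lat d => ψ p.1 p.2) 2 (edgeMeasure P)) :
    covInner P φ ψ = ∫ p, φ p.1 p.2 * ψ p.1 p.2 ∂(edgeMeasure P) := by
  exact (integral_edgeMeasure hmom hstat (F := fun p => φ p.1 p.2 * ψ p.1 p.2)
    (hφ.integrable_mul hψ)).symm

theorem memCov_coordField (hmom : UpperMoment P) (i : Fin d) : MemCov P (coordField i) := by
  refine ⟨fun z => measurable_const, fun ω x z => by simp [coordField], ?_⟩
  refine (lintegral_mono fun ω => ?_).trans_lt hmom
  refine ENNReal.tsum_le_tsum fun z => ?_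
  gcongr
  exact sq_coord_le_sqLen z i

theorem IsLocal.measurable {g : Env d → ℝ} (hg : IsLocal g) : Measurable g :=
  hg.continuous.measurable

theorem grad_covariant (g : Env d → ℝ) (ω : Env d) (x z : Lat d) :
    grad g ω (x + z) - grad g ω x = grad g (shift x ω) z := by
  simp only [grad, shift_shift]; ring

theorem memCov_grad (hmom : UpperMoment P) {g : Env d → ℝ} (hg : IsLocal g) :
    MemCov P (grad g) := by
  refine ⟨fun z => (hg.measurable.comp (measurable_shift z)).sub hg.measurable,
    grad_covariant g, ?_⟩
  obtain ⟨C, hC⟩ := hg.bounded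
  have hb : ∀ ω z, ENNReal.ofReal (grad g ω z ^ 2) ≤ ENNReal.ofReal ((C + C) ^ 2) := fun ω z => by
    refine ENNReal.ofReal_le_ofReal ?_
    rw [← sq_abs]
    have : |grad g ω z| ≤ C + C := (abs_sub _ _).trans (add_le_add (hC _) (hC _))
    gcongr
  calc covNormSq P (grad g) ≤ ∫⁻ ω, (∑' z, cond ω 0 z) * ENNReal.ofReal ((C + C) ^ 2) ∂P := by
        refine lintegral_mono fun ω => ?_
        rw [← ENNReal.tsum_mul_right]
        exact ENNReal.tsum_le_tsum fun z => mul_le_mul' le_rfl (hb ω z)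
    _ = (∫⁻ ω, ∑' z, cond ω 0 z ∂P) * ENNReal.ofReal ((C + C) ^ 2) :=
        lintegral_mul_const' _ _ (by finiteness)
    _ < ∞ := ENNReal.mul_lt_top (lintegral_tsum_cond_lt_top hmom) (by finiteness)

theorem memPot_grad (hmom : UpperMoment P) {g : Env d → ℝ} (hg : IsLocal g) :
    MemPot P (grad g) :=
  ⟨memCov_grad hmom hg, fun δ hδ => ⟨g, hg, by simpa [covNormSq] using hδ⟩⟩

theorem IsLocal.add {g g' : Env d → ℝ} (hg : IsLocal g) (hg' : IsLocal g') :
    IsLocal (fun ω => g ω + g' ω) := by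
  classical
  obtain ⟨C, hC⟩ := hg.bounded
  obtain ⟨C', hC'⟩ := hg'.bounded
  obtain ⟨s, hs⟩ := hg.dependsOn
  obtain ⟨s', hs'⟩ := hg'.dependsOn
  refine ⟨⟨C + C', fun ω => (abs_add_le _ _).trans (add_le_add (hC _) (hC' _))⟩,
    hg.continuous.add hg'.continuous, s ∪ s', fun ω ω' h => ?_⟩
  have h1 : g ω = g ω' := hs fun i hi => h i (by simp at hi; simp [hi])
  have h2 : g' ω = g' ω' := hs' fun i hi => h i (by simp at hi; simp [hi])
  simp only [h1, h2]

theorem IsLocal.const_mul {g : Env d → ℝ} (hg : IsLocal g) (c : ℝ) :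
    IsLocal (fun ω => c * g ω) := by
  obtain ⟨C, hC⟩ := hg.bounded
  obtain ⟨s, hs⟩ := hg.dependsOn
  exact ⟨⟨|c| * C, fun ω => by rw [abs_mul]; gcongr; exact hC ω⟩, hg.continuous.const_mul c, s,
    fun ω ω' h => by
      have h1 : g ω = g ω' := hs h
      simp only [h1]⟩

theorem isLocal_zero : IsLocal (fun _ : Env d => (0 : ℝ)) :=
  ⟨⟨0, by simp⟩, continuous_const, ∅, fun _ _ _ => rfl⟩

/-! ### Uniform summability of weighted functions along a realization -/

/-- A nonnegative function on pairs `(x, z)` whose sums over `z` have bounded averages over boxes,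
with small tails, uniformly in the size of the box. -/
structure Tame (w : Lat d → Lat d → ℝ) : Prop where
  nonneg : ∀ x z, 0 ≤ w x z
  summable : ∀ x, Summable (w x)
  bdd : ∃ C : ℝ, 0 ≤ C ∧ ∀ N, ∑ x ∈ box d N, ∑' z, w x z ≤ C * (box d N).card
  tail : ∀ δ : ℝ, 0 < δ → ∃ Z : Finset (Lat d), ∀ N,
    ∑ x ∈ box d N, ∑' z, (if z ∈ Z then 0 else w x z) ≤ δ * (box d N).card

theorem lintegral_tsum_weight_lt_top (hmom : UpperMoment P) {φ : Field d}
    (hm : ∀ z, Measurable fun ω => φ ω z) (hφ : covNormSq P φ < ∞) :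
    ∑' z, ∫⁻ ω, cond ω 0 z * ENNReal.ofReal (sqLen z + φ ω z ^ 2) ∂P < ∞ := by
  have hmz : ∀ z, Measurable fun ω => cond ω 0 z * ENNReal.ofReal (sqLen z + φ ω z ^ 2) :=
    fun z => (measurable_cond 0 z).mul (measurable_const.add ((hm z).pow_const 2)).ennreal_ofReal
  rw [← lintegral_tsum fun z => (hmz z).aemeasurable]
  have : ∀ ω, ∑' z, cond ω 0 z * ENNReal.ofReal (sqLen z + φ ω z ^ 2) =
      ∑' z, cond ω 0 z * ENNReal.ofReal (sqLen z) +
        ∑' z, cond ω 0 z * ENNReal.ofReal (φ ω z ^ 2) := fun ω => by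
    rw [← ENNReal.tsum_add]
    refine tsum_congr fun z => ?_
    rw [ENNReal.ofReal_add (sqLen_nonneg z) (sq_nonneg _), mul_add]
  simp_rw [this]
  rw [lintegral_add_left (measurable_tsum_cond_mul (F := fun _ z => ENNReal.ofReal (sqLen z))
    fun z => measurable_const)]
  exact ENNReal.add_lt_top.2 ⟨hmom, hφ⟩

/-- By the maximal inequality, applied to the sums over `z ∉ Z` as `Z` exhausts the lattice. -/
theorem ae_tame (hmom : UpperMoment P) (hstat : Stationary P) {φ : Field d}
    (hm : ∀ z, Measurable fun ω => φ ω z) (hφ : covNormSq P φ < ∞) :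
    ∀ᵐ ω ∂P, Tame fun x z => (cond ω x z).toReal * (sqLen z + φ (shift x ω) z ^ 2) := by
  classical
  let F : Env d → Lat d → ℝ≥0∞ := fun ω z => cond ω 0 z * ENNReal.ofReal (sqLen z + φ ω z ^ 2)
  have hF : ∀ z, Measurable fun ω => F ω z := fun z =>
    (measurable_cond 0 z).mul (measurable_const.add ((hm z).pow_const 2)).ennreal_ofReal
  have hfin := lintegral_tsum_weight_lt_top hmom hm hφ
  have hFZ : ∀ (Z : Finset (Lat d)) z, Measurable fun ω => if z ∈ Z then 0 else F ω z :=
    fun Z z => by split_ifs; exacts [measurable_const, hF z]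
  have htot : ∫⁻ ω, ∑' z, F ω z ∂P < ∞ := by
    rwa [lintegral_tsum fun z => (hF z).aemeasurable]
  have h1 := ae_exists_forall_sum_box_le hstat
    (fun (Z : Finset (Lat d)) ω => ∑' z, if z ∈ Z then 0 else F ω z)
    (fun Z => Measurable.tsum (hFZ Z)) (fun η hη => by
      have := ENNReal.tendsto_tsum_compl_atTop_zero hfin.ne
      obtain ⟨Z, hZ⟩ := (this.eventually (gt_mem_nhds hη)).exists
      refine ⟨Z, ?_⟩
      rw [lintegral_tsum fun z => (hFZ Z z).aemeasurable]
      refine lt_of_le_of_lt (le_of_eq ?_) hZ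
      refine Eq.trans ?_ (tsum_subtype (s := {z | z ∉ Z})
        (f := fun z => ∫⁻ ω, cond ω 0 z * ENNReal.ofReal (sqLen z + φ ω z ^ 2) ∂P)).symm
      refine tsum_congr fun z => ?_
      by_cases hz : z ∈ Z <;> simp [hz, F])
  have h2 := ae_exists_forall_sum_box_le_of_lt_top hstat (Measurable.tsum hF) htot
  have h3 := ae_forall_shift hstat (ae_lt_top (Measurable.tsum hF) htot.ne)
  filter_upwards [h1, h2, h3, ae_cond_lt_top hmom hstat] with ω h1 h2 h3 h4
  set w : Lat d → Lat d → ℝ := fun x z => (cond ω x z).toReal * (sqLen z + φ (shift x ω) z ^ 2)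
    with hw
  have hnn : ∀ x z, 0 ≤ w x z := fun x z =>
    mul_nonneg ENNReal.toReal_nonneg (add_nonneg (sqLen_nonneg z) (sq_nonneg _))
  have hFw : ∀ x z, F (shift x ω) z = ENNReal.ofReal (w x z) := fun x z => by
    simp only [F, w, cond_shift_zero]
    rw [ENNReal.ofReal_mul ENNReal.toReal_nonneg, ENNReal.ofReal_toReal (h4 x z).ne]
  have hsum : ∀ x, Summable (w x) := fun x => by
    have := h3 x
    simp_rw [hFw] at this
    exact (ENNReal.summable_toReal this.ne).congr fun z => ENNReal.toReal_ofReal (hnn x z)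
  have hconv : ∀ (v : Lat d → Lat d → ℝ), (∀ x z, 0 ≤ v x z) → (∀ x, Summable (v x)) →
      ∀ N, ∑ x ∈ box d N, ∑' z, ENNReal.ofReal (v x z) =
        ENNReal.ofReal (∑ x ∈ box d N, ∑' z, v x z) := fun v hv hs N => by
    rw [ENNReal.ofReal_sum_of_nonneg fun x _ => tsum_nonneg (hv x)]
    exact Finset.sum_congr rfl fun x _ => (ENNReal.ofReal_tsum_of_nonneg (hv x) (hs x)).symm
  refine ⟨hnn, hsum, ?_, ?_⟩
  · obtain ⟨C, hC⟩ := h2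
    refine ⟨C, C.2, fun N => ?_⟩
    have := hC N
    simp_rw [hFw] at this
    rw [hconv w hnn hsum, ← ENNReal.ofReal_natCast, ← ENNReal.ofReal_coe_nnreal,
      ← ENNReal.ofReal_mul (NNReal.coe_nonneg C)] at this
    exact (ENNReal.ofReal_le_ofReal_iff (mul_nonneg C.2 (Nat.cast_nonneg _))).1 this
  · intro δ hδ
    obtain ⟨Z, hZ⟩ := h1 (ENNReal.ofReal δ) (ENNReal.ofReal_pos.2 hδ)
    refine ⟨Z, fun N => ?_⟩
    have := hZ N
    have e : ∀ x z, (if z ∈ Z then 0 else F (shift x ω) z) =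
        ENNReal.ofReal (if z ∈ Z then 0 else w x z) := fun x z => by
      split_ifs
      · simp
      · exact hFw x z
    simp_rw [e] at this
    rw [hconv _ (fun x z => by split_ifs; exacts [le_rfl, hnn x z])
      (fun x => (hsum x).of_nonneg_of_le (fun z => by split_ifs; exacts [le_rfl, hnn x z])
        fun z => by split_ifs; exacts [hnn x z, le_rfl]),
      ← ENNReal.ofReal_natCast, ← ENNReal.ofReal_mul hδ.le] at this
    convert (ENNReal.ofReal_le_ofReal_iff (mul_nonneg hδ.le (Nat.cast_nonneg _))).1 this

/-! ### Control of nearest-neighbour increments by the energy -/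

/-- The weighted inequality between the arithmetic and the geometric mean; the conventions
`0⁻¹ = ∞` and `∞⁻¹ = 0` make it true for every conductance `c`. -/
theorem ofReal_abs_le_inv_add (c t : ℝ≥0∞) (ht : t ≠ 0) (ht' : t ≠ ∞) (D : ℝ) :
    ENNReal.ofReal |D| ≤ t * c⁻¹ + t⁻¹ * (c * ENNReal.ofReal (D ^ 2)) := by
  rcases eq_or_ne c 0 with rfl | hc
  · simp [ENNReal.mul_top ht]
  rcases eq_or_ne D 0 with rfl | hD
  · simp
  rcases eq_or_ne c ∞ with rfl | hc'
  · have : ENNReal.ofReal (D ^ 2) ≠ 0 := by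
      rw [Ne, ENNReal.ofReal_eq_zero, not_le]; positivity
    rw [ENNReal.top_mul this, ENNReal.mul_top (ENNReal.inv_ne_zero.2 ht')]
    simp
  lift c to ℝ≥0 using hc'
  lift t to ℝ≥0 using ht'
  have hc0 : c ≠ 0 := by exact_mod_cast hc
  have ht0 : t ≠ 0 := by exact_mod_cast ht
  rw [← ENNReal.coe_inv hc0, ← ENNReal.coe_inv ht0, ENNReal.ofReal, ENNReal.ofReal]
  norm_cast
  rw [← NNReal.coe_le_coe]
  push_cast
  rw [Real.coe_toNNReal _ (abs_nonneg _), Real.coe_toNNReal _ (sq_nonneg _)]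
  have hcp : (0 : ℝ) < c := by positivity
  have htp : (0 : ℝ) < t := by positivity
  have key : (t : ℝ) * (c : ℝ)⁻¹ + (t : ℝ)⁻¹ * (c * D ^ 2) - |D| =
      ((t - c * |D|) ^ 2 + t * c * |D|) / (t * c) := by
    field_simp
    rw [sub_sq, mul_pow, sq_abs]
    ring
  have : 0 ≤ ((t - c * |D|) ^ 2 + t * c * |D|) / ((t : ℝ) * c) := by positivity
  linarith

theorem sub_mem_box_of_mem_support {u v : Lat d} (p : (nnGraph d).Walk u v) :
    ∀ b ∈ p.support, b - u ∈ box d p.length := by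
  induction p with
  | nil =>
    intro b hb
    simp only [SimpleGraph.Walk.support_nil, List.mem_singleton] at hb
    subst hb
    simp [mem_box]
  | @cons u w v h p ih =>
    intro b hb
    rw [SimpleGraph.Walk.support_cons, List.mem_cons] at hb
    rcases hb with rfl | hb
    · simp only [sub_self, mem_box, Pi.zero_apply, abs_zero]
      intro i; positivity
    · have h1 : w - u ∈ box d 1 := by
        rw [mem_box]
        intro i
        have h2 : ∑ i, |u i - w i| = 1 := h
        have h3 := Finset.single_le_sum (f := fun i => |u i - w i|) (fun _ _ => abs_nonneg _)
          (Finset.mem_univ i)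
        simp only [h2] at h3
        rw [Pi.sub_apply, abs_sub_comm]
        exact_mod_cast h3
      have := add_mem_box (ih b hb) h1
      simpa using this

/-- The increment of `f` along a path, if `R` bounds the resistances and `S` the energies of its
edges. -/
theorem ofReal_abs_sub_le_of_walk (ω : Env d) (f : Lat d → ℝ) (t R S : ℝ≥0∞) (ht : t ≠ 0)
    (ht' : t ≠ ∞) {u v : Lat d} (p : (nnGraph d).Walk u v)
    (hR : ∀ e ∈ p.edges, (pairCond ω e)⁻¹ ≤ R)
    (hS : ∀ b ∈ p.support, ∀ z, cond ω b z * ENNReal.ofReal ((f (b + z) - f b) ^ 2) ≤ S) :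
    ENNReal.ofReal |f v - f u| ≤ p.length * (t * R + t⁻¹ * S) := by
  induction p with
  | nil => simp
  | @cons u w v h p ih =>
    have h1 := ih (fun e he => hR e (by simp [he])) (fun b hb => hS b (by simp [hb]))
    have h2 : ENNReal.ofReal |f w - f u| ≤ t * R + t⁻¹ * S := by
      refine (ofReal_abs_le_inv_add (cond ω u (w - u)) t ht ht' _).trans ?_
      gcongr
      · rw [← pairCond_mk]
        exact hR _ (by simp)
      · simpa using hS u (by simp) (w - u)
    calc ENNReal.ofReal |f v - f u| ≤ ENNReal.ofReal (|f v - f w| + |f w - f u|) :=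
          ENNReal.ofReal_le_ofReal (abs_sub_le _ _ _)
      _ ≤ ENNReal.ofReal |f v - f w| + ENNReal.ofReal |f w - f u| := ENNReal.ofReal_add_le
      _ ≤ p.length * (t * R + t⁻¹ * S) + (t * R + t⁻¹ * S) := add_le_add h1 h2
      _ = _ := by
        rw [SimpleGraph.Walk.length_cons]; push_cast; ring

/-- A predicate inherited along edges of positive conductance propagates along paths of such edges.
-/
theorem pred_of_open_walk (ω : Env d) {u v : Lat d} (p : (nnGraph d).Walk u v)
    (hp : ∀ e ∈ p.edges, pairCond ω e ≠ 0) (A : Lat d → Prop) (hu : A u)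
    (hA : ∀ x y, A x → cond ω x (y - x) ≠ 0 → A y) : A v := by
  induction p with
  | nil => exact hu
  | @cons u w v h p ih =>
    refine ih (fun e he => hp e (by simp [he])) (hA u w hu ?_)
    rw [← pairCond_mk]
    exact hp _ (by simp)

instance (x y : Lat d) : Countable ((nnGraph d).Walk x y) :=
  Function.Injective.countable (f := fun p : (nnGraph d).Walk x y => p.support)
    fun _ _ h => SimpleGraph.Walk.ext_support h

theorem measurable_pathResistance {x y : Lat d} (Γ : Set ((nnGraph d).Walk x y)) :
    Measurable fun ω => pathResistance ω Γ := by
  classical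
  unfold pathResistance
  refine Measurable.biInf Γ (Set.to_countable _) fun γ _ => ?_
  exact Finset.measurable_sum _ fun e _ => (measurable_pairCond e).inv

/-- The energy carried by the edges that start in the box of radius `l`. -/
def localEnergy (l : ℕ) (ω : Env d) (f : Lat d → ℝ) : ℝ≥0∞ :=
  ∑ b ∈ box d l, ∑' z, cond ω b z * ENNReal.ofReal ((f (b + z) - f b) ^ 2)

/-- `ν` is an integrable random variable controlling, together with the energy in a box of fixed
size, the increments of all functions along the nearest-neighbour edges at the origin. The last
condition says that where `ν` is finite, every nearest neighbour of the origin is joined to it by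
edges of positive conductance. -/
structure IsResistance (P : Measure (Env d)) (l : ℕ) (ν : Env d → ℝ≥0∞) : Prop where
  measurable : Measurable ν
  lintegral_lt_top : ∫⁻ ω, ν ω ∂P < ∞
  ofReal_abs_le : ∀ (ω : Env d) (y : Lat d), (nnGraph d).Adj 0 y → ∀ (f : Lat d → ℝ) (t : ℝ≥0∞),
    t ≠ 0 → t ≠ ∞ → ENNReal.ofReal |f y - f 0| ≤ (l + 1) * (t * ν ω + t⁻¹ * localEnergy l ω f)
  pred : ∀ (ω : Env d), ν ω < ∞ → ∀ (y : Lat d), (nnGraph d).Adj 0 y → ∀ (A : Lat d → Prop),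
    A 0 → (∀ x y, A x → cond ω x (y - x) ≠ 0 → A y) → A y

/-- The witness is the sum of the path resistances plus one: the additional one leaves room to
choose a path whose resistance is below it, although the infimum need not be attained. -/
theorem exists_isResistance [IsProbabilityMeasure P] (hlow : LowerMoment P) :
    ∃ l ν, IsResistance P l ν := by
  classical
  obtain ⟨l, Γ, hlen, -, hint⟩ := hlow
  have hm : Measurable fun ω => ∑' y, pathResistance ω (Γ y) :=
    Measurable.tsum fun y => measurable_pathResistance _
  have hex : ∀ ω (y : (nnGraph d).neighborSet 0), ∑' y, pathResistance ω (Γ y) < ∞ →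
      ∃ γ ∈ Γ y, ∑ e ∈ γ.edges.toFinset, (pairCond ω e)⁻¹ <
        ∑' y, pathResistance ω (Γ y) + 1 := by
    intro ω y hfin
    have h1 : pathResistance ω (Γ y) < ∑' y, pathResistance ω (Γ y) + 1 :=
      (ENNReal.le_tsum y).trans_lt (ENNReal.lt_add_right hfin.ne one_ne_zero)
    rw [pathResistance] at h1
    simpa only [iInf_lt_iff, exists_prop] using h1
  refine ⟨l, fun ω => ∑' y, pathResistance ω (Γ y) + 1, hm.add_const 1, ?_, ?_, ?_⟩
  · rw [lintegral_add_right _ measurable_const]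
    exact ENNReal.add_lt_top.2 ⟨hint, by simp⟩
  · intro ω y hy f t ht ht'
    -- where `ν` is infinite the right-hand side is infinite
    rcases eq_or_ne (∑' y, pathResistance ω (Γ y)) ∞ with htop | hfin
    · simp [htop, ENNReal.mul_top ht, ENNReal.mul_top]
    obtain ⟨γ, hγ, hlt⟩ := hex ω ⟨y, hy⟩ (lt_top_iff_ne_top.2 hfin)
    refine (ofReal_abs_sub_le_of_walk ω f t _ (localEnergy l ω f) ht ht' γ (fun e he =>
      (Finset.single_le_sum (f := fun e => (pairCond ω e)⁻¹) (fun _ _ => zero_le)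
        (List.mem_toFinset.2 he)).trans hlt.le) fun b hb z => ?_).trans ?_
    · have hb' : b ∈ box d l := by
        have := sub_mem_box_of_mem_support γ b hb
        rw [sub_zero, mem_box] at this
        rw [mem_box]
        exact fun i => (this i).trans (by exact_mod_cast hlen _ γ hγ)
      exact (ENNReal.le_tsum z).trans (Finset.single_le_sum
        (f := fun b => ∑' z, cond ω b z * ENNReal.ofReal ((f (b + z) - f b) ^ 2))
        (fun _ _ => zero_le) hb')
    · gcongr
      exact_mod_cast (hlen _ γ hγ).trans (Nat.le_succ l)
  · intro ω hω y hy A h0 hA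
    have hfin : ∑' y, pathResistance ω (Γ y) < ∞ := lt_of_le_of_lt le_self_add hω
    obtain ⟨γ, hγ, hlt⟩ := hex ω ⟨y, hy⟩ hfin
    refine pred_of_open_walk ω γ (fun e he hz => ?_) A h0 hA
    have h1 := (Finset.single_le_sum (f := fun e => (pairCond ω e)⁻¹) (fun _ _ => zero_le)
        (List.mem_toFinset.2 he)).trans_lt hlt
    -- an edge of zero conductance has infinite resistance
    simp only [hz, ENNReal.inv_zero, not_top_lt] at h1

theorem adj_single (i : Fin d) : (nnGraph d).Adj 0 (Pi.single i 1) := by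
  change ∑ j, |(0 : Lat d) j - (Pi.single i 1 : Lat d) j| = 1
  rw [Finset.sum_eq_single i]
  · simp
  · intro j _ hj; simp [hj]
  · simp

theorem adj_neg_single (i : Fin d) : (nnGraph d).Adj 0 (-Pi.single i 1) := by
  change ∑ j, |(0 : Lat d) j - (-Pi.single i 1 : Lat d) j| = 1
  rw [Finset.sum_eq_single i]
  · simp
  · intro j _ hj; simp [hj]
  · simp

/-- The edges of positive conductance connect the lattice: a predicate that holds at the origin and
is inherited along these edges holds everywhere. -/
def OpenConnected (ω : Env d) : Prop :=
  ∀ A : Lat d → Prop, A 0 → (∀ x y, A x → cond ω x (y - x) ≠ 0 → A y) → ∀ y, A y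

/-- Almost surely `ν` is finite at all vertices, so that all nearest-neighbour edges are bridged by
edges of positive conductance. -/
theorem ae_connected {l : ℕ} {ν : Env d → ℝ≥0∞} (hν : IsResistance P l ν) (hstat : Stationary P) :
    ∀ᵐ ω ∂P, OpenConnected ω := by
  filter_upwards [ae_forall_shift hstat (ae_lt_top hν.measurable hν.lintegral_lt_top.ne)]
    with ω hω A h0 hA
  have step : ∀ x y, (nnGraph d).Adj 0 y → A x → A (x + y) := by
    intro x y hy hx
    refine hν.pred (shift x ω) (hω x) y hy (fun u => A (x + u)) (by simpa using hx) ?_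
    intro u v hu huv
    refine hA (x + u) (x + v) hu ?_
    rw [cond_shift] at huv
    convert huv using 2
    abel
  have hmono : ∀ (n : ℕ) (i : Fin d) x, A x →
      A (x + (n : ℤ) • Pi.single i (1 : ℤ)) ∧ A (x + (n : ℤ) • -Pi.single i (1 : ℤ)) := by
    intro n i x hx
    induction n with
    | zero => simpa using hx
    | succ n ih =>
      refine ⟨?_, ?_⟩
      · have := step _ _ (adj_single i) ih.1
        convert this using 1
        push_cast
        rw [add_smul, one_smul, add_assoc]
      · have := step _ _ (adj_neg_single i) ih.2
        convert this using 1
        push_cast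
        rw [add_smul, one_smul, add_assoc]
  have hz : ∀ (k : ℤ) (i : Fin d) x, A x → A (x + k • Pi.single i (1 : ℤ)) := by
    intro k i x hx
    obtain ⟨n, rfl | rfl⟩ := k.eq_nat_or_neg
    · exact (hmono n i x hx).1
    · have := (hmono n i x hx).2
      rwa [smul_neg, ← neg_smul] at this
  intro y
  have hs : ∀ s : Finset (Fin d), A (∑ i ∈ s, y i • (Pi.single i 1 : Lat d)) := by
    intro s
    induction s using Finset.induction_on with
    | empty => simpa using h0
    | insert i s hi ih =>
      rw [Finset.sum_insert hi, add_comm]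
      exact hz _ _ _ ih
  have hx : y = ∑ i, y i • (Pi.single i 1 : Lat d) := by
    funext j
    simp [Finset.sum_apply, Pi.single_apply]
  rw [hx]
  exact hs _

/-! ### Covariant representatives of limits -/

/-- A limit, almost everywhere with respect to the edge measure, of covariant functions has a
version that is covariant everywhere. Convergence spreads from the edges of positive conductance to
all pairs of vertices, because these edges connect the lattice. -/
theorem exists_covariant_limit {X : Type*} [MeasurableSpace X] (μ : Measure X)
    [SFinite P] (hstat : Stationary P)
    (hconn : ∀ᵐ ω ∂P, OpenConnected ω)
    (f : ℕ → X → Field d) (hm : ∀ n z, Measurable fun q : X × Env d => f n q.1 q.2 z)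
    (hcov : ∀ n x ω y z, f n x ω (y + z) - f n x ω y = f n x (shift y ω) z)
    (hconv : ∀ᵐ q ∂(μ.prod (edgeMeasure P)),
      ∃ a, Tendsto (fun n => f n q.1 q.2.1 q.2.2) atTop (𝓝 a)) :
    ∃ F : X → Field d, (∀ z, Measurable fun q : X × Env d => F q.1 q.2 z) ∧
      (∀ x ω y z, F x ω (y + z) - F x ω y = F x (shift y ω) z) ∧
      ∀ᵐ q ∂(μ.prod (edgeMeasure P)),
        Tendsto (fun n => f n q.1 q.2.1 q.2.2) atTop (𝓝 (F q.1 q.2.1 q.2.2)) := by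
  classical
  -- the limit is taken where the sequence converges at all `z`, and is zero elsewhere; covariance
  -- holds everywhere because this set of environments is invariant under translations
  let C : X → Env d → Prop := fun x ω => ∀ z, ∃ a, Tendsto (fun n => f n x ω z) atTop (𝓝 a)
  have hC : MeasurableSet {q : X × Env d | C q.1 q.2} := by
    have : {q : X × Env d | C q.1 q.2} =
        ⋂ z, {q : X × Env d | ∃ a, Tendsto (fun n => f n q.1 q.2 z) atTop (𝓝 a)} := by
      ext; simp [C]
    rw [this]
    exact MeasurableSet.iInter fun z => measurableSet_exists_tendsto fun n => hm n z
  let F : X → Field d := fun x ω z =>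
    if h : C x ω then Classical.choose (h z) else 0
  have hF : ∀ x ω, C x ω → ∀ z, Tendsto (fun n => f n x ω z) atTop (𝓝 (F x ω z)) := by
    intro x ω h z
    simp only [F, h, dif_pos]
    exact Classical.choose_spec (h z)
  have hCshift : ∀ x ω y, C x ω → C x (shift y ω) := by
    intro x ω y h z
    obtain ⟨a, ha⟩ := h (y + z)
    obtain ⟨b, hb⟩ := h y
    refine ⟨a - b, (ha.sub hb).congr fun n => ?_⟩
    rw [hcov]
  have hCshift' : ∀ x ω y, C x (shift y ω) ↔ C x ω := by
    refine fun x ω y => ⟨fun h => ?_, hCshift x ω y⟩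
    simpa [shift_shift] using hCshift x _ (-y) h
  refine ⟨F, fun z => ?_, ?_, ?_⟩
  · refine measurable_of_tendsto_metrizable
      (f := fun n => {q : X × Env d | C q.1 q.2}.indicator fun q => f n q.1 q.2 z)
      (fun n => (hm n z).indicator hC) (tendsto_pi_nhds.2 fun q => ?_)
    by_cases h : C q.1 q.2
    · simpa [h] using hF q.1 q.2 h z
    · simp [h, F]
  · intro x ω y z
    by_cases h : C x ω
    · refine tendsto_nhds_unique ((hF x ω h (y + z)).sub (hF x ω h y)) ?_
      simp_rw [hcov]
      exact hF x _ (hCshift x ω y h) z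
    · simp [F, h, hCshift']
  -- for fixed `x` and `ω`, convergence at `z` is inherited along edges of positive conductance
  · have hae : ∀ᵐ x ∂μ, ∀ᵐ ω ∂P, C x ω := by
      filter_upwards [Measure.ae_ae_of_ae_prod hconv] with x hx
      filter_upwards [ae_forall_shift hstat (ae_of_ae_edgeMeasure hx), hconn] with ω h1 h2
      refine h2 _ ?_ ?_
      · refine ⟨0, tendsto_const_nhds.congr fun n => ?_⟩
        have := hcov n x ω 0 0
        simp only [add_zero, sub_self, shift_zero] at this
        exact this
      · rintro u v ⟨a, ha⟩ huv
        obtain ⟨b, hb⟩ := h1 u (v - u) (by rwa [cond_shift_zero])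
        refine ⟨b + a, (hb.add ha).congr fun n => ?_⟩
        rw [← hcov]
        simp
    have hae' : ∀ᵐ q ∂(μ.prod (edgeMeasure P)), C q.1 q.2.1 := by
      have hms : MeasurableSet {q : X × (Env d × Lat d) | C q.1 q.2.1} :=
        (measurable_fst.prodMk (measurable_fst.comp measurable_snd)) hC
      refine (Measure.ae_prod_iff_ae_ae hms).2 ?_
      filter_upwards [hae] with x hx
      exact ae_edgeMeasure_of_ae (p := fun q => C x q.1) (hx.mono fun ω h _ => h)
    filter_upwards [hae'] with q hq
    exact hF _ _ hq _

/-- The subspace of `L²(X; L²_cov)` consisting of the gradients of measurable families of local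
functions. -/
def gradSpace {X : Type*} [MeasurableSpace X] (μ : Measure X) (P : Measure (Env d)) :
    Submodule ℝ (Lp ℝ 2 (μ.prod (edgeMeasure P))) where
  carrier := {h | ∃ g : X → Env d → ℝ, (∀ x, IsLocal (g x)) ∧
    (Measurable fun q : X × Env d => g q.1 q.2) ∧
    h =ᵐ[μ.prod (edgeMeasure P)] fun q => grad (g q.1) q.2.1 q.2.2}
  add_mem' := by
    rintro h h' ⟨g, hg, hgm, hh⟩ ⟨g', hg', hgm', hh'⟩
    refine ⟨fun x ω => g x ω + g' x ω, fun x => (hg x).add (hg' x), hgm.add hgm', ?_⟩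
    filter_upwards [Lp.coeFn_add h h', hh, hh'] with q h1 h2 h3
    rw [h1, Pi.add_apply, h2, h3]
    simp only [grad]; ring
  zero_mem' := ⟨fun _ _ => 0, fun _ => isLocal_zero, measurable_const, by
    filter_upwards [Lp.coeFn_zero ℝ 2 (μ.prod (edgeMeasure P))] with q h1
    rw [h1]; simp [grad]⟩
  smul_mem' := by
    rintro c h ⟨g, hg, hgm, hh⟩
    refine ⟨fun x ω => c * g x ω, fun x => (hg x).const_mul c, hgm.const_mul c, ?_⟩
    filter_upwards [Lp.coeFn_smul c h, hh] with q h1 h2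
    rw [h1, Pi.smul_apply, h2]
    simp only [grad, smul_eq_mul]; ring

theorem measurable_section {X : Type*} [MeasurableSpace X] {F : X → Field d}
    (hF : ∀ z, Measurable fun q : X × Env d => F q.1 q.2 z) (x : X) (z : Lat d) :
    Measurable fun ω => F x ω z :=
  (hF z).comp measurable_prodMk_left

theorem measurable_triple {X : Type*} [MeasurableSpace X] {F : X → Field d}
    (hF : ∀ z, Measurable fun q : X × Env d => F q.1 q.2 z) :
    Measurable fun q : X × (Env d × Lat d) => F q.1 q.2.1 q.2.2 :=
  (measurable_uncurry (F := fun (q : X × Env d) z => F q.1 q.2 z) hF).comp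
    ((measurable_fst.prodMk (measurable_fst.comp measurable_snd)).prodMk
      (measurable_snd.comp measurable_snd))

theorem measurable_covNormSq {X : Type*} [MeasurableSpace X] [SFinite P] {F : X → Field d}
    (hF : ∀ z, Measurable fun q : X × Env d => F q.1 q.2 z) :
    Measurable fun x => covNormSq P (F x) := by
  have : (fun x => covNormSq P (F x)) =
      fun x => ∫⁻ p, ENNReal.ofReal (F x p.1 p.2 ^ 2) ∂(edgeMeasure P) :=
    funext fun x => covNormSq_eq_lintegral (measurable_section hF x)
  rw [this]
  exact ((measurable_triple hF).pow_const 2).ennreal_ofReal.lintegral_prod_right'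

theorem lintegral_covNormSq {X : Type*} [MeasurableSpace X] {μ : Measure X}
    [SFinite P] {F : X → Field d} (hF : ∀ z, Measurable fun q : X × Env d => F q.1 q.2 z) :
    ∫⁻ x, covNormSq P (F x) ∂μ =
      eLpNorm (fun q : X × (Env d × Lat d) => F q.1 q.2.1 q.2.2) 2
        (μ.prod (edgeMeasure P)) ^ 2 := by
  rw [eLpNorm_two_sq,
    lintegral_prod _ ((measurable_triple hF).pow_const 2).ennreal_ofReal.aemeasurable]
  exact lintegral_congr fun x => covNormSq_eq_lintegral (measurable_section hF x)

theorem measurable_grad_family {X : Type*} [MeasurableSpace X] {g : X → Env d → ℝ}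
    (hg : Measurable fun q : X × Env d => g q.1 q.2) (z : Lat d) :
    Measurable fun q : X × Env d => grad (g q.1) q.2 z :=
  (hg.comp (measurable_fst.prodMk ((measurable_shift z).comp measurable_snd))).sub hg

/-- Elements of the closed span of gradients are represented by functions with values in
`L²_pot`. -/
theorem exists_memPot_of_mem_closure {X : Type*} [MeasurableSpace X] {μ : Measure X}
    [SFinite P] (hstat : Stationary P)
    (hconn : ∀ᵐ ω ∂P, OpenConnected ω)
    {h : Lp ℝ 2 (μ.prod (edgeMeasure P))} (hh : h ∈ (gradSpace μ P).topologicalClosure) :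
    ∃ F : X → Field d, (∀ z, Measurable fun q : X × Env d => F q.1 q.2 z) ∧
      (∀ x ω y z, F x ω (y + z) - F x ω y = F x (shift y ω) z) ∧
      (h =ᵐ[μ.prod (edgeMeasure P)] fun q => F q.1 q.2.1 q.2.2) ∧
      (∀ᵐ x ∂μ, MemPot P (F x)) ∧ ∫⁻ x, covNormSq P (F x) ∂μ < ∞ := by
  obtain ⟨u, hu, hlim⟩ := mem_closure_iff_seq_limit.1 hh
  choose g hg hgm hgu using hu
  obtain ⟨ns, -, hns⟩ := (tendstoInMeasure_of_tendsto_Lp hlim).exists_seq_tendsto_ae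
  have hconv : ∀ᵐ q ∂(μ.prod (edgeMeasure P)),
      Tendsto (fun n => grad (g (ns n) q.1) q.2.1 q.2.2) atTop (𝓝 (h q)) := by
    filter_upwards [hns, ae_all_iff.2 hgu] with q h1 h2
    exact h1.congr fun n => h2 _
  obtain ⟨F, hFm, hFc, hFl⟩ := exists_covariant_limit μ hstat hconn (fun n x => grad (g (ns n) x))
    (fun n z => measurable_grad_family (hgm _) z) (fun n x ω y z => grad_covariant _ ω y z)
    (hconv.mono fun q hq => ⟨_, hq⟩)
  have hhF : h =ᵐ[μ.prod (edgeMeasure P)] fun q => F q.1 q.2.1 q.2.2 := by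
    filter_upwards [hconv, hFl] with q h1 h2 using tendsto_nhds_unique h1 h2
  have hfin : ∫⁻ x, covNormSq P (F x) ∂μ < ∞ := by
    rw [lintegral_covNormSq hFm, ← eLpNorm_congr_ae hhF]
    exact ENNReal.pow_lt_top (Lp.memLp h).2
  have hdm : ∀ n z, Measurable fun q : X × Env d => (F q.1 - grad (g n q.1)) q.2 z := fun n z =>
    (hFm z).sub (measurable_grad_family (hgm n) z)
  have hdiff : ∀ n, ∫⁻ x, covNormSq P (F x - grad (g n x)) ∂μ = ‖h - u n‖ₑ ^ 2 := by
    intro n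
    rw [lintegral_covNormSq (F := fun x => F x - grad (g n x)) (hdm n), Lp.enorm_def]
    congr 1
    refine eLpNorm_congr_ae ?_
    filter_upwards [Lp.coeFn_sub h (u n), hhF, hgu n] with q h1 h2 h3
    rw [h1]
    simp only [Pi.sub_apply, h2, h3]
  -- the distances to the approximating gradients need not converge pointwise, but their infimum
  -- vanishes almost everywhere
  have hinf : ∫⁻ x, ⨅ n, covNormSq P (F x - grad (g n x)) ∂μ = 0 := by
    have h1 : Tendsto (fun n => ‖h - u n‖ₑ ^ 2) atTop (𝓝 0) := by
      have h2 : Tendsto (fun n => h - u n) atTop (𝓝 0) := by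
        simpa using tendsto_const_nhds (x := h) |>.sub hlim
      have h3 : Tendsto (fun n => ‖h - u n‖ₑ) atTop (𝓝 0) := by
        simpa using h2.enorm
      simpa using ENNReal.Tendsto.pow (n := 2) h3
    refine le_antisymm (ge_of_tendsto' h1 fun n => ?_) zero_le
    rw [← hdiff]
    exact lintegral_mono fun x => iInf_le _ n
  refine ⟨F, hFm, hFc, hhF, ?_, hfin⟩
  have hm1 : Measurable fun x => ⨅ n, covNormSq P (F x - grad (g n x)) :=
    Measurable.iInf fun n => measurable_covNormSq (F := fun x => F x - grad (g n x)) (hdm n)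
  filter_upwards [(lintegral_eq_zero_iff hm1).1 hinf,
    ae_lt_top (measurable_covNormSq hFm) hfin.ne] with x h1 h2
  refine ⟨⟨measurable_section hFm x, hFc x, h2⟩, fun δ hδ => ?_⟩
  have h3 : ⨅ n, covNormSq P (F x - grad (g n x)) < δ := by
    rw [show ⨅ n, covNormSq P (F x - grad (g n x)) = 0 from h1]
    exact_mod_cast hδ
  obtain ⟨n, hn⟩ := iInf_lt_iff.1 h3
  exact ⟨g n x, hg n x, hn⟩

/-! ### The decomposition into potential and solenoidal fields -/

theorem memCov_of_memLp {φ : Field d} (hm : ∀ z, Measurable fun ω => φ ω z)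
    (hc : ∀ ω x z, φ ω (x + z) - φ ω x = φ (shift x ω) z)
    (h : MemLp (fun p : Env d × Lat d => φ p.1 p.2) 2 (edgeMeasure P)) : MemCov P φ :=
  ⟨hm, hc, by rw [covNormSq_eq_eLpNorm hm]; exact ENNReal.pow_lt_top h.2⟩

theorem MemCov.add {φ ψ : Field d} (hφ : MemCov P φ) (hψ : MemCov P ψ) :
    MemCov P (φ + ψ) :=
  memCov_of_memLp (fun z => (hφ.measurable z).add (hψ.measurable z))
    (fun ω x z => by
      simp only [Pi.add_apply, ← hφ.covariant, ← hψ.covariant]; ring) (hφ.memLp.add hψ.memLp)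

theorem MemCov.sub {φ ψ : Field d} (hφ : MemCov P φ) (hψ : MemCov P ψ) :
    MemCov P (φ - ψ) :=
  memCov_of_memLp (fun z => (hφ.measurable z).sub (hψ.measurable z))
    (fun ω x z => by
      simp only [Pi.sub_apply, ← hφ.covariant, ← hψ.covariant]; ring) (hφ.memLp.sub hψ.memLp)

theorem MemCov.smul {φ : Field d} (hφ : MemCov P φ) (c : ℝ) :
    MemCov P (c • φ) :=
  memCov_of_memLp (fun z => (hφ.measurable z).const_mul c)
    (fun ω x z => by
      simp only [Pi.smul_apply, smul_eq_mul, ← hφ.covariant]; ring) (hφ.memLp.const_smul c)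

theorem memCov_zero : MemCov P (0 : Field d) :=
  ⟨fun _ => measurable_const, fun _ _ _ => by simp, by simp [covNormSq]⟩

theorem MemCov.sum {ι : Type*} (s : Finset ι) {φ : ι → Field d}
    (h : ∀ i ∈ s, MemCov P (φ i)) : MemCov P (∑ i ∈ s, φ i) := by
  classical
  induction s using Finset.induction_on with
  | empty => simpa using memCov_zero
  | insert i s hi ih =>
    rw [Finset.sum_insert hi]
    exact (h i (by simp)).add (ih fun j hj => h j (by simp [hj]))

theorem covNormSq_lt_iff {φ : Field d} (hm : ∀ z, Measurable fun ω => φ ω z)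
    {δ : ℝ≥0∞} : covNormSq P φ < δ ^ 2 ↔
      eLpNorm (fun p : Env d × Lat d => φ p.1 p.2) 2 (edgeMeasure P) < δ := by
  rw [covNormSq_eq_eLpNorm hm, ENNReal.pow_lt_pow_left_iff two_ne_zero]

/-- Every square integrable covariant function is the sum of a potential and a solenoidal one. -/
theorem exists_memPot_add_memSol [IsProbabilityMeasure P] (hmom : UpperMoment P)
    (hstat : Stationary P) (hconn : ∀ᵐ ω ∂P, OpenConnected ω) {φ : Field d} (hφ : MemCov P φ) :
    ∃ p s, MemPot P p ∧ MemSol P s ∧ φ = p + s := by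
  -- over a one-point space, this is the projection onto the closed span of the gradients
  let μ : Measure Unit := Measure.dirac ()
  have hmp : MeasurePreserving (Prod.snd : Unit × (Env d × Lat d) → _) (μ.prod (edgeMeasure P))
    (edgeMeasure P) := measurePreserving_snd
  have hL : ∀ {ψ : Field d}, MemCov P ψ →
      MemLp (fun q : Unit × (Env d × Lat d) => ψ q.2.1 q.2.2) 2 (μ.prod (edgeMeasure P)) :=
    fun hψ => hψ.memLp.comp_measurePreserving hmp
  let K := (gradSpace μ P).topologicalClosure
  have hK : ∀ {ψ : Field d} (hψ : MemPot P ψ), (hL hψ.1).toLp _ ∈ K := by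
    intro ψ hψ
    refine EMetric.mem_closure_iff.2 fun δ hδ => ?_
    obtain ⟨η, hη0, hη⟩ := ENNReal.lt_iff_exists_nnreal_btwn.1 hδ
    obtain ⟨g, hg, hd⟩ := hψ.2 (η ^ 2) (by have : 0 < η := by exact_mod_cast hη0
                                           positivity)
    have hgC := memCov_grad hmom hg
    refine ⟨(hL hgC).toLp _, ⟨fun _ => g, fun _ => hg, hg.measurable.comp measurable_snd,
      (hL hgC).coeFn_toLp⟩, ?_⟩
    rw [Lp.edist_toLp_toLp]
    refine lt_trans ?_ hη
    rw [covNormSq_lt_iff (hψ.1.sub hgC).measurable] at hd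
    rw [← eLpNorm_comp_measurePreserving (hψ.1.sub hgC).memLp.1 hmp] at hd
    exact hd
  let φ' := (hL hφ).toLp _
  obtain ⟨F, hFm, hFc, hhF, hpot, -⟩ := exists_memPot_of_mem_closure hstat hconn
    (K.starProjection_apply_mem φ')
  have hp : MemPot P (F ()) := by
    rw [ae_dirac_eq] at hpot
    exact hpot
  -- the remainder is orthogonal to the potential fields
  refine ⟨F (), φ - F (), hp, ⟨hφ.sub hp.1, fun ψ hψ => ?_⟩, by simp⟩
  rw [covInner_eq_integral hmom hstat (hφ.sub hp.1).memLp hψ.1.memLp]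
  have h0 := (Submodule.mem_orthogonal _ _).1 (K.sub_starProjection_mem_orthogonal φ') _ (hK hψ)
  rw [L2.inner_def] at h0
  have h1 : ∫ q : Unit × (Env d × Lat d), (φ - F ()) q.2.1 q.2.2 * ψ q.2.1 q.2.2
      ∂(μ.prod (edgeMeasure P)) = 0 := by
    rw [← h0]
    refine integral_congr_ae ?_
    filter_upwards [(hL hψ.1).coeFn_toLp, (hL hφ).coeFn_toLp, hhF,
      Lp.coeFn_sub φ' (K.starProjection φ')] with q h1 h2 h3 h4
    have h2' : φ' q = φ q.2.1 q.2.2 := h2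
    rw [h4]
    simp only [Pi.sub_apply, h1, h2', h3]
    simp
  have hF : AEStronglyMeasurable (fun p : Env d × Lat d => (φ - F ()) p.1 p.2 * ψ p.1 p.2)
      (Measure.map Prod.snd (μ.prod (edgeMeasure P))) := by
    rw [hmp.map_eq]
    exact ((hφ.sub hp.1).memLp.integrable_mul hψ.1.memLp).aestronglyMeasurable
  have h2 := integral_map hmp.measurable.aemeasurable hF
  rw [hmp.map_eq] at h2
  rw [← h1, h2]

/-! ### Nondegeneracy -/

theorem lintegral_localEnergy (hstat : Stationary P) (l : ℕ) {φ : Field d}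
    (hφ : MemCov P φ) :
    ∫⁻ ω, localEnergy l ω (φ ω) ∂P = (box d l).card * covNormSq P φ := by
  let D : Env d → ℝ≥0∞ := fun ω => ∑' z, cond ω 0 z * ENNReal.ofReal (φ ω z ^ 2)
  have hm : Measurable D :=
    measurable_tsum_cond_mul fun z => ((hφ.measurable z).pow_const 2).ennreal_ofReal
  have hmb : ∀ b, Measurable fun ω => D (shift b ω) := fun b => hm.comp (measurable_shift b)
  have e : ∀ ω, localEnergy l ω (φ ω) = ∑ b ∈ box d l, D (shift b ω) := fun ω => by
    refine Finset.sum_congr rfl fun b _ => tsum_congr fun z => ?_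
    rw [cond_shift_zero, hφ.covariant]
  rw [lintegral_congr e, lintegral_finsetSum _ fun b _ => hmb b]
  simp_rw [fun b => lintegral_comp_shift hstat hm b]
  rw [Finset.sum_const, nsmul_eq_mul]
  rfl

theorem MemCov.apply_zero {φ : Field d} (hφ : MemCov P φ) (ω : Env d) : φ ω 0 = 0 := by
  have := hφ.covariant ω 0 0
  simpa using this.symm

/-- The `L¹` norm of a covariant function at a nearest neighbour of the origin is controlled by its
norm in `L²_cov`. -/
theorem lintegral_abs_le (hstat : Stationary P) {l : ℕ} {ν : Env d → ℝ≥0∞}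
    (hν : IsResistance P l ν) {φ : Field d} (hφ : MemCov P φ) {y : Lat d}
    (hy : (nnGraph d).Adj 0 y) {t : ℝ≥0∞} (ht : t ≠ 0) (ht' : t ≠ ∞) :
    ∫⁻ ω, ENNReal.ofReal |φ ω y| ∂P ≤
      (l + 1) * (t * ∫⁻ ω, ν ω ∂P + t⁻¹ * ((box d l).card * covNormSq P φ)) := by
  rw [← lintegral_localEnergy hstat l hφ, ← lintegral_const_mul _ hν.measurable,
    ← lintegral_const_mul' _ _ (ENNReal.inv_ne_top.2 ht),
    ← lintegral_add_left (hν.measurable.const_mul _), ← lintegral_const_mul' _ _ (by finiteness)]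
  refine lintegral_mono fun ω => ?_
  have := hν.ofReal_abs_le ω y hy (φ ω) t ht ht'
  rwa [hφ.apply_zero, sub_zero] at this

/-- Gradients have mean zero, by stationarity. -/
theorem integral_grad [IsProbabilityMeasure P] (hstat : Stationary P) {g : Env d → ℝ}
    (hg : IsLocal g) (z : Lat d) : ∫ ω, grad g ω z ∂P = 0 := by
  obtain ⟨C, hC⟩ := hg.bounded
  have hi : Integrable g P := Integrable.of_bound hg.measurable.aestronglyMeasurable C
    (Eventually.of_forall hC)
  have hi' : Integrable (fun ω => g (shift z ω)) P := (hstat z).integrable_comp_of_integrable hi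
  simp only [grad]
  rw [integral_sub hi' hi, sub_eq_zero]
  have := integral_map (hstat z).measurable.aemeasurable (μ := P) (f := g)
    (by rw [(hstat z).map_eq]; exact hi.aestronglyMeasurable)
  rw [(hstat z).map_eq] at this
  exact this.symm

/-- The linear field `ξ · z`. -/
def linField (ξ : Fin d → ℝ) : Field d := fun _ z => ∑ i, ξ i * (z i : ℝ)

theorem linField_eq_sum (ξ : Fin d → ℝ) : linField ξ = ∑ i, ξ i • coordField i := by
  funext ω z
  simp [linField, coordField, Finset.sum_apply]

theorem memCov_linField (hmom : UpperMoment P) (ξ : Fin d → ℝ) :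
    MemCov P (linField ξ) := by
  rw [linField_eq_sum]
  exact MemCov.sum _ fun i _ => (memCov_coordField hmom i).smul _

/-- A nonzero linear field is not approximated by gradients, since these have mean zero. -/
theorem eq_zero_of_linField_approx [IsProbabilityMeasure P] (hmom : UpperMoment P)
    (hstat : Stationary P) {l : ℕ} {ν : Env d → ℝ≥0∞} (hν : IsResistance P l ν)
    (ξ : Fin d → ℝ)
    (h : ∀ δ : ℝ≥0, 0 < δ → ∃ g, IsLocal g ∧ covNormSq P (linField ξ - grad g) < δ) : ξ = 0 := by
  funext i
  by_contra hne
  set A : ℝ≥0∞ := (l + 1) * (∫⁻ ω, ν ω ∂P + (box d l).card) with hA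
  have hAt : A ≠ ∞ := by
    have := hν.lintegral_lt_top
    finiteness
  -- choose a gradient whose squared distance to `ξ · z` is less than `t²`, and the weight `t` in
  -- the bound on the mean of the difference at a unit vector
  have key : ∀ t : ℝ≥0, 0 < t → ENNReal.ofReal |ξ i| ≤ t * A := by
    intro t ht
    have ht0 : (t : ℝ≥0∞) ≠ 0 := by exact_mod_cast ht.ne'
    obtain ⟨g, hg, hd⟩ := h (t ^ 2) (by positivity)
    have hcov := (memCov_linField hmom ξ).sub (memCov_grad hmom hg)
    have h1 := lintegral_abs_le hstat hν hcov (adj_single i) ht0 ENNReal.coe_ne_top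
    have h2 : ξ i = ∫ ω, (linField ξ - grad g) ω (Pi.single i 1) ∂P := by
      have e : ∀ ω, (linField ξ - grad g) ω (Pi.single i 1) = ξ i - grad g ω (Pi.single i 1) := by
        intro ω
        simp only [Pi.sub_apply, linField]
        congr 1
        rw [Finset.sum_eq_single i]
        · simp
        · intro j _ hj; simp [hj]
        · simp
      simp_rw [e]
      obtain ⟨C, hC⟩ := hg.bounded
      rw [integral_sub (integrable_const _), integral_grad hstat hg]
      · simp
      · exact Integrable.of_bound ((memCov_grad hmom hg).measurable _).aestronglyMeasurable (C + C)
          (Eventually.of_forall fun ω => (norm_sub_le _ _).trans (add_le_add (hC _) (hC _)))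
    have h3 : ENNReal.ofReal |ξ i| ≤
        ∫⁻ ω, ENNReal.ofReal |(linField ξ - grad g) ω (Pi.single i 1)| ∂P := by
      rw [← Real.enorm_eq_ofReal_abs, h2]
      refine (enorm_integral_le_lintegral_enorm _).trans (le_of_eq ?_)
      simp_rw [Real.enorm_eq_ofReal_abs]
    refine (h3.trans h1).trans ?_
    have h4 : (t : ℝ≥0∞)⁻¹ * ((box d l).card * covNormSq P (linField ξ - grad g)) ≤
        t * (box d l).card := by
      calc (t : ℝ≥0∞)⁻¹ * ((box d l).card * covNormSq P (linField ξ - grad g))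
          ≤ (t : ℝ≥0∞)⁻¹ * ((box d l).card * (t * t)) := by
            gcongr; rw [← pow_two]; exact_mod_cast hd.le
        _ = ((t : ℝ≥0∞)⁻¹ * t) * (t * (box d l).card) := by ring
        _ = _ := by rw [ENNReal.inv_mul_cancel ht0 ENNReal.coe_ne_top, one_mul]
    calc (l + 1 : ℝ≥0∞) * (t * ∫⁻ ω, ν ω ∂P +
          (t : ℝ≥0∞)⁻¹ * ((box d l).card * covNormSq P (linField ξ - grad g)))
        ≤ (l + 1 : ℝ≥0∞) * (t * ∫⁻ ω, ν ω ∂P + t * (box d l).card) := by gcongr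
      _ = t * A := by rw [hA]; ring
  have hpos : 0 < ENNReal.ofReal |ξ i| := ENNReal.ofReal_pos.2 (abs_pos.2 hne)
  have hA1 : 0 < ENNReal.ofReal |ξ i| / (A + 1) := ENNReal.div_pos hpos.ne' (by finiteness)
  obtain ⟨t, ht0, ht⟩ := ENNReal.lt_iff_exists_nnreal_btwn.1 hA1
  have h5 := key t (by exact_mod_cast ht0)
  rw [ENNReal.lt_div_iff_mul_lt (by simp) (by left; finiteness)] at ht
  refine absurd (h5.trans_lt (lt_of_le_of_lt ?_ ht)) (lt_irrefl _)
  gcongr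
  exact le_self_add

/-- Solenoidal test fields `b` detect all directions: the vectors `(⟨z_j, b⟩)_j` span `ℝ^d`. -/
theorem exists_dual_combination [IsProbabilityMeasure P] (hmom : UpperMoment P)
    (hstat : Stationary P) {l : ℕ} {ν : Env d → ℝ≥0∞} (hν : IsResistance P l ν)
    {Φsol Φpot : Set (Field d)} (hΦ : IsTestFamily P Φsol Φpot) (i : Fin d) :
    ∃ c : Field d →₀ ℝ, (c.support : Set (Field d)) ⊆ Φsol ∧
      ∀ j, (c.sum fun b r => r * covInner P (coordField j) b) = if i = j then 1 else 0 := by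
  classical
  let vec : Field d → Fin d → ℝ := fun b j => covInner P (coordField j) b
  have hconn := ae_connected hν hstat
  have hspan : Submodule.span ℝ (vec '' Φsol) = ⊤ := by
    by_contra hne
    -- otherwise some `ξ ≠ 0` makes `ξ · z` orthogonal to the solenoidal test fields
    obtain ⟨f, hf, hle⟩ := Submodule.exists_le_ker_of_lt_top _ (lt_top_iff_ne_top.2 hne)
    let ξ : Fin d → ℝ := fun j => f (Pi.single j 1)
    have hfξ : ∀ v, f v = ∑ j, ξ j * v j := by
      intro v
      conv_lhs => rw [pi_eq_sum_univ v]
      rw [map_sum]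
      refine Finset.sum_congr rfl fun j _ => ?_
      rw [map_smul, smul_eq_mul, mul_comm]
      congr 2
      funext k
      simp [Pi.single_apply, eq_comm]
    refine hf (LinearMap.ext fun v => ?_)
    -- such a linear field is potential, hence it vanishes
    have hξ : ξ = 0 := by
      have hL := memCov_linField hmom ξ
      have horth : ∀ b ∈ Φsol, ∫ p, linField ξ p.1 p.2 * b p.1 p.2 ∂(edgeMeasure P) = 0 := by
        intro b hb
        have hbL := (hΦ.sol_mem b hb).1.memLp
        have h1 : f (vec b) = 0 := hle (Submodule.subset_span ⟨b, hb, rfl⟩)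
        rw [hfξ] at h1
        rw [← h1]
        simp only [vec]
        simp_rw [fun j => covInner_eq_integral hmom hstat (memCov_coordField hmom j).memLp hbL,
          ← integral_const_mul]
        rw [← integral_finsetSum]
        · refine integral_congr_ae (Eventually.of_forall fun p => ?_)
          simp only [linField, coordField, Finset.sum_mul, mul_assoc]
        · exact fun j _ => ((memCov_coordField hmom j).memLp.integrable_mul hbL).const_mul _
      have horth' : ∀ b ∈ Submodule.span ℝ Φsol,
          MemCov P b ∧ ∫ p, linField ξ p.1 p.2 * b p.1 p.2 ∂(edgeMeasure P) = 0 := by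
        intro b hb
        induction hb using Submodule.span_induction with
        | mem b hb => exact ⟨(hΦ.sol_mem b hb).1, horth b hb⟩
        | zero => exact ⟨memCov_zero, by simp⟩
        | add b b' _ _ h h' =>
          refine ⟨h.1.add h'.1, ?_⟩
          simp only [Pi.add_apply, mul_add]
          rw [integral_add, h.2, h'.2, add_zero]
          · exact hL.memLp.integrable_mul h.1.memLp
          · exact hL.memLp.integrable_mul h'.1.memLp
        | smul r b _ h =>
          refine ⟨h.1.smul r, ?_⟩
          simp only [Pi.smul_apply, smul_eq_mul, mul_left_comm]
          rw [integral_const_mul, h.2, mul_zero]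
      obtain ⟨p, s, hp, hs, hps⟩ := exists_memPot_add_memSol hmom hstat hconn hL
      -- `s` is orthogonal to itself: to `p` by definition, to `ξ · z` by density
      let S := hs.1.memLp.toLp _
      have hSL : inner ℝ (hL.memLp.toLp _) S = 0 := by
        let T : Submodule ℝ (Lp ℝ 2 (edgeMeasure P)) := (ℝ ∙ (hL.memLp.toLp _))ᗮ
        have hT : IsClosed (T : Set (Lp ℝ 2 (edgeMeasure P))) := Submodule.isClosed_orthogonal _
        have hmem : S ∈ T := by
          rw [← SetLike.mem_coe, ← hT.closure_eq]
          refine EMetric.mem_closure_iff.2 fun δ hδ => ?_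
          obtain ⟨η, hη0, hη⟩ := ENNReal.lt_iff_exists_nnreal_btwn.1 hδ
          obtain ⟨b, hb, hd⟩ := hΦ.sol_dense s hs (η ^ 2)
            (by have : 0 < η := by exact_mod_cast hη0
                positivity)
          obtain ⟨hbC, hb0⟩ := horth' b hb
          refine ⟨hbC.memLp.toLp _, ?_, ?_⟩
          · rw [SetLike.mem_coe, Submodule.mem_orthogonal_singleton_iff_inner_right, L2.inner_def,
              ← hb0]
            refine integral_congr_ae ?_
            filter_upwards [hbC.memLp.coeFn_toLp, hL.memLp.coeFn_toLp] with q h1 h2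
            rw [h1, h2]
            simp [mul_comm]
          · rw [Lp.edist_toLp_toLp]
            refine lt_trans ?_ hη
            rw [covNormSq_lt_iff (hs.1.sub hbC).measurable] at hd
            exact hd
        exact (Submodule.mem_orthogonal_singleton_iff_inner_right).1 hmem
      have hSS : inner ℝ S S = 0 := by
        have e : hL.memLp.toLp _ = hp.1.memLp.toLp _ + S := by
          rw [← MemLp.toLp_add]
          exact MemLp.toLp_congr _ _ (Eventually.of_forall fun q => by
            simp [hps])
        rw [e, inner_add_left] at hSL
        have h2 : inner ℝ (hp.1.memLp.toLp _) S = 0 := by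
          have := hs.2 p hp
          rw [covInner_eq_integral hmom hstat hs.1.memLp hp.1.memLp] at this
          rw [L2.inner_def, ← this]
          refine integral_congr_ae ?_
          filter_upwards [hs.1.memLp.coeFn_toLp, hp.1.memLp.coeFn_toLp] with q h1 h2
          rw [h1, h2]
          simp
        rwa [h2, zero_add] at hSL
      have hS0 : S = 0 := inner_self_eq_zero.1 hSS
      have hs0 : ∀ᵐ q ∂(edgeMeasure P), s q.1 q.2 = 0 := by
        have := hs.1.memLp.coeFn_toLp
        rw [show hs.1.memLp.toLp _ = 0 from hS0] at this
        filter_upwards [this, Lp.coeFn_zero ℝ 2 (edgeMeasure P)] with q h1 h2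
        rw [← h1, h2]
        rfl
      refine eq_zero_of_linField_approx hmom hstat hν ξ fun δ hδ => ?_
      obtain ⟨g, hg, hd⟩ := hp.2 δ (by exact_mod_cast hδ)
      refine ⟨g, hg, ?_⟩
      have hgC := memCov_grad hmom hg
      rw [covNormSq_eq_lintegral (hL.sub hgC).measurable]
      rw [covNormSq_eq_lintegral (hp.1.sub hgC).measurable] at hd
      refine lt_of_eq_of_lt (lintegral_congr_ae ?_) hd
      filter_upwards [hs0] with q hq
      simp [hps, hq]
    rw [hfξ, hξ]
    simp
  have hmem : (Pi.single i 1 : Fin d → ℝ) ∈ Submodule.span ℝ (vec '' Φsol) := by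
    rw [hspan]; trivial
  obtain ⟨c, hc, hce⟩ := (Finsupp.mem_span_image_iff_linearCombination ℝ).1 hmem
  refine ⟨c, (Finsupp.mem_supported _ _).1 hc, fun j => ?_⟩
  have := congrFun hce j
  rw [Finsupp.linearCombination_apply, Finsupp.sum, Finset.sum_apply] at this
  simp only [Pi.smul_apply, smul_eq_mul, vec] at this
  rw [Finsupp.sum, this, Pi.single_apply]
  simp [eq_comm]

/-! ### Sums over the rescaled lattice -/

open Classical in
/-- The lattice points `x` with `ε x ∈ Q`, as a finite set; the box contains all of them if `ε > 0`.
-/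
def latQ (d : ℕ) (ε : ℝ) : Finset (Lat d) := (box d ⌈1 / ε⌉₊).filter fun x => scaled ε x ∈ cube d

theorem scaled_apply (ε : ℝ) (x : Lat d) (i : Fin d) : scaled ε x i = ε * (x i : ℝ) := rfl

theorem scaled_mem_cube {ε : ℝ} {x : Lat d} : scaled ε x ∈ cube d ↔ ∀ i, |ε * (x i : ℝ)| < 1 :=
  Iff.rfl

theorem mem_latQ {ε : ℝ} (hε : 0 < ε) {x : Lat d} : x ∈ latQ d ε ↔ scaled ε x ∈ cube d := by
  classical
  simp only [latQ, Finset.mem_filter, and_iff_right_iff_imp, mem_box]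
  intro h i
  have h1 := h i
  rw [scaled_apply, abs_mul, abs_of_pos hε] at h1
  have h2 : |(x i : ℝ)| < 1 / ε := by rw [lt_div_iff₀ hε]; linarith
  have h3 := h2.le.trans (Nat.le_ceil (1 / ε))
  exact_mod_cast h3

theorem latQ_subset_box (ε : ℝ) : latQ d ε ⊆ box d ⌈1 / ε⌉₊ := by
  classical
  exact Finset.filter_subset _ _

theorem pow_mul_card_box_le {ε : ℝ} (hε : 0 < ε) (hε1 : ε ≤ 1) (k : ℕ) :
    ε ^ d * ((box d (⌈1 / ε⌉₊ + k)).card : ℝ) ≤ (2 * k + 5 : ℝ) ^ d := by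
  rw [card_box]
  push_cast
  rw [← mul_pow]
  have h1 : (⌈1 / ε⌉₊ : ℝ) < 1 / ε + 1 := Nat.ceil_lt_add_one (by positivity)
  have h2 : ε * (⌈1 / ε⌉₊ : ℝ) ≤ 1 + ε := by
    calc ε * (⌈1 / ε⌉₊ : ℝ) ≤ ε * (1 / ε + 1) := by gcongr
      _ = 1 + ε := by field_simp
  have h3 : ε * (k : ℝ) ≤ k := mul_le_of_le_one_left (Nat.cast_nonneg k) hε1
  refine pow_le_pow_left₀ (by positivity) ?_ d
  nlinarith

theorem pow_mul_card_latQ_le {ε : ℝ} (hε : 0 < ε) (hε1 : ε ≤ 1) :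
    ε ^ d * ((latQ d ε).card : ℝ) ≤ 5 ^ d := by
  have := pow_mul_card_box_le (d := d) hε hε1 0
  simp only [add_zero, Nat.cast_zero, mul_zero, zero_add] at this
  refine le_trans ?_ this
  gcongr
  exact latQ_subset_box ε

theorem SuppInCube.eq_zero {ε : ℝ} (hε : 0 < ε) {U : Lat d → ℝ} (hU : SuppInCube ε U) {x : Lat d}
    (hx : x ∉ latQ d ε) : U x = 0 := by
  by_contra h
  exact hx ((mem_latQ hε).2 (hU x h))

/-- The real-valued conductance. -/
def rcond (ω : Env d) (x z : Lat d) : ℝ := (cond ω x z).toReal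

theorem rcond_nonneg (ω : Env d) (x z : Lat d) : 0 ≤ rcond ω x z := ENNReal.toReal_nonneg

theorem rcond_neg (ω : Env d) (x z : Lat d) : rcond ω (x + z) (-z) = rcond ω x z := by
  rw [rcond, cond_neg, rcond]

/-- The reversal `(x, z) ↦ (x + z, -z)` of oriented edges. -/
def edgeFlip (d : ℕ) : (Lat d × Lat d) ≃ (Lat d × Lat d) where
  toFun p := (p.1 + p.2, -p.2)
  invFun p := (p.1 + p.2, -p.2)
  left_inv p := by simp
  right_inv p := by simp

theorem edgeFlip_apply (p : Lat d × Lat d) : edgeFlip d p = (p.1 + p.2, -p.2) := rfl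

theorem discDeriv_flip (ε : ℝ) (U : Lat d → ℝ) (x z : Lat d) :
    discDeriv ε U (x + z) (-z) = -discDeriv ε U x z := by
  simp only [discDeriv, add_neg_cancel_right]
  ring

theorem covariant_flip {φ : Field d} (hφ : ∀ ω x z, φ ω (x + z) - φ ω x = φ (shift x ω) z)
    (ω : Env d) (x z : Lat d) : φ (shift (x + z) ω) (-z) = -φ (shift x ω) z := by
  rw [← hφ, ← hφ]
  simp

theorem summable_indicator_fst {w : Lat d → Lat d → ℝ} (hw0 : ∀ x z, 0 ≤ w x z)
    (hw : ∀ x, Summable (w x)) (S : Finset (Lat d)) :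
    Summable (fun p : Lat d × Lat d => if p.1 ∈ S then w p.1 p.2 else 0) ∧
      ∑' p : Lat d × Lat d, (if p.1 ∈ S then w p.1 p.2 else 0) = ∑ x ∈ S, ∑' z, w x z := by
  have h1 : ∀ x, Summable fun z => if x ∈ S then w x z else 0 := fun x => by
    by_cases hx : x ∈ S
    · simpa [hx] using hw x
    · simp [hx, summable_zero]
  have h2 : ∀ x, ∑' z, (if x ∈ S then w x z else 0) =
      if x ∈ S then ∑' z, w x z else 0 := fun x => by
    by_cases hx : x ∈ S <;> simp [hx]
  have h3 : Summable (fun p : Lat d × Lat d => if p.1 ∈ S then w p.1 p.2 else 0) := by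
    refine (summable_prod_of_nonneg fun p => ?_).2 ⟨h1, ?_⟩
    · dsimp; split_ifs; exacts [hw0 _ _, le_rfl]
    · simp only [h2]
      exact summable_of_ne_finset_zero (s := S) fun x hx => if_neg hx
  refine ⟨h3, ?_⟩
  rw [h3.tsum_prod' h1]
  simp only [h2]
  rw [tsum_eq_sum (s := S) fun x hx => if_neg hx]
  exact Finset.sum_congr rfl fun x hx => if_pos hx

theorem summable_indicator_snd {w : Lat d → Lat d → ℝ} (hw0 : ∀ x z, 0 ≤ w x z)
    (hw : ∀ x, Summable (w x)) (hflip : ∀ x z, w (x + z) (-z) = w x z) (S : Finset (Lat d)) :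
    Summable (fun p : Lat d × Lat d => if p.1 + p.2 ∈ S then w p.1 p.2 else 0) := by
  have := (edgeFlip d).summable_iff.2 (summable_indicator_fst hw0 hw S).1
  refine this.congr fun p => ?_
  simp only [Function.comp_apply, edgeFlip_apply, hflip]

/-- The edges with an endpoint in `S`; each of them is the reversal of one that starts in `S`, or
starts there itself. -/
theorem summable_near {w : Lat d → Lat d → ℝ} (hw0 : ∀ x z, 0 ≤ w x z)
    (hw : ∀ x, Summable (w x)) (hflip : ∀ x z, w (x + z) (-z) = w x z) (S : Finset (Lat d)) :
    Summable (fun p : Lat d × Lat d => if p.1 ∈ S ∨ p.1 + p.2 ∈ S then w p.1 p.2 else 0) ∧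
      ∑' p : Lat d × Lat d, (if p.1 ∈ S ∨ p.1 + p.2 ∈ S then w p.1 p.2 else 0) ≤
        2 * ∑ x ∈ S, ∑' z, w x z := by
  have h1 := summable_indicator_fst hw0 hw S
  have h2 := summable_indicator_snd hw0 hw hflip S
  have hle : ∀ p : Lat d × Lat d, (if p.1 ∈ S ∨ p.1 + p.2 ∈ S then w p.1 p.2 else 0) ≤
      (if p.1 ∈ S then w p.1 p.2 else 0) + (if p.1 + p.2 ∈ S then w p.1 p.2 else 0) := by
    intro p
    have := hw0 p.1 p.2
    by_cases ha : p.1 ∈ S <;> by_cases hb : p.1 + p.2 ∈ S <;> simp [ha, hb, this]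
  have h3 : Summable (fun p : Lat d × Lat d => if p.1 ∈ S ∨ p.1 + p.2 ∈ S then w p.1 p.2 else 0) :=
    (h1.1.add h2).of_nonneg_of_le (fun p => by split_ifs; exacts [hw0 _ _, le_rfl]) hle
  refine ⟨h3, (h3.tsum_le_tsum hle (h1.1.add h2)).trans (le_of_eq ?_)⟩
  rw [h1.1.tsum_add h2, h1.2, two_mul]
  congr 1
  rw [← h1.2, ← (edgeFlip d).tsum_eq]
  refine tsum_congr fun p => ?_
  simp only [edgeFlip_apply, add_neg_cancel_right]
  split_ifs
  exacts [hflip _ _, rfl]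

/-- The energy as a convergent real series. -/
theorem summable_energy {ω : Env d} (hω : ∀ x z, cond ω x z < ∞) {ε : ℝ} (hε : 0 < ε)
    {U : Lat d → ℝ} {C : ℝ≥0} (hC : gradEnergy ω ε U ≤ C) :
    Summable (fun p : Lat d × Lat d => rcond ω p.1 p.2 * discDeriv ε U p.1 p.2 ^ 2) ∧
      ε ^ d * ∑' p : Lat d × Lat d, rcond ω p.1 p.2 * discDeriv ε U p.1 p.2 ^ 2 ≤ C := by
  have e : ∀ p : Lat d × Lat d, cond ω p.1 p.2 * ENNReal.ofReal (discDeriv ε U p.1 p.2 ^ 2) =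
      ENNReal.ofReal (rcond ω p.1 p.2 * discDeriv ε U p.1 p.2 ^ 2) := fun p => by
    rw [ENNReal.ofReal_mul (rcond_nonneg _ _ _), rcond, ENNReal.ofReal_toReal (hω _ _).ne]
  have hnn : ∀ p : Lat d × Lat d, 0 ≤ rcond ω p.1 p.2 * discDeriv ε U p.1 p.2 ^ 2 := fun p =>
    mul_nonneg (rcond_nonneg _ _ _) (sq_nonneg _)
  rw [gradEnergy, ← ENNReal.tsum_prod
    (f := fun x z => cond ω x z * ENNReal.ofReal (discDeriv ε U x z ^ 2)), tsum_congr e] at hC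
  have hεd : 0 < ε ^ d := by positivity
  have hfin : ∑' p : Lat d × Lat d,
      ENNReal.ofReal (rcond ω p.1 p.2 * discDeriv ε U p.1 p.2 ^ 2) ≠ ∞ := by
    intro h
    rw [h, ENNReal.mul_top (ENNReal.ofReal_pos.2 hεd).ne'] at hC
    simp at hC
  have hs : Summable (fun p : Lat d × Lat d => rcond ω p.1 p.2 * discDeriv ε U p.1 p.2 ^ 2) :=
    (ENNReal.summable_toReal hfin).congr fun p => ENNReal.toReal_ofReal (hnn p)
  refine ⟨hs, ?_⟩
  rw [← ENNReal.ofReal_tsum_of_nonneg hnn hs, ← ENNReal.ofReal_mul hεd.le,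
    ← ENNReal.ofReal_coe_nnreal] at hC
  exact (ENNReal.ofReal_le_ofReal_iff C.2).1 hC

theorem abs_mul_le_half {c W ψ s : ℝ} (hc : 0 ≤ c) (hs : 0 < s) :
    |c * (W * ψ)| ≤ (s * (c * W ^ 2) + s⁻¹ * (c * ψ ^ 2)) / 2 := by
  rw [abs_mul, abs_of_nonneg hc, abs_mul]
  have key : (s * W ^ 2 + s⁻¹ * ψ ^ 2) / 2 - |W| * |ψ| = (s * |W| - |ψ|) ^ 2 / (2 * s) := by
    rw [sub_sq, mul_pow, sq_abs, sq_abs]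
    field_simp
    ring
  have h2 : 0 ≤ (s * |W| - |ψ|) ^ 2 / (2 * s) := by positivity
  have h3 : |W| * |ψ| ≤ (s * W ^ 2 + s⁻¹ * ψ ^ 2) / 2 := by linarith
  calc c * (|W| * |ψ|) ≤ c * ((s * W ^ 2 + s⁻¹ * ψ ^ 2) / 2) := by gcongr
    _ = _ := by ring

/-- The expression tested in two-scale convergence. -/
def pairing (ω : Env d) (ε : ℝ) (U : Lat d → ℝ) (v : Sp d → ℝ) (φ : Field d) : ℝ :=
  ε ^ d * ∑' x, v (scaled ε x) *
    ∑' z, (cond ω x z).toReal * (discDeriv ε U x z * φ (shift x ω) z)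

/-- The part of `pairing` that comes from the base points in `Q`. -/
def pairingQ (ω : Env d) (ε : ℝ) (U : Lat d → ℝ) (v : Sp d → ℝ) (φ : Field d) : ℝ :=
  ε ^ d * ∑ x ∈ latQ d ε, v (scaled ε x) *
    ∑' z, rcond ω x z * (discDeriv ε U x z * φ (shift x ω) z)

/-- A lattice function of the rescaled lattice with support in `Q` and energy at most `C`, at an
environment with finite conductances. -/
structure Admissible (ω : Env d) (ε : ℝ) (U : Lat d → ℝ) (C : ℝ≥0) : Prop where
  cond_lt_top : ∀ x z, cond ω x z < ∞
  pos : 0 < ε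
  le_one : ε ≤ 1
  supp : SuppInCube ε U
  energy : gradEnergy ω ε U ≤ C

variable {ω : Env d} {ε : ℝ} {U : Lat d → ℝ} {C : ℝ≥0}

theorem Admissible.discDeriv_eq_zero (h : Admissible ω ε U C) {x z : Lat d}
    (hx : ¬ (x ∈ latQ d ε ∨ x + z ∈ latQ d ε)) : discDeriv ε U x z = 0 := by
  rw [not_or] at hx
  rw [discDeriv, h.supp.eq_zero h.pos hx.1, h.supp.eq_zero h.pos hx.2]
  simp

theorem Admissible.summable_pair (h : Admissible ω ε U C) {ψ : Lat d → Lat d → ℝ}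
    (hψ : ∀ x, Summable fun z => rcond ω x z * ψ x z ^ 2)
    (hflip : ∀ x z, ψ (x + z) (-z) ^ 2 = ψ x z ^ 2) :
    Summable fun p : Lat d × Lat d =>
      rcond ω p.1 p.2 * (discDeriv ε U p.1 p.2 * ψ p.1 p.2) := by
  have h1 := (summable_energy h.cond_lt_top h.pos h.energy).1
  have h2 := (summable_near (w := fun x z => rcond ω x z * ψ x z ^ 2)
    (fun x z => mul_nonneg (rcond_nonneg _ _ _) (sq_nonneg _)) hψ
    (fun x z => by rw [rcond_neg, hflip]) (latQ d ε)).1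
  refine Summable.of_norm_bounded (h1.add h2) fun p => ?_
  by_cases hp : p.1 ∈ latQ d ε ∨ p.1 + p.2 ∈ latQ d ε
  · have := abs_mul_le_half (W := discDeriv ε U p.1 p.2) (ψ := ψ p.1 p.2)
      (rcond_nonneg ω p.1 p.2) one_pos
    rw [Real.norm_eq_abs, if_pos hp]
    simp only [one_mul, inv_one] at this
    have h3 := mul_nonneg (rcond_nonneg ω p.1 p.2) (sq_nonneg (discDeriv ε U p.1 p.2))
    have h4 := mul_nonneg (rcond_nonneg ω p.1 p.2) (sq_nonneg (ψ p.1 p.2))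
    linarith
  · rw [h.discDeriv_eq_zero hp, if_neg hp]
    simp

theorem Admissible.summable_pair_mul (h : Admissible ω ε U C) {ψ : Lat d → Lat d → ℝ}
    (hψ : ∀ x, Summable fun z => rcond ω x z * ψ x z ^ 2)
    (hflip : ∀ x z, ψ (x + z) (-z) ^ 2 = ψ x z ^ 2) {m : Lat d × Lat d → ℝ} {K : ℝ}
    (hm : ∀ p, |m p| ≤ K) :
    Summable fun p : Lat d × Lat d =>
      m p * (rcond ω p.1 p.2 * (discDeriv ε U p.1 p.2 * ψ p.1 p.2)) := by
  refine Summable.of_norm_bounded ((h.summable_pair hψ hflip).norm.mul_left K) fun p => ?_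
  rw [norm_mul]
  gcongr
  exact hm p

theorem Admissible.pairing_eq (h : Admissible ω ε U C) {φ : Field d}
    (hφ : ∀ x, Summable fun z => rcond ω x z * φ (shift x ω) z ^ 2)
    (hflip : ∀ x z, φ (shift (x + z) ω) (-z) ^ 2 = φ (shift x ω) z ^ 2) {v : Sp d → ℝ} {K : ℝ}
    (hv : ∀ x, |v x| ≤ K) :
    pairing ω ε U v φ = ε ^ d * ∑' p : Lat d × Lat d, v (scaled ε p.1) *
      (rcond ω p.1 p.2 * (discDeriv ε U p.1 p.2 * φ (shift p.1 ω) p.2)) := by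
  have hs := h.summable_pair_mul (ψ := fun x z => φ (shift x ω) z) hφ hflip
    (m := fun p => v (scaled ε p.1)) fun p => hv _
  rw [pairing, hs.tsum_prod]
  congr 1
  refine tsum_congr fun x => ?_
  rw [← tsum_mul_left]
  rfl

theorem Admissible.pairing_sub_pairingQ (h : Admissible ω ε U C) {φ : Field d}
    (hφ : ∀ x, Summable fun z => rcond ω x z * φ (shift x ω) z ^ 2)
    (hflip : ∀ x z, φ (shift (x + z) ω) (-z) ^ 2 = φ (shift x ω) z ^ 2) {v : Sp d → ℝ} {K : ℝ}
    (hv : ∀ x, |v x| ≤ K) :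
    pairing ω ε U v φ - pairingQ ω ε U v φ = ε ^ d * ∑' p : Lat d × Lat d,
      (if p.1 ∈ latQ d ε then 0 else v (scaled ε p.1)) *
      (rcond ω p.1 p.2 * (discDeriv ε U p.1 p.2 * φ (shift p.1 ω) p.2)) := by
  have hK : 0 ≤ K := (abs_nonneg _).trans (hv 0)
  have hs := h.summable_pair_mul (ψ := fun x z => φ (shift x ω) z) hφ hflip
    (m := fun p => v (scaled ε p.1)) fun p => hv _
  have hs1 := h.summable_pair_mul (ψ := fun x z => φ (shift x ω) z) hφ hflip
    (m := fun p => if p.1 ∈ latQ d ε then v (scaled ε p.1) else 0) (K := K) fun p => by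
      split_ifs
      · exact hv _
      · simpa using hK
  rw [h.pairing_eq hφ hflip hv, pairingQ, ← mul_sub]
  have e : ∑ x ∈ latQ d ε, v (scaled ε x) *
      ∑' z, rcond ω x z * (discDeriv ε U x z * φ (shift x ω) z) =
      ∑' p : Lat d × Lat d, (if p.1 ∈ latQ d ε then v (scaled ε p.1) else 0) *
      (rcond ω p.1 p.2 * (discDeriv ε U p.1 p.2 * φ (shift p.1 ω) p.2)) := by
    rw [hs1.tsum_prod, tsum_eq_sum (s := latQ d ε)]
    · refine Finset.sum_congr rfl fun x hx => ?_
      simp only [hx, if_true]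
      rw [tsum_mul_left]
    · intro x hx
      simp [hx]
  rw [e, ← hs.tsum_sub hs1]
  congr 1
  refine tsum_congr fun p => ?_
  split_ifs <;> ring

/-- The contribution of the base points outside of `Q` is controlled by the edges leaving `Q`, with
a weight `s` between them and the energy. -/
theorem Admissible.abs_pairing_sub_le (h : Admissible ω ε U C) {φ : Field d}
    (hφ : ∀ x, Summable fun z => rcond ω x z * φ (shift x ω) z ^ 2)
    (hflip : ∀ x z, φ (shift (x + z) ω) (-z) ^ 2 = φ (shift x ω) z ^ 2) {v : Sp d → ℝ} {K : ℝ}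
    (hv : ∀ x, |v x| ≤ K) {s : ℝ} (hs : 0 < s) :
    |pairing ω ε U v φ - pairingQ ω ε U v φ| ≤ K * (s * C + s⁻¹ * (ε ^ d * ∑ x ∈ latQ d ε,
      ∑' z, if x + z ∈ latQ d ε then 0 else rcond ω x z * φ (shift x ω) z ^ 2)) := by
  have hK : 0 ≤ K := (abs_nonneg _).trans (hv 0)
  obtain ⟨hE, hEC⟩ := summable_energy h.cond_lt_top h.pos h.energy
  have hεd : 0 < ε ^ d := pow_pos h.pos d
  obtain ⟨w, hw⟩ : ∃ w : Lat d → Lat d → ℝ, w = fun x z =>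
    if x + z ∈ latQ d ε then 0 else rcond ω x z * φ (shift x ω) z ^ 2 := ⟨_, rfl⟩
  have hnn : ∀ x z, 0 ≤ rcond ω x z * φ (shift x ω) z ^ 2 := fun x z =>
    mul_nonneg (rcond_nonneg _ _ _) (sq_nonneg _)
  have hw0 : ∀ x z, 0 ≤ w x z := fun x z => by
    simp only [hw]; split_ifs; exacts [le_rfl, hnn x z]
  have hws : ∀ x, Summable (w x) := fun x =>
    (hφ x).of_nonneg_of_le (hw0 x) fun z => by
      simp only [hw]; split_ifs; exacts [hnn x z, le_rfl]
  -- the edges that leave `Q`, and by reversal those that enter it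
  obtain ⟨B, hBdef⟩ : ∃ B : Lat d × Lat d → ℝ,
      B = fun p => if p.1 ∈ latQ d ε then w p.1 p.2 else 0 := ⟨_, rfl⟩
  have hB : Summable B ∧ ∑' p, B p = ∑ x ∈ latQ d ε, ∑' z, w x z := by
    rw [hBdef]; exact summable_indicator_fst hw0 hws (latQ d ε)
  have hB0 : ∀ p, 0 ≤ B p := fun p => by
    simp only [hBdef]; split_ifs; exacts [hw0 _ _, le_rfl]
  have hB' : Summable fun p => B (edgeFlip d p) := (edgeFlip d).summable_iff.2 hB.1
  have hB'e : ∑' p, B (edgeFlip d p) = ∑ x ∈ latQ d ε, ∑' z, w x z := by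
    rw [← hB.2, (edgeFlip d).tsum_eq B]
  have hBval : ∀ p : Lat d × Lat d, p.1 ∉ latQ d ε → p.1 + p.2 ∈ latQ d ε →
      B (edgeFlip d p) = rcond ω p.1 p.2 * φ (shift p.1 ω) p.2 ^ 2 := by
    intro p hp hp2
    simp only [hBdef, edgeFlip_apply, hp2, if_true, hw, add_neg_cancel_right, hp, if_false]
    rw [rcond_neg, hflip]
  rw [h.pairing_sub_pairingQ hφ hflip hv, abs_mul, abs_of_pos hεd]
  -- the discrete derivative vanishes on edges with both endpoints outside of `Q`
  have hbound : ∀ p : Lat d × Lat d, ‖(if p.1 ∈ latQ d ε then 0 else v (scaled ε p.1)) *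
      (rcond ω p.1 p.2 * (discDeriv ε U p.1 p.2 * φ (shift p.1 ω) p.2))‖ ≤
      K * (s * (rcond ω p.1 p.2 * discDeriv ε U p.1 p.2 ^ 2) + s⁻¹ * B (edgeFlip d p)) := by
    intro p
    have h3 := mul_nonneg (rcond_nonneg ω p.1 p.2) (sq_nonneg (discDeriv ε U p.1 p.2))
    have h5 := hB0 (edgeFlip d p)
    have h6 : 0 ≤ K * (s * (rcond ω p.1 p.2 * discDeriv ε U p.1 p.2 ^ 2) +
        s⁻¹ * B (edgeFlip d p)) := by positivity
    by_cases hp : p.1 ∈ latQ d ε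
    · rw [if_pos hp, zero_mul, norm_zero]
      exact h6
    by_cases hp2 : p.1 + p.2 ∈ latQ d ε
    · rw [hBval p hp hp2, if_neg hp, norm_mul, Real.norm_eq_abs, Real.norm_eq_abs]
      refine mul_le_mul (hv _) ?_ (abs_nonneg _) hK
      have := abs_mul_le_half (W := discDeriv ε U p.1 p.2) (ψ := φ (shift p.1 ω) p.2)
        (rcond_nonneg ω p.1 p.2) hs
      have h4 := hnn p.1 p.2
      have h7 : 0 ≤ s * (rcond ω p.1 p.2 * discDeriv ε U p.1 p.2 ^ 2) := by positivity
      have h8 : 0 ≤ s⁻¹ * (rcond ω p.1 p.2 * φ (shift p.1 ω) p.2 ^ 2) := by positivity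
      linarith
    · have h7 : (if p.1 ∈ latQ d ε then 0 else v (scaled ε p.1)) *
          (rcond ω p.1 p.2 * (discDeriv ε U p.1 p.2 * φ (shift p.1 ω) p.2)) = 0 := by
        rw [h.discDeriv_eq_zero (not_or.2 ⟨hp, hp2⟩)]; ring
      rw [h7, norm_zero]
      exact h6
  have hsum := tsum_of_norm_bounded (((hE.mul_left s).add (hB'.mul_left s⁻¹)).mul_left K).hasSum
    hbound
  rw [tsum_mul_left, (hE.mul_left s).tsum_add (hB'.mul_left s⁻¹), tsum_mul_left, tsum_mul_left,
    hB'e, Real.norm_eq_abs] at hsum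
  refine (mul_le_mul_of_nonneg_left hsum hεd.le).trans ?_
  have hws' : ∀ x, ∑' z, w x z =
      ∑' z, if x + z ∈ latQ d ε then 0 else rcond ω x z * φ (shift x ω) z ^ 2 := fun x => by
    rw [hw]
  simp_rw [← hws']
  have hfin : ε ^ d * (K * (s * ∑' p : Lat d × Lat d, rcond ω p.1 p.2 * discDeriv ε U p.1 p.2 ^ 2 +
      s⁻¹ * ∑ x ∈ latQ d ε, ∑' z, w x z)) =
      K * (s * (ε ^ d * ∑' p : Lat d × Lat d, rcond ω p.1 p.2 * discDeriv ε U p.1 p.2 ^ 2) +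
        s⁻¹ * (ε ^ d * ∑ x ∈ latQ d ε, ∑' z, w x z)) := by ring
  rw [hfin]
  gcongr

/-! ### The cube -/

theorem continuous_coord (i : Fin d) : Continuous fun x : Sp d => x i :=
  (EuclideanSpace.proj i : Sp d →L[ℝ] ℝ).continuous

/-- The supremum norm on `ℝ^d`. -/
def supNorm (x : Sp d) : ℝ := ‖(fun i => x i : Fin d → ℝ)‖

theorem continuous_supNorm : Continuous (supNorm : Sp d → ℝ) :=
  continuous_norm.comp (continuous_pi continuous_coord)

theorem supNorm_nonneg (x : Sp d) : 0 ≤ supNorm x := norm_nonneg _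

theorem mem_cube_iff {x : Sp d} : x ∈ cube d ↔ supNorm x < 1 := by
  rw [supNorm, pi_norm_lt_iff one_pos]
  rfl

theorem isOpen_cube : IsOpen (cube d) := by
  have : cube d = supNorm ⁻¹' Set.Iio 1 := by ext x; exact mem_cube_iff
  rw [this]
  exact isOpen_Iio.preimage continuous_supNorm

theorem measurableSet_cube : MeasurableSet (cube d) := isOpen_cube.measurableSet

theorem norm_le_of_abs_le {x : Sp d} {r : ℝ} (hr : 0 ≤ r) (h : ∀ i, |x i| ≤ r) :
    ‖x‖ ≤ √d * r := by
  rw [EuclideanSpace.norm_eq, ← Real.sqrt_sq hr, ← Real.sqrt_mul (Nat.cast_nonneg d)]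
  refine Real.sqrt_le_sqrt ?_
  calc ∑ i, ‖x i‖ ^ 2 ≤ ∑ _i : Fin d, r ^ 2 := by
        refine Finset.sum_le_sum fun i _ => ?_
        rw [Real.norm_eq_abs]
        gcongr
        exact h i
    _ = d * r ^ 2 := by simp

theorem isBounded_abs_le (r : ℝ) : Bornology.IsBounded {x : Sp d | ∀ i, |x i| ≤ r} := by
  refine (Metric.isBounded_closedBall (x := (0 : Sp d)) (r := √d * |r|)).subset fun x hx => ?_
  rw [mem_closedBall_zero_iff]
  exact norm_le_of_abs_le (abs_nonneg r) fun i => (hx i).trans (le_abs_self r)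

theorem isBounded_cube : Bornology.IsBounded (cube d) :=
  (isBounded_abs_le 1).subset fun _ hx i => (hx i).le

theorem volume_cube_lt_top : volume (cube d) < ∞ := isBounded_cube.measure_lt_top

instance : IsFiniteMeasure ((volume : Measure (Sp d)).restrict (cube d)) :=
  ⟨by simpa using volume_cube_lt_top⟩

theorem tendsto_integral_supNorm_pow :
    Tendsto (fun n : ℕ => ∫ x in cube d, supNorm x ^ n) atTop (𝓝 0) := by
  have := tendsto_integral_of_dominated_convergence (μ := volume.restrict (cube d))
    (F := fun (n : ℕ) x => supNorm x ^ n) (f := fun _ => (0 : ℝ)) (fun _ => (1 : ℝ))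
    (fun n => (continuous_supNorm.pow n).aestronglyMeasurable) (integrable_const _)
    (fun n => by
      filter_upwards [ae_restrict_mem measurableSet_cube] with x hx
      rw [Real.norm_of_nonneg (pow_nonneg (supNorm_nonneg x) n)]
      exact pow_le_one₀ (supNorm_nonneg x) (mem_cube_iff.1 hx).le)
    (by
      filter_upwards [ae_restrict_mem measurableSet_cube] with x hx
      exact tendsto_pow_atTop_nhds_zero_of_lt_one (supNorm_nonneg x) (mem_cube_iff.1 hx))
  simpa using this

/-! ### Localization to the cube -/

theorem ErgodicLimit.tendsto_latQ {f : Env d → ℝ} {ω : Env d} (h : ErgodicLimit P f ω)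
    {v : Sp d → ℝ} (hv : Continuous v) {ε : ℕ → ℝ} (hε : ∀ k, 0 < ε k)
    (h0 : Tendsto ε atTop (𝓝 0)) :
    Tendsto (fun k => ε k ^ d * ∑ x ∈ latQ d (ε k), v (scaled (ε k) x) * f (shift x ω)) atTop
      (𝓝 ((∫ ω', f ω' ∂P) * ∫ x in cube d, v x)) := by
  classical
  have h1 : Tendsto ε atTop (𝓝[>] 0) :=
    tendsto_nhdsWithin_iff.2 ⟨h0, Eventually.of_forall hε⟩
  refine ((h v hv.continuousOn).comp h1).congr fun k => ?_
  simp only [Function.comp_apply]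
  congr 1
  rw [tsum_eq_sum (s := latQ d (ε k))]
  · exact Finset.sum_congr rfl fun x hx => if_pos ((mem_latQ (hε k)).1 hx)
  · exact fun x hx => if_neg fun h => hx ((mem_latQ (hε k)).2 h)

theorem density_shift (φ ψ : Field d) (ω : Env d) (x : Lat d) :
    density φ ψ (shift x ω) =
      ∑' z, rcond ω x z * (φ (shift x ω) z * ψ (shift x ω) z) := by
  simp only [density, cond_shift_zero, rcond]

/-- The weight `ω_{x,z} (|z|² + φ(τ_x ω, z)²)`, which dominates both the field `φ` and the jump
lengths along a realization. -/
def weight (ω : Env d) (φ : Field d) (x z : Lat d) : ℝ :=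
  rcond ω x z * (sqLen z + φ (shift x ω) z ^ 2)

theorem mul_sq_le_weight (ω : Env d) (φ : Field d) (x z : Lat d) :
    rcond ω x z * φ (shift x ω) z ^ 2 ≤ weight ω φ x z :=
  mul_le_mul_of_nonneg_left (le_add_of_nonneg_left (sqLen_nonneg z)) (rcond_nonneg _ _ _)

theorem mul_sqLen_le_weight (ω : Env d) (φ : Field d) (x z : Lat d) :
    rcond ω x z * sqLen z ≤ weight ω φ x z :=
  mul_le_mul_of_nonneg_left (le_add_of_nonneg_right (sq_nonneg _)) (rcond_nonneg _ _ _)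

theorem rcond_le_weight (ω : Env d) (φ : Field d) (x z : Lat d) :
    rcond ω x z ≤ weight ω φ x z := by
  refine le_trans ?_ (mul_sqLen_le_weight ω φ x z)
  by_cases hz : z = 0
  · simp [hz, rcond]
  · exact le_mul_of_one_le_right (rcond_nonneg _ _ _) (one_le_sqLen hz)

theorem Tame.summable_sq {ω : Env d} {φ : Field d} (h : Tame (weight ω φ)) (x : Lat d) :
    Summable fun z => rcond ω x z * φ (shift x ω) z ^ 2 :=
  (h.summable x).of_nonneg_of_le (fun _ => mul_nonneg (rcond_nonneg _ _ _) (sq_nonneg _))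
    fun z => mul_sq_le_weight ω φ x z

theorem Tame.summable_sqLen {ω : Env d} {φ : Field d} (h : Tame (weight ω φ)) (x : Lat d) :
    Summable fun z => rcond ω x z * sqLen z :=
  (h.summable x).of_nonneg_of_le (fun _ => mul_nonneg (rcond_nonneg _ _ _) (sqLen_nonneg _))
    fun z => mul_sqLen_le_weight ω φ x z

theorem summable_mul_of_sq {ω : Env d} {x : Lat d} {f g : Lat d → ℝ}
    (hf : Summable fun z => rcond ω x z * f z ^ 2) (hg : Summable fun z => rcond ω x z * g z ^ 2) :
    Summable fun z => rcond ω x z * (f z * g z) := by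
  refine Summable.of_norm_bounded (hf.add hg) fun z => ?_
  have := abs_mul_le_half (W := f z) (ψ := g z) (rcond_nonneg ω x z) one_pos
  rw [Real.norm_eq_abs]
  simp only [one_mul, inv_one] at this
  have h3 := mul_nonneg (rcond_nonneg ω x z) (sq_nonneg (f z))
  have h4 := mul_nonneg (rcond_nonneg ω x z) (sq_nonneg (g z))
  linarith

theorem Tame.sum_latQ_le {w : Lat d → Lat d → ℝ} (h : Tame w) :
    ∃ C : ℝ, 0 ≤ C ∧ ∀ ε : ℝ, 0 < ε → ε ≤ 1 → ε ^ d * ∑ x ∈ latQ d ε, ∑' z, w x z ≤ C := by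
  obtain ⟨C, hC0, hC⟩ := h.bdd
  refine ⟨C * 5 ^ d, by positivity, fun ε hε hε1 => ?_⟩
  have h1 := pow_mul_card_box_le (d := d) hε hε1 0
  simp only [add_zero, Nat.cast_zero, mul_zero, zero_add] at h1
  calc ε ^ d * ∑ x ∈ latQ d ε, ∑' z, w x z
      ≤ ε ^ d * (C * (box d ⌈1 / ε⌉₊).card) := by
        refine mul_le_mul_of_nonneg_left ?_ (by positivity)
        exact (Finset.sum_le_sum_of_subset_of_nonneg (latQ_subset_box ε)
          fun x _ _ => tsum_nonneg (h.nonneg x)).trans (hC _)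
    _ = C * (ε ^ d * (box d ⌈1 / ε⌉₊).card) := by ring
    _ ≤ C * 5 ^ d := by gcongr

theorem Tame.sum_latQ_tail_le {w : Lat d → Lat d → ℝ} (h : Tame w) {δ : ℝ} (hδ : 0 < δ) :
    ∃ Z : Finset (Lat d), ∀ ε : ℝ, 0 < ε → ε ≤ 1 →
      ε ^ d * ∑ x ∈ latQ d ε, ∑' z, (if z ∈ Z then 0 else w x z) ≤ δ := by
  obtain ⟨Z, hZ⟩ := h.tail (δ / 5 ^ d) (by positivity)
  refine ⟨Z, fun ε hε hε1 => ?_⟩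
  have h1 := pow_mul_card_box_le (d := d) hε hε1 0
  simp only [add_zero, Nat.cast_zero, mul_zero, zero_add] at h1
  calc ε ^ d * ∑ x ∈ latQ d ε, ∑' z, (if z ∈ Z then 0 else w x z)
      ≤ ε ^ d * (δ / 5 ^ d * (box d ⌈1 / ε⌉₊).card) := by
        refine mul_le_mul_of_nonneg_left ?_ (by positivity)
        exact (Finset.sum_le_sum_of_subset_of_nonneg (latQ_subset_box ε)
          fun x _ _ => tsum_nonneg fun z => by
            split_ifs; exacts [le_rfl, h.nonneg x z]).trans (hZ _)
    _ = δ / 5 ^ d * (ε ^ d * (box d ⌈1 / ε⌉₊).card) := by ring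
    _ ≤ δ / 5 ^ d * 5 ^ d := by gcongr
    _ = δ := by field_simp

theorem one_sub_le_supNorm {ε : ℝ} (hε : 0 < ε) {M : ℕ} {x z : Lat d} (hz : z ∈ box d M)
    (hxz : x + z ∉ latQ d ε) : 1 - ε * M ≤ supNorm (scaled ε x) := by
  rw [mem_latQ hε, scaled_mem_cube] at hxz
  push Not at hxz
  obtain ⟨i, hi⟩ := hxz
  have h1 : |ε * (x i : ℝ)| ≤ supNorm (scaled ε x) :=
    norm_le_pi_norm (fun i => scaled ε x i) i
  have h2 : |(z i : ℝ)| ≤ M := by exact_mod_cast mem_box.1 hz i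
  have h3 : |ε * ((x + z) i : ℝ)| ≤ |ε * (x i : ℝ)| + ε * M := by
    rw [Pi.add_apply, Int.cast_add, mul_add]
    refine (abs_add_le _ _).trans ?_
    rw [abs_mul ε (z i : ℝ), abs_of_pos hε]
    gcongr
  linarith

/-- The edges leaving `Q` carry asymptotically no weight: long edges by uniform summability, short
ones because their base points are close to the boundary of `Q`. -/
theorem tendsto_boundary_zero {ω : Env d} {φ : Field d} (ht : Tame (weight ω φ))
    (herg : ErgodicLimit P (density φ φ) ω) {ε : ℕ → ℝ} (hε : ∀ k, 0 < ε k ∧ ε k ≤ 1)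
    (h0 : Tendsto ε atTop (𝓝 0)) :
    Tendsto (fun k => ε k ^ d * ∑ x ∈ latQ d (ε k), ∑' z,
      if x + z ∈ latQ d (ε k) then 0 else rcond ω x z * φ (shift x ω) z ^ 2) atTop (𝓝 0) := by
  have hnn : ∀ x z, 0 ≤ rcond ω x z * φ (shift x ω) z ^ 2 := fun x z =>
    mul_nonneg (rcond_nonneg _ _ _) (sq_nonneg _)
  have hden : ∀ x, density φ φ (shift x ω) = ∑' z, rcond ω x z * φ (shift x ω) z ^ 2 := fun x => by
    rw [density_shift]; simp_rw [← pow_two]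
  have hden0 : ∀ x, 0 ≤ density φ φ (shift x ω) := fun x => by
    rw [hden]; exact tsum_nonneg (hnn x)
  refine (nhds_basis_zero_abs_lt ℝ).tendsto_right_iff.2 fun δ hδ => ?_
  obtain ⟨Z, hZ⟩ := ht.sum_latQ_tail_le (half_pos hδ)
  -- short edges are those with `z ∈ Z`
  obtain ⟨M, hM⟩ : ∃ M, Z ⊆ box d M := by
    refine ⟨Z.sup fun z => Finset.univ.sup fun i => (z i).natAbs, fun z hz => mem_box.2 fun i => ?_⟩
    have h1 : (z i).natAbs ≤ Finset.univ.sup fun i => (z i).natAbs :=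
      Finset.le_sup (f := fun i => (z i).natAbs) (Finset.mem_univ i)
    have h2 := Finset.le_sup (f := fun z : Lat d => Finset.univ.sup fun i => (z i).natAbs) hz
    have h3 := h1.trans h2
    rw [Int.abs_eq_natAbs]
    exact_mod_cast h3
  -- the weight `supNorm ^ n` is close to one at the boundary of `Q` but has small integral over
  -- `Q`
  obtain ⟨n, hn⟩ : ∃ n : ℕ, (∫ ω', density φ φ ω' ∂P) * ∫ x in cube d, supNorm x ^ n < δ / 4 := by
    have := (tendsto_integral_supNorm_pow (d := d)).const_mul (∫ ω', density φ φ ω' ∂P)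
    rw [mul_zero] at this
    exact (this.eventually (gt_mem_nhds (by positivity : (0 : ℝ) < δ / 4))).exists
  have hev1 := (herg.tendsto_latQ (continuous_supNorm.pow n) (fun k => (hε k).1) h0).eventually
    (gt_mem_nhds hn)
  have hev2 : ∀ᶠ k in atTop, 1 / 2 < (1 - ε k * M) ^ n := by
    have : Tendsto (fun k => (1 - ε k * M) ^ n) atTop (𝓝 ((1 - 0 * M) ^ n)) :=
      ((tendsto_const_nhds.sub (h0.mul_const _))).pow n
    simp only [zero_mul, sub_zero, one_pow] at this
    exact this.eventually (lt_mem_nhds (by norm_num))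
  have hev3 : ∀ᶠ k in atTop, 0 < 1 - ε k * M := by
    have : Tendsto (fun k => (1 - ε k * M)) atTop (𝓝 ((1 - 0 * M))) :=
      (tendsto_const_nhds.sub (h0.mul_const _))
    simp only [zero_mul, sub_zero] at this
    exact this.eventually (lt_mem_nhds (by norm_num))
  filter_upwards [hev1, hev2, hev3] with k h1 h2 h3
  have hεk := (hε k).1
  have hεd : 0 < ε k ^ d := pow_pos hεk d
  rw [abs_of_nonneg (mul_nonneg hεd.le (Finset.sum_nonneg fun x _ => tsum_nonneg fun z => by
    split_ifs; exacts [le_rfl, hnn x z]))]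
  -- long edges are bounded by the tail of the weight; short edges leaving `Q` start where
  -- `supNorm ^ n ≥ 1 / 2`
  have hpt : ∀ x ∈ latQ d (ε k), ∑' z, (if x + z ∈ latQ d (ε k) then 0 else
      rcond ω x z * φ (shift x ω) z ^ 2) ≤
      ∑' z, (if z ∈ Z then 0 else weight ω φ x z) +
        2 * (supNorm (scaled (ε k) x) ^ n * density φ φ (shift x ω)) := by
    intro x _
    have hs1 : Summable fun z => if z ∈ Z then 0 else weight ω φ x z :=
      (ht.summable x).of_nonneg_of_le (fun z => by split_ifs; exacts [le_rfl, ht.nonneg x z])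
        fun z => by split_ifs; exacts [ht.nonneg x z, le_rfl]
    rw [hden, ← tsum_mul_left, ← tsum_mul_left,
      ← hs1.tsum_add (((ht.summable_sq x).mul_left _).mul_left _)]
    refine Summable.tsum_le_tsum (fun z => ?_) ?_
      (hs1.add (((ht.summable_sq x).mul_left _).mul_left _))
    · have hp : 0 ≤ supNorm (scaled (ε k) x) ^ n := pow_nonneg (supNorm_nonneg _) _
      have hq := hnn x z
      have hw := ht.nonneg x z
      by_cases hxz : x + z ∈ latQ d (ε k)
      · rw [if_pos hxz]
        split_ifs <;> positivity
      · rw [if_neg hxz]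
        by_cases hz : z ∈ Z
        · rw [if_pos hz, zero_add, ← mul_assoc]
          refine le_mul_of_one_le_left hq ?_
          have h4 := pow_le_pow_left₀ h3.le (one_sub_le_supNorm hεk (hM hz) hxz) n
          linarith
        · rw [if_neg hz]
          have := mul_sq_le_weight ω φ x z
          have : 0 ≤ 2 * (supNorm (scaled (ε k) x) ^ n * (rcond ω x z * φ (shift x ω) z ^ 2)) := by
            positivity
          linarith
    · exact (ht.summable_sq x).of_nonneg_of_le (fun z => by split_ifs; exacts [le_rfl, hnn x z])
        fun z => by split_ifs; exacts [hnn x z, le_rfl]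
  calc ε k ^ d * ∑ x ∈ latQ d (ε k), ∑' z, (if x + z ∈ latQ d (ε k) then 0 else
      rcond ω x z * φ (shift x ω) z ^ 2)
      ≤ ε k ^ d * ∑ x ∈ latQ d (ε k), (∑' z, (if z ∈ Z then 0 else weight ω φ x z) +
        2 * (supNorm (scaled (ε k) x) ^ n * density φ φ (shift x ω))) :=
        mul_le_mul_of_nonneg_left (Finset.sum_le_sum hpt) hεd.le
    _ = ε k ^ d * ∑ x ∈ latQ d (ε k), ∑' z, (if z ∈ Z then 0 else weight ω φ x z) +
        2 * (ε k ^ d * ∑ x ∈ latQ d (ε k),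
          supNorm (scaled (ε k) x) ^ n * density φ φ (shift x ω)) := by
        rw [Finset.sum_add_distrib, ← Finset.mul_sum]; ring
    _ < δ / 2 + 2 * (δ / 4) := add_lt_add_of_le_of_lt (hZ _ hεk (hε k).2)
        (mul_lt_mul_of_pos_left h1 two_pos)
    _ = δ := by ring

theorem tendsto_pairing_sub_pairingQ {ω : Env d} {φ : Field d} (ht : Tame (weight ω φ))
    (hflip : ∀ x z, φ (shift (x + z) ω) (-z) ^ 2 = φ (shift x ω) z ^ 2)
    (herg : ErgodicLimit P (density φ φ) ω) {ε : ℕ → ℝ} (h0 : Tendsto ε atTop (𝓝 0))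
    {U : ℕ → Lat d → ℝ} {C : ℝ≥0} (hU : ∀ k, Admissible ω (ε k) (U k) C)
    {v : Sp d → ℝ} {K : ℝ} (hv : ∀ x, |v x| ≤ K) :
    Tendsto (fun k => pairing ω (ε k) (U k) v φ - pairingQ ω (ε k) (U k) v φ) atTop (𝓝 0) := by
  have hK : 0 ≤ K := (abs_nonneg _).trans (hv 0)
  have hB := tendsto_boundary_zero ht herg (fun k => ⟨(hU k).pos, (hU k).le_one⟩) h0
  refine (nhds_basis_zero_abs_lt ℝ).tendsto_right_iff.2 fun δ hδ => ?_
  -- the weight `s` makes the energy term at most `δ / 2`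
  set s : ℝ := δ / (2 * (K + 1) * (C + 1)) with hs
  have hs0 : 0 < s := by positivity
  have hlim := (hB.const_mul (K * s⁻¹))
  rw [mul_zero] at hlim
  filter_upwards [hlim.eventually (gt_mem_nhds (half_pos hδ))] with k hk
  refine ((hU k).abs_pairing_sub_le ht.summable_sq hflip hv hs0).trans_lt ?_
  have h1 : K * (s * C) ≤ δ / 2 := by
    rw [hs]
    have : K * (δ / (2 * (K + 1) * (C + 1)) * C) = δ / 2 * ((K / (K + 1)) * (C / (C + 1))) := by
      field_simp
    rw [this]
    refine mul_le_of_le_one_right (by positivity) ?_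
    refine mul_le_one₀ ?_ (by positivity) ?_
    · rw [div_le_one (by positivity)]; linarith
    · rw [div_le_one (by positivity)]; linarith
  rw [mul_add, ← mul_assoc K s⁻¹]
  linarith

/-! ### The asymptotic Cauchy-Schwarz inequality -/

theorem summable_mul_discDeriv {ω : Env d} {ε : ℝ} {U : Lat d → ℝ} {C : ℝ≥0}
    (h : Admissible ω ε U C) (x : Lat d) : Summable fun z => rcond ω x z * discDeriv ε U x z ^ 2 :=
  (summable_energy h.cond_lt_top h.pos h.energy).1.prod_factor x

/-- Linear combinations of the localized pairings are controlled by the energy and by the weighted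
square sum of the test functions. -/
theorem abs_sum_pairingQ_le {ω : Env d} {ε : ℝ} {U : Lat d → ℝ} {C : ℝ≥0}
    (h : Admissible ω ε U C) {ι : Type*} (S : Finset ι) (c : ι → ℝ) (v : ι → Sp d → ℝ)
    (φ : ι → Field d) (ht : ∀ j ∈ S, Tame (weight ω (φ j))) {s : ℝ} (hs : 0 < s) :
    |∑ j ∈ S, c j * pairingQ ω ε U (v j) (φ j)| ≤ (s * C + s⁻¹ * ∑ j ∈ S, ∑ k ∈ S, c j * c k *
      (ε ^ d * ∑ x ∈ latQ d ε, v j (scaled ε x) * v k (scaled ε x) *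
        density (φ j) (φ k) (shift x ω))) / 2 := by
  have hεd : 0 < ε ^ d := pow_pos h.pos d
  -- by linearity only one combined test function `g` has to be considered
  let g : Lat d → Lat d → ℝ := fun x z =>
    ∑ j ∈ S, c j * v j (scaled ε x) * φ j (shift x ω) z
  have hgsq : ∀ x z, rcond ω x z * g x z ^ 2 = ∑ j ∈ S, ∑ k ∈ S, c j * v j (scaled ε x) *
      (c k * v k (scaled ε x)) * (rcond ω x z * (φ j (shift x ω) z * φ k (shift x ω) z)) := by
    intro x z
    simp only [g]
    rw [pow_two, Finset.sum_mul_sum, Finset.mul_sum]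
    refine Finset.sum_congr rfl fun j _ => ?_
    rw [Finset.mul_sum]
    exact Finset.sum_congr rfl fun k _ => by ring
  have hgs : ∀ x, Summable fun z => rcond ω x z * g x z ^ 2 := by
    intro x
    simp_rw [hgsq]
    exact summable_sum fun j hj => summable_sum fun k hk =>
      (summable_mul_of_sq ((ht j hj).summable_sq x) ((ht k hk).summable_sq x)).mul_left _
  have hgt : ∀ x, ∑' z, rcond ω x z * g x z ^ 2 = ∑ j ∈ S, ∑ k ∈ S, c j * c k *
      (v j (scaled ε x) * v k (scaled ε x) * density (φ j) (φ k) (shift x ω)) := by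
    intro x
    simp_rw [hgsq]
    rw [Summable.tsum_finsetSum fun j hj => summable_sum fun k hk =>
      (summable_mul_of_sq ((ht j hj).summable_sq x) ((ht k hk).summable_sq x)).mul_left _]
    refine Finset.sum_congr rfl fun j hj => ?_
    rw [Summable.tsum_finsetSum fun k hk =>
      (summable_mul_of_sq ((ht j hj).summable_sq x) ((ht k hk).summable_sq x)).mul_left _]
    refine Finset.sum_congr rfl fun k hk => ?_
    rw [tsum_mul_left, density_shift]
    ring
  have hlin : ∑ j ∈ S, c j * pairingQ ω ε U (v j) (φ j) =
      ε ^ d * ∑ x ∈ latQ d ε, ∑' z, rcond ω x z * (discDeriv ε U x z * g x z) := by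
    have e : ∀ x, ∑' z, rcond ω x z * (discDeriv ε U x z * g x z) =
        ∑ j ∈ S, c j * (v j (scaled ε x) *
          ∑' z, rcond ω x z * (discDeriv ε U x z * φ j (shift x ω) z)) := by
      intro x
      have : ∀ z, rcond ω x z * (discDeriv ε U x z * g x z) = ∑ j ∈ S,
          c j * v j (scaled ε x) * (rcond ω x z * (discDeriv ε U x z * φ j (shift x ω) z)) := by
        intro z
        simp only [g]
        rw [Finset.mul_sum, Finset.mul_sum]
        exact Finset.sum_congr rfl fun j _ => by ring
      simp_rw [this]
      rw [Summable.tsum_finsetSum fun j hj =>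
        (summable_mul_of_sq (summable_mul_discDeriv h x) ((ht j hj).summable_sq x)).mul_left _]
      exact Finset.sum_congr rfl fun j _ => by rw [tsum_mul_left]; ring
    simp_rw [e]
    rw [Finset.sum_comm, Finset.mul_sum]
    refine Finset.sum_congr rfl fun j _ => ?_
    rw [pairingQ, ← Finset.mul_sum]
    ring
  obtain ⟨hE, hEC⟩ := summable_energy h.cond_lt_top h.pos h.energy
  have hEQ : ε ^ d * ∑ x ∈ latQ d ε, ∑' z, rcond ω x z * discDeriv ε U x z ^ 2 ≤ C := by
    refine le_trans ?_ hEC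
    gcongr
    rw [hE.tsum_prod]
    exact hE.prod.sum_le_tsum _ fun x _ => tsum_nonneg fun z =>
      mul_nonneg (rcond_nonneg _ _ _) (sq_nonneg _)
  -- the inequality between the arithmetic and the geometric mean, at each base point
  have hx : ∀ x, |∑' z, rcond ω x z * (discDeriv ε U x z * g x z)| ≤
      (s * ∑' z, rcond ω x z * discDeriv ε U x z ^ 2 +
        s⁻¹ * ∑' z, rcond ω x z * g x z ^ 2) / 2 := by
    intro x
    have h1 := (summable_mul_discDeriv h x).mul_left s
    have h2 := (hgs x).mul_left s⁻¹
    rw [← tsum_mul_left, ← tsum_mul_left, ← h1.tsum_add h2, ← tsum_div_const]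
    have hb : ∀ z, ‖rcond ω x z * (discDeriv ε U x z * g x z)‖ ≤
        (s * (rcond ω x z * discDeriv ε U x z ^ 2) + s⁻¹ * (rcond ω x z * g x z ^ 2)) / 2 :=
      fun z => abs_mul_le_half (rcond_nonneg ω x z) hs
    exact tsum_of_norm_bounded ((h1.add h2).div_const 2).hasSum hb
  rw [hlin, abs_mul, abs_of_pos hεd]
  calc ε ^ d * |∑ x ∈ latQ d ε, ∑' z, rcond ω x z * (discDeriv ε U x z * g x z)|
      ≤ ε ^ d * ∑ x ∈ latQ d ε, (s * ∑' z, rcond ω x z * discDeriv ε U x z ^ 2 +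
        s⁻¹ * ∑' z, rcond ω x z * g x z ^ 2) / 2 := by
        gcongr
        exact (Finset.abs_sum_le_sum_abs _ _).trans (Finset.sum_le_sum fun x _ => hx x)
    _ = (s * (ε ^ d * ∑ x ∈ latQ d ε, ∑' z, rcond ω x z * discDeriv ε U x z ^ 2) +
        s⁻¹ * (ε ^ d * ∑ x ∈ latQ d ε, ∑' z, rcond ω x z * g x z ^ 2)) / 2 := by
        rw [← Finset.sum_div, Finset.sum_add_distrib, ← Finset.mul_sum, ← Finset.mul_sum]
        ring
    _ ≤ (s * C + s⁻¹ * (ε ^ d * ∑ x ∈ latQ d ε, ∑' z, rcond ω x z * g x z ^ 2)) / 2 := by gcongr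
    _ = _ := by
        simp_rw [hgt]
        rw [Finset.sum_comm, Finset.mul_sum]
        congr 3
        refine Finset.sum_congr rfl fun j _ => ?_
        rw [Finset.sum_comm, Finset.mul_sum]
        refine Finset.sum_congr rfl fun k _ => ?_
        rw [← Finset.mul_sum]
        ring

/-! ### Nearest-neighbour differences of functions of bounded energy -/

/-- Each edge is counted by at most as many boxes as there are points in one of them. -/
theorem sum_localEnergy_le (ω : Env d) (U : Lat d → ℝ) (l N : ℕ) :
    ∑ x ∈ box d N, localEnergy l (shift x ω) (fun y => U (x + y)) ≤
      (box d l).card * ∑' x, ∑' z, cond ω x z * ENNReal.ofReal ((U (x + z) - U x) ^ 2) := by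
  simp only [localEnergy, cond_shift]
  rw [Finset.sum_comm, ← nsmul_eq_mul, ← Finset.sum_const]
  refine Finset.sum_le_sum fun b _ => ?_
  calc ∑ x ∈ box d N, ∑' z, cond ω (x + b) z *
        ENNReal.ofReal ((U (x + (b + z)) - U (x + b)) ^ 2)
      ≤ ∑' x, ∑' z, cond ω (x + b) z * ENNReal.ofReal ((U (x + (b + z)) - U (x + b)) ^ 2) :=
        ENNReal.sum_le_tsum _
    _ = ∑' x, ∑' z, cond ω x z * ENNReal.ofReal ((U (x + z) - U x) ^ 2) := by
        refine Eq.trans (tsum_congr fun x => tsum_congr fun z => ?_) ((Equiv.addRight b).tsum_eq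
          fun x => ∑' z, cond ω x z * ENNReal.ofReal ((U (x + z) - U x) ^ 2))
        simp [add_assoc]

theorem mem_box_succ_of_near {ε : ℝ} {x : Lat d} {i : Fin d}
    (h : x ∈ latQ d ε ∨ x + Pi.single i 1 ∈ latQ d ε) : x ∈ box d (⌈1 / ε⌉₊ + 1) := by
  have hone : ∀ y ∈ box d ⌈1 / ε⌉₊, ∀ e : Lat d, (∀ j, |e j| ≤ 1) → y + e ∈ box d (⌈1 / ε⌉₊ + 1) :=
    fun y hy e he => add_mem_box hy (mem_box.2 (by exact_mod_cast he))
  rcases h with h | h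
  · simpa using hone x (latQ_subset_box ε h) 0 (by simp)
  · have := hone _ (latQ_subset_box ε h) (-Pi.single i 1) (fun j => by
      by_cases hj : j = i <;> simp [hj])
    simpa using this

/-- The resistance bound with weight `ε`, summed over the lattice: the unscaled increments have
energy of order `ε²`, so that both terms are of order `ε`. -/
theorem tsum_abs_diff_le {ω : Env d} {ε : ℝ} {U : Lat d → ℝ} {C : ℝ≥0} (h : Admissible ω ε U C)
    {l : ℕ} {ν : Env d → ℝ≥0∞} (hν : IsResistance P l ν) {A : ℝ≥0}
    (hA : ∀ N, ∑ x ∈ box d N, ν (shift x ω) ≤ A * (box d N).card) (i : Fin d) :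
    ε ^ d * ∑' x, |U (x + Pi.single i 1) - U x| ≤
      ε * ((l + 1) * (A * 7 ^ d + (box d l).card * C)) := by
  have hε := h.pos
  have hεd : 0 < ε ^ d := pow_pos hε d
  set B := box d (⌈1 / ε⌉₊ + 1) with hB
  have hzero : ∀ x, x ∉ B → |U (x + Pi.single i 1) - U x| = 0 := by
    intro x hx
    have : ¬ (x ∈ latQ d ε ∨ x + Pi.single i 1 ∈ latQ d ε) := fun h' => hx (mem_box_succ_of_near h')
    rw [not_or] at this
    rw [h.supp.eq_zero hε this.1, h.supp.eq_zero hε this.2]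
    simp
  rw [tsum_eq_sum fun x hx => hzero x hx]
  have ht : ENNReal.ofReal ε ≠ 0 := (ENNReal.ofReal_pos.2 hε).ne'
  have hx : ∀ x, ENNReal.ofReal |U (x + Pi.single i 1) - U x| ≤ (l + 1) *
      (ENNReal.ofReal ε * ν (shift x ω) +
        (ENNReal.ofReal ε)⁻¹ * localEnergy l (shift x ω) (fun y => U (x + y))) := by
    intro x
    have := hν.ofReal_abs_le (shift x ω) _ (adj_single i) (fun y => U (x + y)) _ ht
      ENNReal.ofReal_ne_top
    simpa using this
  -- the energy of the increments `U (x + z) - U x`, without the factor `ε⁻²`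
  have hen : ∑' x, ∑' z, cond ω x z * ENNReal.ofReal ((U (x + z) - U x) ^ 2) =
      ENNReal.ofReal (ε ^ 2) *
        ∑' x, ∑' z, cond ω x z * ENNReal.ofReal (discDeriv ε U x z ^ 2) := by
    rw [← ENNReal.tsum_mul_left]
    refine tsum_congr fun x => ?_
    rw [← ENNReal.tsum_mul_left]
    refine tsum_congr fun z => ?_
    rw [mul_left_comm, ← ENNReal.ofReal_mul (by positivity), discDeriv, div_pow,
      mul_div_cancel₀ _ (by positivity)]
  have hcard : ENNReal.ofReal (ε ^ d) * B.card ≤ 7 ^ d := by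
    rw [← ENNReal.ofReal_natCast, ← ENNReal.ofReal_mul hεd.le]
    refine (ENNReal.ofReal_le_ofReal (pow_mul_card_box_le hε h.le_one 1)).trans (le_of_eq ?_)
    norm_num
  have hsq : (ENNReal.ofReal ε)⁻¹ * ENNReal.ofReal (ε ^ 2) = ENNReal.ofReal ε := by
    rw [pow_two, ENNReal.ofReal_mul hε.le, ← mul_assoc,
      ENNReal.inv_mul_cancel ht ENNReal.ofReal_ne_top, one_mul]
  have key : ENNReal.ofReal (ε ^ d * ∑ x ∈ B, |U (x + Pi.single i 1) - U x|) ≤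
      ENNReal.ofReal ε * ((l + 1) * (A * 7 ^ d + (box d l).card * C)) := by
    rw [ENNReal.ofReal_mul hεd.le, ENNReal.ofReal_sum_of_nonneg fun _ _ => abs_nonneg _]
    calc ENNReal.ofReal (ε ^ d) * ∑ x ∈ B, ENNReal.ofReal |U (x + Pi.single i 1) - U x|
        ≤ ENNReal.ofReal (ε ^ d) * ∑ x ∈ B, (l + 1) * (ENNReal.ofReal ε * ν (shift x ω) +
          (ENNReal.ofReal ε)⁻¹ * localEnergy l (shift x ω) (fun y => U (x + y))) := by
          gcongr with x; exact hx x
      _ = ENNReal.ofReal (ε ^ d) * ((l + 1) * (ENNReal.ofReal ε * ∑ x ∈ B, ν (shift x ω) +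
          (ENNReal.ofReal ε)⁻¹ * ∑ x ∈ B, localEnergy l (shift x ω) (fun y => U (x + y)))) := by
          rw [← Finset.mul_sum, Finset.sum_add_distrib, ← Finset.mul_sum, ← Finset.mul_sum]
      _ ≤ ENNReal.ofReal (ε ^ d) * ((l + 1) * (ENNReal.ofReal ε * (A * B.card) +
          (ENNReal.ofReal ε)⁻¹ * ((box d l).card * (ENNReal.ofReal (ε ^ 2) *
            ∑' x, ∑' z, cond ω x z * ENNReal.ofReal (discDeriv ε U x z ^ 2))))) := by
          rw [← hen]
          gcongr
          · exact hA _
          · exact sum_localEnergy_le ω U l _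
      _ = (l + 1) * (ENNReal.ofReal ε * (A * (ENNReal.ofReal (ε ^ d) * B.card)) +
          ((ENNReal.ofReal ε)⁻¹ * ENNReal.ofReal (ε ^ 2)) * ((box d l).card *
            gradEnergy ω ε U)) := by
          rw [gradEnergy]; ring
      _ ≤ (l + 1) * (ENNReal.ofReal ε * (A * 7 ^ d) + ENNReal.ofReal ε * ((box d l).card * C)) := by
          rw [hsq]
          gcongr
          exact h.energy
      _ = _ := by ring
  have hr : ENNReal.ofReal ε * ((l + 1) * (A * 7 ^ d + (box d l).card * C)) =
      ENNReal.ofReal (ε * ((l + 1) * (A * 7 ^ d + (box d l).card * C))) := by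
    rw [ENNReal.ofReal_mul hε.le]
    congr 1
    rw [ENNReal.ofReal_mul (by positivity), ENNReal.ofReal_add (by positivity) (by positivity),
      ENNReal.ofReal_add (by positivity) (by positivity), ENNReal.ofReal_mul (by positivity),
      ENNReal.ofReal_mul (by positivity), ENNReal.ofReal_pow (by positivity)]
    simp
  rw [hr] at key
  exact (ENNReal.ofReal_le_ofReal_iff (by positivity)).1 key

theorem tendsto_tsum_abs_diff {ω : Env d} {ε : ℕ → ℝ} (h0 : Tendsto ε atTop (𝓝 0))
    {U : ℕ → Lat d → ℝ} {C : ℝ≥0} (hU : ∀ k, Admissible ω (ε k) (U k) C)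
    {l : ℕ} {ν : Env d → ℝ≥0∞} (hν : IsResistance P l ν)
    (hA : ∃ A : ℝ≥0, ∀ N, ∑ x ∈ box d N, ν (shift x ω) ≤ A * (box d N).card) (i : Fin d) :
    Tendsto (fun k => ε k ^ d * ∑' x, |U k (x + Pi.single i 1) - U k x|) atTop (𝓝 0) := by
  obtain ⟨A, hA⟩ := hA
  refine squeeze_zero (fun k => mul_nonneg (pow_nonneg (hU k).pos.le d)
    (tsum_nonneg fun x => abs_nonneg _)) (fun k => tsum_abs_diff_le (hU k) hν hA i) ?_
  simpa using h0.mul_const ((l + 1) * (A * 7 ^ d + (box d l).card * C) : ℝ)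

/-! ### The piecewise constant interpolation -/

theorem measurableSet_cell (ε : ℝ) (z : Lat d) : MeasurableSet (cell ε z) := by
  have : cell ε z = ⋂ i, (fun x : Sp d => x i - ε * (z i : ℝ)) ⁻¹' Set.Ioc (-(ε / 2)) (ε / 2) := by
    ext x; simp [cell]
  rw [this]
  exact MeasurableSet.iInter fun i =>
    ((continuous_coord i).measurable.sub_const _) measurableSet_Ioc

theorem volume_cell {ε : ℝ} (hε : 0 < ε) (z : Lat d) :
    volume (cell ε z) = ENNReal.ofReal (ε ^ d) := by
  have h1 : cell ε z = (WithLp.ofLp : Sp d → Fin d → ℝ) ⁻¹' (Set.univ.pi fun i =>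
      Set.Ioc (ε * (z i : ℝ) - ε / 2) (ε * (z i : ℝ) + ε / 2)) := by
    ext x
    simp only [cell, Set.mem_ofPred_eq, Set.mem_preimage, Set.mem_univ_pi, Set.mem_Ioc]
    refine forall_congr' fun i => ?_
    constructor <;> rintro ⟨h1, h2⟩ <;> constructor <;> linarith
  rw [h1, (PiLp.volume_preserving_ofLp (Fin d)).measure_preimage
    (MeasurableSet.univ_pi fun i => measurableSet_Ioc).nullMeasurableSet, Real.volume_pi_Ioc]
  have : ∀ i, ε * (z i : ℝ) + ε / 2 - (ε * (z i : ℝ) - ε / 2) = ε := fun i => by ring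
  simp [this, ENNReal.ofReal_pow hε.le]

theorem norm_sub_scaled_le {ε : ℝ} (hε : 0 < ε) {z : Lat d} {x : Sp d} (hx : x ∈ cell ε z) :
    ‖x - scaled ε z‖ ≤ √d * ε := by
  refine norm_le_of_abs_le hε.le fun i => ?_
  have := hx i
  rw [PiLp.sub_apply, scaled_apply, abs_le]
  constructor <;> linarith [this.1, this.2]

theorem eq_of_mem_cell {ε : ℝ} (hε : 0 < ε) {z z' : Lat d} {x : Sp d} (hz : x ∈ cell ε z)
    (hz' : x ∈ cell ε z') : z = z' := by
  funext i
  have h1 := hz i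
  have h2 := hz' i
  simp only [Set.mem_Ioc] at h1 h2
  have h3 : ε * ((z i : ℝ) - z' i) < ε * 1 := by linarith
  have h4 : ε * ((z' i : ℝ) - z i) < ε * 1 := by linarith
  have h5 := lt_of_mul_lt_mul_left h3 hε.le
  have h6 := lt_of_mul_lt_mul_left h4 hε.le
  have h7 : z i - z' i < 1 := by exact_mod_cast h5
  have h8 : z' i - z i < 1 := by exact_mod_cast h6
  omega

theorem interp_eq_sum {ε : ℝ} (hε : 0 < ε) {U : Lat d → ℝ} (hU : SuppInCube ε U) (x : Sp d) :
    interp ε U x = ∑ z ∈ latQ d ε, U z * (cell ε z).indicator (fun _ => 1) x :=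
  tsum_eq_sum fun z hz => by rw [hU.eq_zero hε hz, zero_mul]

theorem measurable_interp {ε : ℝ} (hε : 0 < ε) {U : Lat d → ℝ} (hU : SuppInCube ε U) :
    Measurable (interp ε U) := by
  have : interp ε U = fun x => ∑ z ∈ latQ d ε, U z * (cell ε z).indicator (fun _ => 1) x :=
    funext (interp_eq_sum hε hU)
  rw [this]
  exact Finset.measurable_sum _ fun z _ =>
    (measurable_const.indicator (measurableSet_cell ε z)).const_mul _

theorem interp_of_mem_cell {ε : ℝ} (hε : 0 < ε) {U : Lat d → ℝ} {x : Sp d} {z : Lat d}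
    (hz : x ∈ cell ε z) : interp ε U x = U z := by
  rw [interp, tsum_eq_single z]
  · simp [hz]
  · intro z' hz'
    have : x ∉ cell ε z' := fun h => hz' (eq_of_mem_cell hε h hz)
    simp [this]

theorem integral_interp_mul {ε : ℝ} (hε : 0 < ε) {U : Lat d → ℝ} (hU : SuppInCube ε U)
    {g : Sp d → ℝ} (hg : ∀ z, IntegrableOn g (cell ε z)) :
    ∫ x, interp ε U x * g x = ∑ z ∈ latQ d ε, U z * ∫ x in cell ε z, g x := by
  have e : ∀ x, interp ε U x * g x =
      ∑ z ∈ latQ d ε, U z * (cell ε z).indicator g x := fun x => by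
    rw [interp_eq_sum hε hU, Finset.sum_mul]
    refine Finset.sum_congr rfl fun z _ => ?_
    by_cases hx : x ∈ cell ε z <;> simp [hx]
  simp_rw [e]
  rw [integral_finsetSum _ fun z _ =>
    ((integrable_indicator_iff (measurableSet_cell ε z)).2 (hg z)).const_mul _]
  refine Finset.sum_congr rfl fun z _ => ?_
  rw [integral_const_mul, integral_indicator (measurableSet_cell ε z)]

/-- Replacing the test function by its values at the centres of the cells. -/
theorem abs_integral_interp_sub_le {ε : ℝ} (hε : 0 < ε) (hε1 : ε ≤ 1) {U : Lat d → ℝ}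
    (hU : SuppInCube ε U) {K : ℝ} (hK : ∀ x, |U x| ≤ K) {v : Sp d → ℝ} {L : ℝ≥0}
    (hv : LipschitzWith L v) :
    |(∫ x, interp ε U x * v x) - ε ^ d * ∑ x ∈ latQ d ε, U x * v (scaled ε x)| ≤
      5 ^ d * K * (L * (√d * ε)) := by
  have hK0 : 0 ≤ K := (abs_nonneg _).trans (hK 0)
  have hεd : 0 < ε ^ d := pow_pos hε d
  have hfin : ∀ z : Lat d, volume (cell ε z) < ∞ := fun z => by rw [volume_cell hε]; simp
  have hreal : ∀ z : Lat d, volume.real (cell ε z) = ε ^ d := fun z => by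
    rw [Measure.real, volume_cell hε, ENNReal.toReal_ofReal hεd.le]
  have hbd : ∀ z, ∀ x ∈ cell ε z, ‖v x - v (scaled ε z)‖ ≤ L * (√d * ε) := fun z x hx => by
    refine (hv.norm_sub_le _ _).trans ?_
    gcongr
    exact norm_sub_scaled_le hε hx
  have hint' : ∀ z, IntegrableOn (fun x => v x - v (scaled ε z)) (cell ε z) := fun z => by
    refine Measure.integrableOn_of_bounded (M := L * (√d * ε)) (hfin z).ne
      (hv.continuous.sub continuous_const).aestronglyMeasurable ?_
    filter_upwards [ae_restrict_mem (measurableSet_cell ε z)] with x hx using hbd z x hx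
  have hconst : ∀ z, IntegrableOn (fun _ : Sp d => v (scaled ε z)) (cell ε z) := fun z =>
    integrableOn_const (hfin z).ne
  have hint : ∀ z, IntegrableOn v (cell ε z) := fun z => by
    refine ((hint' z).add (hconst z)).congr (Eventually.of_forall fun x => ?_)
    simp
  rw [integral_interp_mul hε hU hint, Finset.mul_sum, ← Finset.sum_sub_distrib]
  have e : ∀ z, U z * (∫ x in cell ε z, v x) - ε ^ d * (U z * v (scaled ε z)) =
      U z * ∫ x in cell ε z, (v x - v (scaled ε z)) := fun z => by
    rw [integral_sub (hint z) (hconst z), setIntegral_const, hreal, smul_eq_mul]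
    ring
  calc |∑ z ∈ latQ d ε, (U z * (∫ x in cell ε z, v x) - ε ^ d * (U z * v (scaled ε z)))|
      ≤ ∑ z ∈ latQ d ε, K * (L * (√d * ε) * ε ^ d) := by
        refine (Finset.abs_sum_le_sum_abs _ _).trans (Finset.sum_le_sum fun z _ => ?_)
        rw [e, abs_mul]
        refine mul_le_mul (hK z) ?_ (abs_nonneg _) hK0
        rw [← hreal z]
        exact norm_setIntegral_le_of_norm_le_const (hfin z) (hbd z)
    _ = (ε ^ d * (latQ d ε).card) * K * (L * (√d * ε)) := by
        rw [Finset.sum_const, nsmul_eq_mul]; ring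
    _ ≤ _ := by
        gcongr
        exact pow_mul_card_latQ_le hε hε1

/-! ### Smooth test functions -/

/-- Smooth functions on `ℝ^d` with compact support. -/
def IsTest (v : Sp d → ℝ) : Prop := ContDiff ℝ (⊤ : ℕ∞) v ∧ HasCompactSupport v

/-- The partial derivative in the direction of the `i`-th coordinate. -/
def pderiv (i : Fin d) (v : Sp d → ℝ) (x : Sp d) : ℝ :=
  fderiv ℝ v x (EuclideanSpace.single i 1)

theorem IsTest.exists_lipschitz {v : Sp d → ℝ} (hv : IsTest v) : ∃ L : ℝ≥0, LipschitzWith L v :=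
  hv.1.lipschitzWith_of_hasCompactSupport hv.2 (by simp)

theorem IsTest.exists_bound {v : Sp d → ℝ} (hv : IsTest v) : ∃ K : ℝ, ∀ x, |v x| ≤ K :=
  hv.2.exists_bound_of_continuous hv.1.continuous

theorem IsTest.contDiff_fderiv {v : Sp d → ℝ} (hv : IsTest v) :
    ContDiff ℝ (⊤ : ℕ∞) (fderiv ℝ v) :=
  hv.1.fderiv_right (by simp)

theorem IsTest.pderiv {v : Sp d → ℝ} (hv : IsTest v) (i : Fin d) : IsTest (pderiv i v) :=
  ⟨hv.contDiff_fderiv.clm_apply contDiff_const,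
    (hv.2.fderiv ℝ).comp_left (g := fun T : Sp d →L[ℝ] ℝ => T (EuclideanSpace.single i 1)) rfl⟩

theorem scaled_add (ε : ℝ) (x z : Lat d) : scaled ε (x + z) = scaled ε x + scaled ε z := by
  ext i
  simp [scaled_apply, mul_add]

theorem norm_scaled {ε : ℝ} (hε : 0 ≤ ε) (z : Lat d) : ‖scaled ε z‖ = ε * √(sqLen z) := by
  rw [EuclideanSpace.norm_eq, ← Real.sqrt_sq hε, ← Real.sqrt_mul (sq_nonneg _)]
  congr 1
  rw [sqLen, Finset.mul_sum]
  refine Finset.sum_congr rfl fun i _ => ?_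
  rw [scaled_apply, Real.norm_eq_abs, sq_abs, mul_pow, Real.sq_sqrt (sq_nonneg _)]

theorem fderiv_scaled (v : Sp d → ℝ) (y : Sp d) (ε : ℝ) (z : Lat d) :
    fderiv ℝ v y (scaled ε z) = ε * ∑ i, pderiv i v y * (z i : ℝ) := by
  have : scaled ε z = ∑ i, (ε * (z i : ℝ)) • EuclideanSpace.single i (1 : ℝ) := by
    ext j
    simp [scaled_apply, Finset.sum_apply, Pi.single_apply]
  rw [this, map_sum, Finset.mul_sum]
  refine Finset.sum_congr rfl fun i _ => ?_
  rw [map_smul, smul_eq_mul, pderiv]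
  ring

/-- The discrete derivative of a test function is close to its derivative: to second order for
short jumps, and to first order for all jumps. -/
theorem IsTest.exists_taylor {v : Sp d → ℝ} (hv : IsTest v) : ∃ L : ℝ, 0 ≤ L ∧
    ∀ ε : ℝ, 0 < ε → ∀ x z : Lat d,
      |discDeriv ε (fun y => v (scaled ε y)) x z - ∑ i, RCM.pderiv i v (scaled ε x) * (z i : ℝ)| ≤
        L * √(sqLen z) ∧
      |discDeriv ε (fun y => v (scaled ε y)) x z - ∑ i, RCM.pderiv i v (scaled ε x) * (z i : ℝ)| ≤
        L * ε * sqLen z := by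
  obtain ⟨L1, hL1⟩ := hv.exists_lipschitz
  obtain ⟨L2, hL2⟩ := hv.contDiff_fderiv.lipschitzWith_of_hasCompactSupport (hv.2.fderiv ℝ)
    (by simp)
  have hdiff : Differentiable ℝ v := hv.1.differentiable (by simp)
  refine ⟨2 * L1 + L2, by positivity, fun ε hε x z => ?_⟩
  have e : discDeriv ε (fun y => v (scaled ε y)) x z -
      ∑ i, RCM.pderiv i v (scaled ε x) * (z i : ℝ) =
      (v (scaled ε x + scaled ε z) - v (scaled ε x) -
        fderiv ℝ v (scaled ε x) (scaled ε z)) / ε := by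
    rw [discDeriv, fderiv_scaled, scaled_add]
    field_simp
  have hn := norm_scaled hε.le z
  have hs := Real.sqrt_nonneg (sqLen z)
  rw [e, abs_div, abs_of_pos hε, div_le_iff₀ hε, div_le_iff₀ hε]
  constructor
  · have h1 : |v (scaled ε x + scaled ε z) - v (scaled ε x)| ≤ L1 * ‖scaled ε z‖ := by
      simpa using hL1.norm_sub_le (scaled ε x + scaled ε z) (scaled ε x)
    have h2 : |fderiv ℝ v (scaled ε x) (scaled ε z)| ≤ L1 * ‖scaled ε z‖ :=
      (ContinuousLinearMap.le_opNorm _ _).trans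
        (mul_le_mul_of_nonneg_right (norm_fderiv_le_of_lipschitz ℝ hL1) (norm_nonneg _))
    refine (abs_sub _ _).trans ((add_le_add h1 h2).trans ?_)
    rw [hn]
    have : 0 ≤ (L2 : ℝ) * (ε * √(sqLen z)) := by positivity
    linarith
  · have h1 := (convex_closedBall (scaled ε x) ‖scaled ε z‖).norm_image_sub_le_of_norm_fderiv_le'
      (f := v) (φ := fderiv ℝ v (scaled ε x)) (C := L2 * ‖scaled ε z‖)
      (x := scaled ε x) (y := scaled ε x + scaled ε z)
      (fun y _ => hdiff y) (fun y hy => by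
        refine (hL2.norm_sub_le _ _).trans ?_
        gcongr
        exact mem_closedBall_iff_norm.1 hy) (by simp) (by simp)
    rw [add_sub_cancel_left, Real.norm_eq_abs] at h1
    refine h1.trans ?_
    rw [hn]
    have h3 : (L2 : ℝ) * (ε * √(sqLen z)) * (ε * √(sqLen z)) = L2 * ε * sqLen z * ε := by
      have := Real.mul_self_sqrt (sqLen_nonneg z)
      linear_combination (L2 : ℝ) * ε * ε * this
    have : 0 ≤ 2 * (L1 : ℝ) * ε * sqLen z * ε := by
      have := sqLen_nonneg z
      positivity
    rw [h3]
    linarith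

/-! ### Weighted ergodic averages against functions of bounded energy -/

/-- Summation by parts moves the differences from the coboundary to `U` and `v`. -/
theorem abs_sum_mul_cobdry_le {ω : Env d} {ε : ℝ} (hε : 0 < ε) (hε1 : ε ≤ 1) {U : Lat d → ℝ}
    (hU : SuppInCube ε U) {K : ℝ} (hK : ∀ x, |U x| ≤ K) {v : Sp d → ℝ} {L : ℝ≥0}
    (hv : LipschitzWith L v) {Kv : ℝ} (hvb : ∀ x, |v x| ≤ Kv) {g : Fin d → Env d → ℝ} {Kg : ℝ}
    (hg : ∀ i ω, |g i ω| ≤ Kg) :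
    |ε ^ d * ∑ x ∈ latQ d ε, U x * v (scaled ε x) * cobdry g (shift x ω)| ≤
      ∑ i, Kg * (Kv * (ε ^ d * ∑' x, |U (x + Pi.single i 1) - U x|) + K * (L * ε) * 5 ^ d) := by
  have hK0 : 0 ≤ K := (abs_nonneg _).trans (hK 0)
  have hKv0 : 0 ≤ Kv := (abs_nonneg _).trans (hvb 0)
  have hεd : 0 < ε ^ d := pow_pos hε d
  obtain ⟨m, hm⟩ : ∃ m : Lat d → ℝ, m = fun x => U x * v (scaled ε x) := ⟨_, rfl⟩
  have hm0 : ∀ x, x ∉ latQ d ε → m x = 0 := fun x hx => by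
    rw [hm]; simp [hU.eq_zero hε hx]
  have hfin : ∀ F : Lat d → ℝ, (∀ x, x ∉ latQ d ε → F x = 0) → Summable F := fun F hF =>
    summable_of_ne_finset_zero hF
  have e : ∑ x ∈ latQ d ε, U x * v (scaled ε x) * cobdry g (shift x ω) =
      ∑ i, ∑' x, (m x - m (x + Pi.single i 1)) * g i (shift (x + Pi.single i 1) ω) := by
    simp only [cobdry, Finset.mul_sum]
    rw [Finset.sum_comm]
    refine Finset.sum_congr rfl fun i _ => ?_
    have h1 : Summable fun x => m x * g i (shift (x + Pi.single i 1) ω) :=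
      hfin _ fun x hx => by rw [hm0 x hx, zero_mul]
    have h2 : Summable fun x => m x * g i (shift x ω) :=
      hfin _ fun x hx => by rw [hm0 x hx, zero_mul]
    have h3 : Summable fun x : Lat d => m (x + Pi.single i 1) * g i (shift (x + Pi.single i 1) ω) :=
      (Equiv.addRight (Pi.single i 1 : Lat d)).summable_iff.2 h2
    have h4 : ∑' x : Lat d, m (x + Pi.single i 1) * g i (shift (x + Pi.single i 1) ω) =
        ∑' x, m x * g i (shift x ω) :=
      (Equiv.addRight (Pi.single i 1 : Lat d)).tsum_eq fun x => m x * g i (shift x ω)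
    simp only [sub_mul]
    rw [h1.tsum_sub h3, h4, ← h1.tsum_sub h2, tsum_eq_sum (s := latQ d ε)]
    · refine Finset.sum_congr rfl fun x _ => ?_
      rw [shift_shift, hm]
      ring
    · intro x hx
      rw [hm0 x hx]; ring
  have hD : ∀ i : Fin d, Summable fun x => |U (x + Pi.single i 1) - U x| := fun i => by
    refine summable_of_ne_finset_zero (s := box d (⌈1 / ε⌉₊ + 1)) fun x hx => ?_
    have : ¬ (x ∈ latQ d ε ∨ x + Pi.single i 1 ∈ latQ d ε) := fun h' => hx (mem_box_succ_of_near h')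
    rw [not_or] at this
    rw [hU.eq_zero hε this.1, hU.eq_zero hε this.2]
    simp
  have hUs : Summable fun x => |U x| := hfin _ fun x hx => by simp [hU.eq_zero hε hx]
  have hUt : ε ^ d * ∑' x, |U x| ≤ K * 5 ^ d := by
    rw [tsum_eq_sum (s := latQ d ε) fun x hx => by simp [hU.eq_zero hε hx]]
    calc ε ^ d * ∑ x ∈ latQ d ε, |U x| ≤ ε ^ d * ∑ x ∈ latQ d ε, K := by
          gcongr with x; exact hK x
      _ = K * (ε ^ d * (latQ d ε).card) := by rw [Finset.sum_const, nsmul_eq_mul]; ring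
      _ ≤ K * 5 ^ d := by gcongr; exact pow_mul_card_latQ_le hε hε1
  rw [e, Finset.mul_sum]
  refine (Finset.abs_sum_le_sum_abs _ _).trans (Finset.sum_le_sum fun i _ => ?_)
  have hKg0 : 0 ≤ Kg := (abs_nonneg _).trans (hg i ω)
  have hpt : ∀ x, ‖(m x - m (x + Pi.single i 1)) * g i (shift (x + Pi.single i 1) ω)‖ ≤
      Kg * (Kv * |U (x + Pi.single i 1) - U x| + (L * ε) * |U x|) := by
    intro x
    have h1 : |v (scaled ε (x + Pi.single i 1)) - v (scaled ε x)| ≤ L * ε := by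
      have := hv.norm_sub_le (scaled ε (x + Pi.single i 1)) (scaled ε x)
      rw [scaled_add, add_sub_cancel_left, norm_scaled hε.le] at this
      rw [scaled_add]
      have h2 : sqLen (Pi.single i 1 : Lat d) = 1 := by
        rw [sqLen, Finset.sum_eq_single i]
        · simp
        · intro j _ hj; simp [hj]
        · simp
      rw [h2, Real.sqrt_one, mul_one] at this
      exact this
    -- the discrete product rule
    have h2 : m x - m (x + Pi.single i 1) =
        -((U (x + Pi.single i 1) - U x) * v (scaled ε (x + Pi.single i 1)) +
          U x * (v (scaled ε (x + Pi.single i 1)) - v (scaled ε x))) := by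
      rw [hm]; ring
    rw [norm_mul, mul_comm, h2, norm_neg]
    refine mul_le_mul (hg i _) ?_ (norm_nonneg _) hKg0
    refine (norm_add_le _ _).trans ?_
    rw [norm_mul, norm_mul, mul_comm Kv, mul_comm (L * ε : ℝ)]
    exact add_le_add (mul_le_mul_of_nonneg_left (hvb _) (norm_nonneg _))
      (mul_le_mul_of_nonneg_left h1 (norm_nonneg _))
  have hs := (((hD i).mul_left Kv).add (hUs.mul_left (L * ε))).mul_left Kg
  have := tsum_of_norm_bounded hs.hasSum hpt
  rw [Real.norm_eq_abs] at this
  rw [abs_mul, abs_of_pos hεd]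
  refine (mul_le_mul_of_nonneg_left this hεd.le).trans ?_
  rw [tsum_mul_left, ((hD i).mul_left Kv).tsum_add (hUs.mul_left (L * ε)), tsum_mul_left,
    tsum_mul_left]
  have h5 : Kg * (L * ε) * (ε ^ d * ∑' x, |U x|) ≤ Kg * (L * ε) * (K * 5 ^ d) := by gcongr
  linarith

/-- Averages of `f(τ_x ω)` weighted with lattice functions of vanishing oscillation: only the mean
of `f` survives, because the rest is approximated by coboundaries, which are summed by parts. -/
theorem tendsto_sum_mul_cobdryApprox {ω : Env d} {ε : ℕ → ℝ} (hε : ∀ k, 0 < ε k ∧ ε k ≤ 1)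
    (h0 : Tendsto ε atTop (𝓝 0)) {U : ℕ → Lat d → ℝ} (hU : ∀ k, SuppInCube (ε k) (U k))
    {K : ℝ} (hK : ∀ k x, |U k x| ≤ K)
    (hdiff : ∀ i, Tendsto (fun k => ε k ^ d * ∑' x, |U k (x + Pi.single i 1) - U k x|) atTop (𝓝 0))
    {f : Env d → ℝ} {c : ℝ} (hf : CobdryApprox f c ω) {v : Sp d → ℝ} (hv : IsTest v) {I : ℝ}
    (hI : Tendsto (fun k => ∫ x, interp (ε k) (U k) x * v x) atTop (𝓝 I)) :
    Tendsto (fun k => ε k ^ d * ∑ x ∈ latQ d (ε k), U k x * v (scaled (ε k) x) * f (shift x ω))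
      atTop (𝓝 (c * I)) := by
  obtain ⟨L, hL⟩ := hv.exists_lipschitz
  obtain ⟨Kv, hKv⟩ := hv.exists_bound
  have hK0 : 0 ≤ K := (abs_nonneg _).trans (hK 0 0)
  have hKv0 : 0 ≤ Kv := (abs_nonneg _).trans (hKv 0)
  have hmean : Tendsto (fun k => ε k ^ d * ∑ x ∈ latQ d (ε k), U k x * v (scaled (ε k) x)) atTop
      (𝓝 I) := by
    have h1 : Tendsto (fun k => (∫ x, interp (ε k) (U k) x * v x) -
        ε k ^ d * ∑ x ∈ latQ d (ε k), U k x * v (scaled (ε k) x)) atTop (𝓝 0) := by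
      refine squeeze_zero_norm (fun k =>
        abs_integral_interp_sub_le (hε k).1 (hε k).2 (hU k) (hK k) hL) ?_
      have := (h0.const_mul (√d)).const_mul (L : ℝ) |>.const_mul (5 ^ d * K)
      simpa using this
    have := hI.sub h1
    simpa using this
  rw [Metric.tendsto_atTop']
  intro δ hδ
  obtain ⟨g, hg, hgN⟩ := hf (δ / (2 * (K * Kv + 1) * 5 ^ d)) (by positivity)
  obtain ⟨Kg, hKg⟩ := hg.bounded
  have hlim : Tendsto (fun k => |c * (ε k ^ d * ∑ x ∈ latQ d (ε k), U k x * v (scaled (ε k) x)) -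
      c * I| + ∑ i, Kg * (Kv * (ε k ^ d * ∑' x, |U k (x + Pi.single i 1) - U k x|) +
        K * (L * ε k) * 5 ^ d)) atTop (𝓝 0) := by
    have h1 := ((hmean.const_mul c).sub_const (c * I)).abs
    have h2 : ∀ i : Fin d, Tendsto (fun k => Kg * (Kv * (ε k ^ d *
        ∑' x, |U k (x + Pi.single i 1) - U k x|) + K * (L * ε k) * 5 ^ d)) atTop
        (𝓝 (Kg * (Kv * 0 + K * (L * 0) * 5 ^ d))) := fun i =>
      (((hdiff i).const_mul Kv).add (((h0.const_mul _).const_mul K).mul_const _)).const_mul Kg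
    have h3 := h1.add (tendsto_finsetSum Finset.univ fun i _ => h2 i)
    simpa using h3
  obtain ⟨N, hN⟩ := eventually_atTop.1 (hlim.eventually (gt_mem_nhds (half_pos hδ)))
  refine ⟨N, fun k hk => ?_⟩
  have hlt := hN k hk.le
  obtain ⟨hk0, hk1⟩ := hε k
  have hεd : 0 < ε k ^ d := pow_pos hk0 d
  -- the mean of `f`, a coboundary, and an error that is small uniformly in `ε`
  have hsplit : ε k ^ d * ∑ x ∈ latQ d (ε k), U k x * v (scaled (ε k) x) * f (shift x ω) - c * I =
      (c * (ε k ^ d * ∑ x ∈ latQ d (ε k), U k x * v (scaled (ε k) x)) - c * I) +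
      ε k ^ d * ∑ x ∈ latQ d (ε k), U k x * v (scaled (ε k) x) * cobdry g (shift x ω) +
      ε k ^ d * ∑ x ∈ latQ d (ε k), U k x * v (scaled (ε k) x) *
        (f (shift x ω) - c - cobdry g (shift x ω)) := by
    simp only [mul_sub, Finset.sum_sub_distrib, ← Finset.sum_mul]
    ring
  have hrest : |ε k ^ d * ∑ x ∈ latQ d (ε k), U k x * v (scaled (ε k) x) *
      (f (shift x ω) - c - cobdry g (shift x ω))| ≤ δ / 2 := by
    rw [abs_mul, abs_of_pos hεd]
    calc ε k ^ d * |∑ x ∈ latQ d (ε k), U k x * v (scaled (ε k) x) *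
          (f (shift x ω) - c - cobdry g (shift x ω))|
        ≤ ε k ^ d * ∑ x ∈ latQ d (ε k), K * Kv * |f (shift x ω) - c - cobdry g (shift x ω)| := by
          gcongr
          refine (Finset.abs_sum_le_sum_abs _ _).trans (Finset.sum_le_sum fun x _ => ?_)
          rw [abs_mul, abs_mul]
          gcongr
          exacts [hK k x, hKv _]
      _ ≤ ε k ^ d * (K * Kv * (δ / (2 * (K * Kv + 1) * 5 ^ d) * (box d ⌈1 / ε k⌉₊).card)) := by
          rw [← Finset.mul_sum]
          gcongr
          exact (Finset.sum_le_sum_of_subset_of_nonneg (latQ_subset_box (ε k))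
            fun _ _ _ => abs_nonneg _).trans (hgN _)
      _ = K * Kv * (δ / (2 * (K * Kv + 1) * 5 ^ d)) * (ε k ^ d * (box d ⌈1 / ε k⌉₊).card) := by ring
      _ ≤ K * Kv * (δ / (2 * (K * Kv + 1) * 5 ^ d)) * 5 ^ d := by
          have h1 := pow_mul_card_box_le (d := d) hk0 hk1 0
          simp only [add_zero, Nat.cast_zero, mul_zero, zero_add] at h1
          gcongr
      _ = (K * Kv) / (K * Kv + 1) * (δ / 2) := by field_simp
      _ ≤ δ / 2 := by
          refine mul_le_of_le_one_left (by positivity) ?_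
          rw [div_le_one (by positivity)]
          linarith
  rw [Real.dist_eq, hsplit]
  have hcob := abs_sum_mul_cobdry_le (ω := ω) hk0 hk1 (hU k) (hK k) hL hKv hKg
  refine (abs_add_le _ _).trans_lt ?_
  have h6 := abs_add_le (c * (ε k ^ d * ∑ x ∈ latQ d (ε k), U k x * v (scaled (ε k) x)) - c * I)
    (ε k ^ d * ∑ x ∈ latQ d (ε k), U k x * v (scaled (ε k) x) * cobdry g (shift x ω))
  linarith

/-! ### Pairing with solenoidal fields -/

theorem rcond_mul_abs_le (ω : Env d) (φ : Field d) (x z : Lat d) :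
    rcond ω x z * (√(sqLen z) * |φ (shift x ω) z|) ≤ weight ω φ x z := by
  refine mul_le_mul_of_nonneg_left ?_ (rcond_nonneg _ _ _)
  have h1 := two_mul_le_add_sq (√(sqLen z)) |φ (shift x ω) z|
  rw [Real.sq_sqrt (sqLen_nonneg z), sq_abs] at h1
  have h2 : 0 ≤ √(sqLen z) * |φ (shift x ω) z| := by positivity
  linarith

theorem Tame.summable_mul {ω : Env d} {φ : Field d} (h : Tame (weight ω φ)) {f : Lat d → ℝ} {K : ℝ}
    (hf : ∀ z, |f z| ≤ K) (x : Lat d) :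
    Summable fun z => rcond ω x z * (f z * φ (shift x ω) z) := by
  refine summable_mul_of_sq ?_ (h.summable_sq x)
  refine Summable.of_nonneg_of_le (fun z => mul_nonneg (rcond_nonneg _ _ _) (sq_nonneg _))
    (fun z => ?_) ((h.summable x).mul_left (K ^ 2))
  rw [mul_comm]
  exact mul_le_mul (sq_le_sq' (neg_le_of_abs_le (hf z)) (le_of_abs_le (hf z)))
    (rcond_le_weight ω φ x z) (rcond_nonneg _ _ _) (sq_nonneg _)

/-- Summation by parts: for a divergence free field the discrete derivative can be moved to the
test function. -/
theorem pairing_eq_of_div_free {ω : Env d} {ε : ℝ} {U : Lat d → ℝ} {C : ℝ≥0}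
    (h : Admissible ω ε U C) {b : Field d}
    (hb : ∀ ω x z, b ω (x + z) - b ω x = b (shift x ω) z) (ht : Tame (weight ω b))
    (hdiv : ∀ x, ∑' z, rcond ω x z * b (shift x ω) z = 0) {v : Sp d → ℝ} {K : ℝ}
    (hv : ∀ x, |v x| ≤ K) :
    pairing ω ε U v b = -(ε ^ d * ∑ x ∈ latQ d ε, U x *
      ∑' z, rcond ω x z * (discDeriv ε (fun y => v (scaled ε y)) x z * b (shift x ω) z)) := by
  have hflip : ∀ x z, b (shift (x + z) ω) (-z) ^ 2 = b (shift x ω) z ^ 2 := fun x z => by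
    rw [covariant_flip hb, neg_sq]
  have hsab : ∀ x, Summable fun z => |rcond ω x z * b (shift x ω) z| := fun x => by
    have := (ht.summable_mul (f := fun _ => 1) (K := 1) (by simp) x).abs
    simpa using this
  obtain ⟨hS, -⟩ := summable_indicator_fst (w := fun x z => |rcond ω x z * b (shift x ω) z|)
    (fun _ _ => abs_nonneg _) hsab (latQ d ε)
  have hsum : ∀ m : Lat d × Lat d → ℝ, (∀ p, |m p| ≤ K) →
      Summable fun p : Lat d × Lat d =>
        U p.1 * (m p * (rcond ω p.1 p.2 * b (shift p.1 ω) p.2)) := by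
    intro m hm
    obtain ⟨B, hB⟩ : ∃ B : ℝ, ∀ x ∈ latQ d ε, |U x| ≤ B :=
      ⟨∑ x ∈ latQ d ε, |U x|, fun x hx =>
        Finset.single_le_sum (f := fun x => |U x|) (fun _ _ => abs_nonneg _) hx⟩
    refine Summable.of_norm_bounded (hS.mul_left (B * K)) fun p => ?_
    by_cases hp : p.1 ∈ latQ d ε
    · rw [if_pos hp, norm_mul, norm_mul, ← mul_assoc]
      have hB0 := (abs_nonneg _).trans (hB _ hp)
      have hK0 := (abs_nonneg _).trans (hm p)
      gcongr
      exacts [hB _ hp, hm p, le_rfl]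
    · simp [hp, h.supp.eq_zero h.pos hp]
  have h0 := hsum (fun p => v (scaled ε p.1)) fun p => hv _
  have h1 := hsum (fun p => v (scaled ε (p.1 + p.2))) fun p => hv _
  -- summing over `z` first, this vanishes since the divergence does
  have hz0 : ∑' p : Lat d × Lat d,
      U p.1 * (v (scaled ε p.1) * (rcond ω p.1 p.2 * b (shift p.1 ω) p.2)) = 0 := by
    rw [h0.tsum_prod]
    simp_rw [tsum_mul_left, hdiv, mul_zero]
    exact tsum_zero
  -- the discrete derivative of `v` arises by subtracting the vanishing sum
  have hz1 : ∑' p : Lat d × Lat d,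
      U p.1 * (v (scaled ε (p.1 + p.2)) * (rcond ω p.1 p.2 * b (shift p.1 ω) p.2)) =
      ε * ∑ x ∈ latQ d ε, U x *
      ∑' z, rcond ω x z * (discDeriv ε (fun y => v (scaled ε y)) x z * b (shift x ω) z) := by
    have e : ∑' p : Lat d × Lat d,
        U p.1 * (v (scaled ε (p.1 + p.2)) * (rcond ω p.1 p.2 * b (shift p.1 ω) p.2)) =
        ∑' p : Lat d × Lat d,
        (U p.1 * (v (scaled ε (p.1 + p.2)) * (rcond ω p.1 p.2 * b (shift p.1 ω) p.2)) -
         U p.1 * (v (scaled ε p.1) * (rcond ω p.1 p.2 * b (shift p.1 ω) p.2))) := by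
      rw [h1.tsum_sub h0, hz0, sub_zero]
    rw [e, (h1.sub h0).tsum_prod, tsum_eq_sum (s := latQ d ε), Finset.mul_sum]
    · refine Finset.sum_congr rfl fun x _ => ?_
      rw [← tsum_mul_left, ← tsum_mul_left]
      refine tsum_congr fun z => ?_
      have := h.pos.ne'
      rw [discDeriv]
      field_simp
    · intro x hx
      simp [h.supp.eq_zero h.pos hx]
  rw [h.pairing_eq ht.summable_sq hflip hv]
  have hε := h.pos.ne'
  -- the two terms of the discrete derivative of `U`, the first one on the reversed edge
  have e : ∀ p : Lat d × Lat d, v (scaled ε p.1) *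
      (rcond ω p.1 p.2 * (discDeriv ε U p.1 p.2 * b (shift p.1 ω) p.2)) =
      ε⁻¹ * (-(U (edgeFlip d p).1 * (v (scaled ε ((edgeFlip d p).1 + (edgeFlip d p).2)) *
        (rcond ω (edgeFlip d p).1 (edgeFlip d p).2 *
          b (shift (edgeFlip d p).1 ω) (edgeFlip d p).2))) -
        U p.1 * (v (scaled ε p.1) * (rcond ω p.1 p.2 * b (shift p.1 ω) p.2))) := by
    intro p
    simp only [edgeFlip_apply, covariant_flip hb, rcond_neg, add_neg_cancel_right, discDeriv]
    field_simp
  have h1' := (edgeFlip d).summable_iff.2 h1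
  have e2 := (edgeFlip d).tsum_eq fun p : Lat d × Lat d =>
    U p.1 * (v (scaled ε (p.1 + p.2)) * (rcond ω p.1 p.2 * b (shift p.1 ω) p.2))
  simp_rw [e]
  rw [tsum_mul_left]
  have e3 := h1'.neg.tsum_sub h0
  simp only [Function.comp_apply] at e3
  rw [e3, tsum_neg, e2, hz0, hz1, sub_zero]
  field_simp

/-- The discrete derivative of `v` is replaced by its derivative: to second order on the short
edges, for which `z ∈ Z`, and to first order on the long ones, which carry little weight. -/
theorem abs_tsum_taylor_le {ω : Env d} {b : Field d} (ht : Tame (weight ω b)) {v : Sp d → ℝ}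
    {Kv : ℝ} (hv : ∀ x, |v x| ≤ Kv) {L ε : ℝ} (hL0 : 0 ≤ L) (hε : 0 < ε)
    (hL : ∀ x z : Lat d,
      |discDeriv ε (fun y => v (scaled ε y)) x z - ∑ i, pderiv i v (scaled ε x) * (z i : ℝ)| ≤
        L * √(sqLen z) ∧
      |discDeriv ε (fun y => v (scaled ε y)) x z - ∑ i, pderiv i v (scaled ε x) * (z i : ℝ)| ≤
        L * ε * sqLen z) {Z : Finset (Lat d)} {M : ℝ} (hM : ∀ z ∈ Z, √(sqLen z) ≤ M)
    (hM0 : 0 ≤ M) (x : Lat d) :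
    |∑' z, rcond ω x z * (discDeriv ε (fun y => v (scaled ε y)) x z * b (shift x ω) z) -
      ∑ i, pderiv i v (scaled ε x) * density (coordField i) b (shift x ω)| ≤
      L * ε * M * ∑' z, weight ω b x z + L * ∑' z, (if z ∈ Z then 0 else weight ω b x z) := by
  have hs1 : Summable fun z =>
      rcond ω x z * (discDeriv ε (fun y => v (scaled ε y)) x z * b (shift x ω) z) := by
    refine ht.summable_mul (K := (Kv + Kv) / ε) (fun z => ?_) x
    rw [discDeriv, abs_div, abs_of_pos hε]
    refine div_le_div_of_nonneg_right ?_ hε.le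
    exact (abs_sub _ _).trans (add_le_add (hv _) (hv _))
  have hs2 : ∀ i : Fin d, Summable fun z : Lat d =>
      rcond ω x z * (coordField i (shift x ω) z * b (shift x ω) z) := fun i => by
    refine summable_mul_of_sq ?_ (ht.summable_sq x)
    refine (ht.summable_sqLen x).of_nonneg_of_le
      (fun z => mul_nonneg (rcond_nonneg _ _ _) (sq_nonneg _)) fun z => ?_
    exact mul_le_mul_of_nonneg_left (sq_coord_le_sqLen z i) (rcond_nonneg _ _ _)
  have e : ∑ i, pderiv i v (scaled ε x) * density (coordField i) b (shift x ω) =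
      ∑' z, ∑ i, pderiv i v (scaled ε x) *
        (rcond ω x z * (coordField i (shift x ω) z * b (shift x ω) z)) := by
    rw [Summable.tsum_finsetSum fun i _ => (hs2 i).mul_left _]
    refine Finset.sum_congr rfl fun i _ => ?_
    rw [tsum_mul_left, density_shift]
  have hw0 := ht.nonneg
  have hs3 : Summable fun z => if z ∈ Z then 0 else weight ω b x z :=
    (ht.summable x).of_nonneg_of_le (fun z => by split_ifs; exacts [le_rfl, hw0 x z])
      fun z => by split_ifs; exacts [hw0 x z, le_rfl]
  rw [e, ← hs1.tsum_sub (summable_sum fun i _ => (hs2 i).mul_left _), ← tsum_mul_left,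
    ← tsum_mul_left, ← ((ht.summable x).mul_left _).tsum_add (hs3.mul_left _),
    ← Real.norm_eq_abs]
  refine tsum_of_norm_bounded (((ht.summable x).mul_left _).add (hs3.mul_left _)).hasSum
    fun z => ?_
  have e2 : rcond ω x z * (discDeriv ε (fun y => v (scaled ε y)) x z * b (shift x ω) z) -
      ∑ i, pderiv i v (scaled ε x) *
        (rcond ω x z * (coordField i (shift x ω) z * b (shift x ω) z)) =
      rcond ω x z * ((discDeriv ε (fun y => v (scaled ε y)) x z -
        ∑ i, pderiv i v (scaled ε x) * (z i : ℝ)) * b (shift x ω) z) := by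
    rw [sub_mul, mul_sub, Finset.sum_mul, Finset.mul_sum]
    congr 1
    refine Finset.sum_congr rfl fun i _ => ?_
    simp only [coordField]
    ring
  rw [e2, norm_mul, norm_mul, Real.norm_of_nonneg (rcond_nonneg _ _ _), Real.norm_eq_abs,
    Real.norm_eq_abs]
  have hbase := rcond_mul_abs_le ω b x z
  have ha := rcond_nonneg ω x z
  by_cases hz : z ∈ Z
  · rw [if_pos hz, mul_zero, add_zero]
    calc rcond ω x z * (_ * |b (shift x ω) z|)
        ≤ rcond ω x z * (L * ε * sqLen z * |b (shift x ω) z|) := by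
          gcongr; exact (hL x z).2
      _ = L * ε * √(sqLen z) * (rcond ω x z * (√(sqLen z) * |b (shift x ω) z|)) := by
          have := Real.mul_self_sqrt (sqLen_nonneg z)
          linear_combination (-(rcond ω x z * L * ε * |b (shift x ω) z|)) * this
      _ ≤ L * ε * M * weight ω b x z := by
          gcongr
          exact hM z hz
  · rw [if_neg hz]
    calc rcond ω x z * (_ * |b (shift x ω) z|)
        ≤ rcond ω x z * (L * √(sqLen z) * |b (shift x ω) z|) := by
          gcongr; exact (hL x z).1
      _ = L * (rcond ω x z * (√(sqLen z) * |b (shift x ω) z|)) := by ring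
      _ ≤ L * weight ω b x z := by gcongr
      _ ≤ _ := le_add_of_nonneg_left (by have := hw0 x z; positivity)

/-- In the limit, pairing with a solenoidal field is a weak derivative of the limit function in the
direction `(⟨z_i, b⟩)_i`. -/
theorem tendsto_pairing_sol {ω : Env d} {ε : ℕ → ℝ}
    (h0 : Tendsto ε atTop (𝓝 0)) {U : ℕ → Lat d → ℝ} {C : ℝ≥0}
    (hU : ∀ k, Admissible ω (ε k) (U k) C)
    {K : ℝ} (hK : ∀ k x, |U k x| ≤ K)
    (hdiff : ∀ i, Tendsto (fun k => ε k ^ d * ∑' x, |U k (x + Pi.single i 1) - U k x|) atTop (𝓝 0))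
    {b : Field d} (hb : ∀ ω x z, b ω (x + z) - b ω x = b (shift x ω) z) (ht : Tame (weight ω b))
    (hdiv : ∀ x, ∑' z, rcond ω x z * b (shift x ω) z = 0) {c : Fin d → ℝ}
    (hc : ∀ i, CobdryApprox (density (coordField i) b) (c i) ω) {v : Sp d → ℝ} (hv : IsTest v)
    {I : Fin d → ℝ}
    (hI : ∀ i, Tendsto (fun k => ∫ x, interp (ε k) (U k) x * pderiv i v x) atTop (𝓝 (I i))) :
    Tendsto (fun k => pairing ω (ε k) (U k) v b) atTop (𝓝 (-∑ i, c i * I i)) := by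
  obtain ⟨Kv, hKv⟩ := hv.exists_bound
  obtain ⟨L, hL0, hL⟩ := hv.exists_taylor
  have hε : ∀ k, 0 < ε k ∧ ε k ≤ 1 := fun k => ⟨(hU k).pos, (hU k).le_one⟩
  have hK0 : 0 ≤ K := (abs_nonneg _).trans (hK 0 0)
  -- the first-order term, where only the means of the densities survive
  have hmain : Tendsto (fun k => ε k ^ d * ∑ x ∈ latQ d (ε k), U k x *
      ∑ i, pderiv i v (scaled (ε k) x) * density (coordField i) b (shift x ω)) atTop
      (𝓝 (∑ i, c i * I i)) := by
    have := tendsto_finsetSum Finset.univ fun i _ => tendsto_sum_mul_cobdryApprox hε h0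
      (fun k => (hU k).supp) hK hdiff (hc i) (hv.pderiv i) (hI i)
    refine this.congr fun k => ?_
    rw [← Finset.mul_sum, Finset.sum_comm]
    congr 1
    refine Finset.sum_congr rfl fun x _ => ?_
    rw [Finset.mul_sum]
    exact Finset.sum_congr rfl fun i _ => by ring
  -- the Taylor remainder
  have herr : Tendsto (fun k => ε k ^ d * ∑ x ∈ latQ d (ε k), U k x *
      (∑' z, rcond ω x z * (discDeriv (ε k) (fun y => v (scaled (ε k) y)) x z * b (shift x ω) z) -
      ∑ i, pderiv i v (scaled (ε k) x) * density (coordField i) b (shift x ω))) atTop (𝓝 0) := by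
    obtain ⟨Cw, hCw0, hCw⟩ := ht.sum_latQ_le
    refine (nhds_basis_zero_abs_lt ℝ).tendsto_right_iff.2 fun δ hδ => ?_
    obtain ⟨Z, hZ⟩ := ht.sum_latQ_tail_le (δ := δ / (2 * (K * L + 1))) (by positivity)
    obtain ⟨M, hM0, hM⟩ : ∃ M : ℝ, 0 ≤ M ∧ ∀ z ∈ Z, √(sqLen z) ≤ M :=
      ⟨∑ z ∈ Z, √(sqLen z), Finset.sum_nonneg fun _ _ => Real.sqrt_nonneg _, fun z hz =>
        Finset.single_le_sum (f := fun z => √(sqLen z)) (fun _ _ => Real.sqrt_nonneg _) hz⟩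
    have hsmall : Tendsto (fun k => K * (L * ε k * M * Cw)) atTop (𝓝 0) := by
      have := (((h0.const_mul L).mul_const M).mul_const Cw).const_mul K
      simpa using this
    filter_upwards [hsmall.eventually (gt_mem_nhds (half_pos hδ))] with k hk
    have hεd : 0 < ε k ^ d := pow_pos (hε k).1 d
    rw [abs_mul, abs_of_pos hεd]
    calc ε k ^ d * |∑ x ∈ latQ d (ε k), U k x * (∑' z, rcond ω x z *
          (discDeriv (ε k) (fun y => v (scaled (ε k) y)) x z * b (shift x ω) z) -
          ∑ i, pderiv i v (scaled (ε k) x) * density (coordField i) b (shift x ω))|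
        ≤ ε k ^ d * ∑ x ∈ latQ d (ε k), K * (L * ε k * M * ∑' z, weight ω b x z +
          L * ∑' z, (if z ∈ Z then 0 else weight ω b x z)) := by
          gcongr
          refine (Finset.abs_sum_le_sum_abs _ _).trans (Finset.sum_le_sum fun x _ => ?_)
          rw [abs_mul]
          exact mul_le_mul (hK k x)
            (abs_tsum_taylor_le ht hKv hL0 (hε k).1 (hL (ε k) (hε k).1) hM hM0 x)
            (abs_nonneg _) hK0
      _ = K * (L * ε k * M * (ε k ^ d * ∑ x ∈ latQ d (ε k), ∑' z, weight ω b x z)) +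
          K * L * (ε k ^ d * ∑ x ∈ latQ d (ε k), ∑' z, (if z ∈ Z then 0 else weight ω b x z)) := by
          rw [← Finset.mul_sum, Finset.sum_add_distrib, ← Finset.mul_sum, ← Finset.mul_sum]
          ring
      _ ≤ K * (L * ε k * M * Cw) + K * L * (δ / (2 * (K * L + 1))) := by
          have := (hε k).1
          gcongr
          exacts [hCw _ (hε k).1 (hε k).2, hZ _ (hε k).1 (hε k).2]
      _ < δ / 2 + δ / 2 := by
          refine add_lt_add_of_lt_of_le hk ?_
          have : K * L * (δ / (2 * (K * L + 1))) = K * L / (K * L + 1) * (δ / 2) := by field_simp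
          rw [this]
          refine mul_le_of_le_one_left (by positivity) ?_
          rw [div_le_one (by positivity)]
          linarith
      _ = δ := by ring
  have := (hmain.add herr).neg
  rw [add_zero] at this
  refine this.congr fun k => ?_
  rw [pairing_eq_of_div_free (hU k) hb ht hdiv hKv, ← mul_add, ← Finset.sum_add_distrib]
  congr 2
  exact Finset.sum_congr rfl fun x _ => by ring

/-! ### Pairing with the constant field -/

/-- The discrete derivative is antisymmetric under reversal of edges. Symmetrization replaces `v` by
its difference along the edge, which yields a factor `ε`. -/
theorem abs_pairing_one_le {ω : Env d} {ε : ℝ} {U : Lat d → ℝ} {C : ℝ≥0}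
    (h : Admissible ω ε U C) {φ : Field d} (ht : Tame (weight ω φ)) {v : Sp d → ℝ} {Kv : ℝ}
    (hvb : ∀ x, |v x| ≤ Kv) {L : ℝ≥0} (hv : LipschitzWith L v) :
    |pairing ω ε U v fun _ _ => 1| ≤ ε * ((C + 2 * L ^ 2 *
      (ε ^ d * ∑ x ∈ latQ d ε, ∑' z, weight ω φ x z)) / 4) := by
  have hε := h.pos
  have hεd : 0 < ε ^ d := pow_pos hε d
  have hsc : ∀ x, Summable fun z => rcond ω x z * (1 : ℝ) ^ 2 := fun x =>
    (ht.summable x).of_nonneg_of_le (fun z => by simpa using rcond_nonneg ω x z)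
      fun z => by simpa using rcond_le_weight ω φ x z
  have hs := h.summable_pair_mul (ψ := fun _ _ => 1) hsc (by simp)
    (m := fun p => v (scaled ε p.1)) fun p => hvb _
  rw [h.pairing_eq (φ := fun _ _ => 1) hsc (by simp) hvb]
  simp only [mul_one] at hs ⊢
  obtain ⟨T, hT⟩ : ∃ T : Lat d × Lat d → ℝ, T = fun p =>
    v (scaled ε p.1) * (rcond ω p.1 p.2 * discDeriv ε U p.1 p.2) := ⟨_, rfl⟩
  have hs' : Summable T := by rw [hT]; exact hs
  have hsf := (edgeFlip d).summable_iff.2 hs'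
  obtain ⟨hE, hEC⟩ := summable_energy h.cond_lt_top h.pos h.energy
  obtain ⟨hN, hNle⟩ := summable_near (w := fun x z => rcond ω x z * sqLen z)
    (fun x z => mul_nonneg (rcond_nonneg _ _ _) (sqLen_nonneg _)) ht.summable_sqLen
    (fun x z => by rw [rcond_neg]; simp [sqLen]) (latQ d ε)
  have hb : ∀ p, ‖T p + T (edgeFlip d p)‖ ≤
      ε * ((rcond ω p.1 p.2 * discDeriv ε U p.1 p.2 ^ 2 + L ^ 2 *
        (if p.1 ∈ latQ d ε ∨ p.1 + p.2 ∈ latQ d ε then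
          rcond ω p.1 p.2 * sqLen p.2 else 0)) / 2) := by
    intro p
    have e : T p + T (edgeFlip d p) = rcond ω p.1 p.2 *
        (discDeriv ε U p.1 p.2 * (v (scaled ε p.1) - v (scaled ε (p.1 + p.2)))) := by
      rw [hT]
      simp only [edgeFlip_apply, rcond_neg, discDeriv_flip]
      ring
    rw [e]
    by_cases hp : p.1 ∈ latQ d ε ∨ p.1 + p.2 ∈ latQ d ε
    · rw [if_pos hp]
      have h1 : |v (scaled ε p.1) - v (scaled ε (p.1 + p.2))| ≤ L * (ε * √(sqLen p.2)) := by
        have := hv.norm_sub_le (scaled ε (p.1 + p.2)) (scaled ε p.1)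
        rw [scaled_add, add_sub_cancel_left, norm_scaled hε.le] at this
        rw [abs_sub_comm, scaled_add]
        exact this
      have h2 := abs_mul_le_half (W := discDeriv ε U p.1 p.2)
        (ψ := L * √(sqLen p.2)) (rcond_nonneg ω p.1 p.2) one_pos
      have h3 : (L * √(sqLen p.2)) ^ 2 = L ^ 2 * sqLen p.2 := by
        rw [mul_pow, Real.sq_sqrt (sqLen_nonneg _)]
      rw [h3] at h2
      have h4 : 0 ≤ (L : ℝ) * √(sqLen p.2) := by positivity
      have ha := rcond_nonneg ω p.1 p.2
      rw [abs_mul, abs_mul, abs_of_nonneg ha, abs_of_nonneg h4] at h2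
      rw [norm_mul, norm_mul, Real.norm_of_nonneg ha, Real.norm_eq_abs, Real.norm_eq_abs]
      calc rcond ω p.1 p.2 * (|discDeriv ε U p.1 p.2| * |_|)
          ≤ rcond ω p.1 p.2 * (|discDeriv ε U p.1 p.2| * (L * (ε * √(sqLen p.2)))) := by gcongr
        _ = ε * (rcond ω p.1 p.2 * (|discDeriv ε U p.1 p.2| * (L * √(sqLen p.2)))) := by ring
        _ ≤ ε * _ := by
            refine mul_le_mul_of_nonneg_left (h2.trans (le_of_eq ?_)) hε.le
            simp only [one_mul, inv_one]
            ring
    · rw [h.discDeriv_eq_zero hp, if_neg hp]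
      simp
  -- the sum is invariant under reversal of edges
  have hdouble : ∑' p, T p = (∑' p, (T p + T (edgeFlip d p))) / 2 := by
    have := hs'.tsum_add hsf
    simp only [Function.comp_apply] at this
    rw [this, (edgeFlip d).tsum_eq T]; ring
  have hle := tsum_of_norm_bounded (((hE.add (hN.mul_left (L ^ 2 : ℝ))).div_const 2).mul_left
    ε).hasSum hb
  rw [tsum_mul_left, tsum_div_const, hE.tsum_add (hN.mul_left _), tsum_mul_left] at hle
  have hT' : ∑' p : Lat d × Lat d, v (scaled ε p.1) *
      (rcond ω p.1 p.2 * discDeriv ε U p.1 p.2) = ∑' p, T p := by rw [hT]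
  rw [hT', hdouble, abs_mul, abs_of_pos hεd, abs_div, abs_of_pos (two_pos : (0 : ℝ) < 2)]
  have hq : ∑ x ∈ latQ d ε, ∑' z, rcond ω x z * sqLen z ≤
      ∑ x ∈ latQ d ε, ∑' z, weight ω φ x z := Finset.sum_le_sum fun x _ =>
    (ht.summable_sqLen x).tsum_le_tsum (fun z => mul_sqLen_le_weight ω φ x z) (ht.summable x)
  rw [Real.norm_eq_abs] at hle
  obtain ⟨E, hEd⟩ : ∃ E, E = ∑' p : Lat d × Lat d,
    rcond ω p.1 p.2 * discDeriv ε U p.1 p.2 ^ 2 := ⟨_, rfl⟩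
  rw [← hEd] at hle hEC
  have hN2 := hNle.trans (mul_le_mul_of_nonneg_left hq zero_le_two)
  calc ε ^ d * (|∑' p, (T p + T (edgeFlip d p))| / 2)
      ≤ ε ^ d * ((ε * ((E + L ^ 2 * (2 * ∑ x ∈ latQ d ε, ∑' z, weight ω φ x z)) / 2)) / 2) := by
        gcongr
        refine hle.trans ?_
        gcongr
    _ = ε * ((ε ^ d * E + 2 * L ^ 2 * (ε ^ d * ∑ x ∈ latQ d ε, ∑' z, weight ω φ x z)) / 4) := by
        ring
    _ ≤ _ := by gcongr

theorem tendsto_pairing_one {ω : Env d} {ε : ℕ → ℝ} (h0 : Tendsto ε atTop (𝓝 0))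
    {U : ℕ → Lat d → ℝ} {C : ℝ≥0} (hU : ∀ k, Admissible ω (ε k) (U k) C)
    {φ : Field d} (ht : Tame (weight ω φ)) {v : Sp d → ℝ} (hv : IsTest v) :
    Tendsto (fun k => pairing ω (ε k) (U k) v fun _ _ => 1) atTop (𝓝 0) := by
  obtain ⟨Kv, hKv⟩ := hv.exists_bound
  obtain ⟨L, hL⟩ := hv.exists_lipschitz
  obtain ⟨Cw, hCw0, hCw⟩ := ht.sum_latQ_le
  refine squeeze_zero_norm (a := fun k => ε k * ((C + 2 * L ^ 2 * Cw) / 4)) (fun k => ?_) ?_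
  · refine (abs_pairing_one_le (hU k) ht hKv hL).trans ?_
    have := (hU k).pos
    gcongr
    exact hCw _ (hU k).pos (hU k).le_one
  · simpa using h0.mul_const ((C + 2 * L ^ 2 * Cw : ℝ) / 4)

/-! ### Reversal of edges -/

theorem measurable_reverse :
    Measurable fun p : Env d × Lat d => ((shift p.2 p.1, -p.2) : Env d × Lat d) :=
  measurable_from_prod_countable_left fun z =>
    (measurable_shift z).prodMk (measurable_const (a := -z))

theorem lintegral_reverse (hstat : Stationary P) {F : Env d × Lat d → ℝ≥0∞}
    (hF : Measurable F) :
    ∫⁻ p, F (shift p.2 p.1, -p.2) ∂(edgeMeasure P) = ∫⁻ p, F p ∂(edgeMeasure P) := by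
  have hsec : ∀ z, Measurable fun ω => F (ω, z) := fun z =>
    hF.comp (measurable_id.prodMk measurable_const)
  have h1 : ∫⁻ p, F (shift p.2 p.1, -p.2) ∂(edgeMeasure P) =
      ∑' z, ∫⁻ ω, cond ω 0 z * F (shift z ω, -z) ∂P := by
    rw [lintegral_edgeMeasure (F := fun p => F (shift p.2 p.1, -p.2)) (hF.comp measurable_reverse)]
    exact lintegral_tsum fun z => ((measurable_cond 0 z).mul
      ((hsec (-z)).comp (measurable_shift z))).aemeasurable
  have h2 : ∫⁻ p, F p ∂(edgeMeasure P) = ∑' z, ∫⁻ ω, cond ω 0 z * F (ω, z) ∂P := by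
    rw [lintegral_edgeMeasure hF]
    exact lintegral_tsum fun z => ((measurable_cond 0 z).mul (hsec z)).aemeasurable
  rw [h1, h2, ← (Equiv.neg (Lat d)).tsum_eq fun z => ∫⁻ ω, cond ω 0 z * F (ω, z) ∂P]
  refine tsum_congr fun z => ?_
  refine Eq.trans (lintegral_congr fun ω => ?_)
    (lintegral_comp_shift hstat ((measurable_cond 0 (-z)).mul (hsec (-z))) z)
  have := cond_neg ω 0 z
  rw [zero_add] at this
  simp only [Pi.mul_apply, cond_shift_zero, this]

/-- The measure on the edges at the origin is invariant under reversal of edges. -/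
theorem measurePreserving_reverse (hstat : Stationary P) :
    MeasurePreserving (fun p : Env d × Lat d => ((shift p.2 p.1, -p.2) : Env d × Lat d))
      (edgeMeasure P) (edgeMeasure P) := by
  refine ⟨measurable_reverse, Measure.ext fun A hA => ?_⟩
  rw [Measure.map_apply measurable_reverse hA, ← lintegral_indicator_one hA,
    ← lintegral_indicator_one (measurable_reverse hA),
    ← lintegral_reverse hstat (measurable_one.indicator hA)]
  rfl

/-- Covariant fields are antisymmetric under reversal of edges, hence orthogonal to constants. -/
theorem MemCov.covInner_one [SFinite P] (hmom : UpperMoment P) (hstat : Stationary P) {φ : Field d}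
    (hφ : MemCov P φ) : covInner P φ (fun _ _ => 1) = 0 := by
  have := isFiniteMeasure_edgeMeasure hmom
  rw [covInner_eq_integral hmom hstat hφ.memLp (memLp_const 1)]
  simp only [mul_one]
  have h1 := (measurePreserving_reverse hstat).map_eq
  have h2 : ∫ p, φ p.1 p.2 ∂(edgeMeasure P) = -∫ p, φ p.1 p.2 ∂(edgeMeasure P) := by
    conv_lhs => rw [← h1]
    rw [integral_map measurable_reverse.aemeasurable
      (by rw [h1]; exact hφ.memLp.aestronglyMeasurable), ← integral_neg]
    refine integral_congr_ae (Eventually.of_forall fun p => ?_)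
    have := covariant_flip hφ.covariant p.1 0 p.2
    rwa [zero_add, shift_zero] at this
  linarith

/-! ### Weak compactness -/

theorem exists_subseq_forall_tendsto {a : ℕ → ℕ → ℝ} (h : ∀ n, ∃ M, ∀ k, |a k n| ≤ M) :
    ∃ σ : ℕ → ℕ, StrictMono σ ∧ ∀ n, ∃ L, Tendsto (fun k => a (σ k) n) atTop (𝓝 L) := by
  choose M hM using h
  obtain ⟨L, -, σ, hσ, hL⟩ := (isCompact_univ_pi fun n => isCompact_Icc (a := -M n)
    (b := M n)).tendsto_subseq (x := a) fun k n _ => abs_le.1 (hM n k)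
  exact ⟨σ, hσ, fun n => ⟨L n, (tendsto_pi_nhds.1 hL) n⟩⟩

/-- Weak sequential compactness, for functionals that are only asymptotically bounded: linear
functionals `l k` on a vector space `E` with `limsup |l k e| ≤ C ‖j e‖`, where `j` maps `E` into
a separable Hilbert space, converge along a subsequence to the pairing with some vector. -/
theorem exists_weak_limit {E H : Type*} [AddCommGroup E] [Module ℝ E] [NormedAddCommGroup H]
    [InnerProductSpace ℝ H] [CompleteSpace H] [SecondCountableTopology H] (j : E →ₗ[ℝ] H)
    (l : ℕ → E →ₗ[ℝ] ℝ) (C : ℝ)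
    (hl : ∀ e, ∀ δ : ℝ, 0 < δ → ∀ᶠ k in atTop, |l k e| ≤ C * ‖j e‖ + δ) :
    ∃ (σ : ℕ → ℕ) (w : H), StrictMono σ ∧
      ∀ e, Tendsto (fun k => l (σ k) e) atTop (𝓝 (inner ℝ w (j e))) := by
  have : Nonempty (Set.range j) := ⟨⟨j 0, 0, rfl⟩⟩
  -- a diagonal subsequence along which the functionals converge on a dense sequence
  obtain ⟨u, hu⟩ := TopologicalSpace.exists_dense_seq (Set.range j)
  choose e he using fun n => (u n).2
  have hbdd : ∀ n, ∃ M, ∀ k, |l k (e n)| ≤ M := fun n => by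
    have : IsBoundedUnder (· ≤ ·) atTop fun k => |l k (e n)| := ⟨_, hl (e n) 1 one_pos⟩
    obtain ⟨M, hM⟩ := this.bddAbove_range
    exact ⟨M, fun k => hM ⟨k, rfl⟩⟩
  obtain ⟨σ, hσ, hconv⟩ := exists_subseq_forall_tendsto hbdd
  have hlσ : ∀ e, ∀ δ : ℝ, 0 < δ → ∀ᶠ k in atTop, |l (σ k) e| ≤ C * ‖j e‖ + δ := fun e δ hδ =>
    hσ.tendsto_atTop.eventually (hl e δ hδ)
  -- by density and the asymptotic bound, convergence extends to all of `E`
  have hcauchy : ∀ x, ∃ L, Tendsto (fun k => l (σ k) x) atTop (𝓝 L) := by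
    intro x
    refine cauchySeq_tendsto_of_complete (Metric.cauchySeq_iff'.2 fun δ hδ => ?_)
    obtain ⟨n, hn⟩ : ∃ n, ‖j (x - e n)‖ < δ / (8 * (|C| + 1)) := by
      obtain ⟨n, hn⟩ := hu.exists_dist_lt ⟨j x, x, rfl⟩
        (by positivity : 0 < δ / (8 * (|C| + 1)))
      refine ⟨n, ?_⟩
      rw [Subtype.dist_eq, ← he n, dist_eq_norm] at hn
      rwa [map_sub]
    have hC : C * ‖j (x - e n)‖ ≤ δ / 8 := by
      calc C * ‖j (x - e n)‖ ≤ (|C| + 1) * (δ / (8 * (|C| + 1))) := by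
            gcongr
            linarith [le_abs_self C]
        _ = δ / 8 := by field_simp
    obtain ⟨L, hL⟩ := hconv n
    obtain ⟨N1, hN1⟩ := Metric.cauchySeq_iff.1 hL.cauchySeq (δ / 4) (by positivity)
    obtain ⟨N2, hN2⟩ := eventually_atTop.1 (hlσ (x - e n) (δ / 8) (by positivity))
    refine ⟨max N1 N2, fun k hk => ?_⟩
    have h1 := hN1 k (le_of_max_le_left hk) (max N1 N2) (le_max_left _ _)
    have h2 := hN2 k (le_of_max_le_right hk)
    have h3 := hN2 (max N1 N2) (le_max_right _ _)
    rw [map_sub] at h2 h3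
    rw [Real.dist_eq] at h1 ⊢
    rw [abs_lt] at h1 ⊢
    rw [abs_le] at h2 h3
    constructor <;> linarith [h1.1, h1.2, h2.1, h2.2, h3.1, h3.2]
  choose T hT using hcauchy
  let Tl : E →ₗ[ℝ] ℝ :=
    { toFun := T
      map_add' := fun x y => tendsto_nhds_unique (hT (x + y))
        (((hT x).add (hT y)).congr fun k => (map_add _ _ _).symm)
      map_smul' := fun c x => tendsto_nhds_unique (hT (c • x))
        (((hT x).const_mul c).congr fun k => (map_smul (l (σ k)) c x).symm) }
  have hTb : ∀ x, |Tl x| ≤ C * ‖j x‖ := fun x =>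
    le_of_forall_pos_le_add fun δ hδ => le_of_tendsto (hT x).abs (hlσ x δ hδ)
  have hker : LinearMap.ker j ≤ LinearMap.ker Tl := fun x hx => by
    have := hTb x
    rw [LinearMap.mem_ker] at hx ⊢
    rw [hx, norm_zero, mul_zero] at this
    exact abs_nonpos_iff.1 this
  -- the limit functional factors through the range of `j`, where it is bounded
  let f0 : LinearMap.range j →ₗ[ℝ] ℝ :=
    ((LinearMap.ker j).liftQ Tl hker).comp j.quotKerEquivRange.symm.toLinearMap
  have hf0 : ∀ x, f0 ⟨j x, x, rfl⟩ = T x := fun x => by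
    have : j.quotKerEquivRange.symm ⟨j x, x, rfl⟩ = (LinearMap.ker j).mkQ x := by
      rw [LinearEquiv.symm_apply_eq]
      rfl
    change (LinearMap.ker j).liftQ Tl hker (j.quotKerEquivRange.symm ⟨j x, x, rfl⟩) = T x
    rw [this]
    rfl
  let f : StrongDual ℝ (LinearMap.range j) := f0.mkContinuous C fun y => by
    obtain ⟨y, x, rfl⟩ := y
    rw [hf0]
    exact hTb x
  obtain ⟨g, hg, -⟩ := exists_extension_norm_eq (LinearMap.range j) f
  refine ⟨σ, (InnerProductSpace.toDual ℝ H).symm g, hσ, fun x => ?_⟩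
  rw [InnerProductSpace.toDual_symm_apply]
  have : g (j x) = T x := (hg ⟨j x, x, rfl⟩).trans (hf0 x)
  rw [this]
  exact hT x

/-! ### Tensor products of test functions and fields -/

/-- The product of the Lebesgue measure on `Q` and the measure on the edges at the origin. -/
abbrev cubeEdge (P : Measure (Env d)) : Measure (Sp d × (Env d × Lat d)) :=
  (volume.restrict (cube d)).prod (edgeMeasure P)

/-- The function `(x, ω, z) ↦ v(x) φ(ω, z)`. -/
def tens (v : Sp d → ℝ) (φ : Field d) (q : Sp d × (Env d × Lat d)) : ℝ := v q.1 * φ q.2.1 q.2.2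

theorem IsTest.memLp_cube {v : Sp d → ℝ} (hv : IsTest v) (p : ℝ≥0∞) :
    MemLp v p (volume.restrict (cube d)) := by
  obtain ⟨K, hK⟩ := hv.exists_bound
  exact MemLp.of_bound hv.1.continuous.aestronglyMeasurable K (Eventually.of_forall hK)

theorem memLp_tens {v : Sp d → ℝ} (hv : MemLp v 2 (volume.restrict (cube d)))
    {φ : Field d} (hφ : MemLp (fun p : Env d × Lat d => φ p.1 p.2) 2 (edgeMeasure P)) :
    MemLp (tens v φ) 2 (cubeEdge P) := by
  have hm : AEStronglyMeasurable (tens v φ) (cubeEdge P) :=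
    hv.aestronglyMeasurable.comp_fst.mul hφ.aestronglyMeasurable.comp_snd
  refine (memLp_two_iff_integrable_sq hm).2 ?_
  have := hv.integrable_sq.mul_prod hφ.integrable_sq
  refine this.congr (Eventually.of_forall fun q => ?_)
  simp only [tens]; ring

theorem integral_tens_mul_tens [SFinite P] (hmom : UpperMoment P) (hstat : Stationary P)
    (v v' : Sp d → ℝ) {φ ψ : Field d} (hφ : MemCov P φ) (hψ : MemCov P ψ) :
    ∫ q, tens v φ q * tens v' ψ q ∂(cubeEdge P) =
      (∫ x in cube d, v x * v' x) * covInner P φ ψ := by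
  rw [covInner_eq_integral hmom hstat hφ.memLp hψ.memLp, ← integral_prod_mul]
  refine integral_congr_ae (Eventually.of_forall fun q => ?_)
  simp only [tens]; ring

theorem inner_toLp {α : Type*} [MeasurableSpace α] {m : Measure α} {f g : α → ℝ}
    (hf : MemLp f 2 m) (hg : MemLp g 2 m) :
    inner ℝ (hf.toLp f) (hg.toLp g) = ∫ a, f a * g a ∂m := by
  rw [L2.inner_def]
  refine integral_congr_ae ?_
  filter_upwards [hf.coeFn_toLp, hg.coeFn_toLp] with a h1 h2
  rw [h1, h2]
  simp [mul_comm]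

/-! ### Compactness for two-scale convergence -/

/-- The pairings of functions of bounded energy are asymptotically controlled by the norm of the
limiting test function. -/
theorem eventually_abs_sum_pairing_le {ω : Env d} {ε : ℕ → ℝ} (h0 : Tendsto ε atTop (𝓝 0))
    {U : ℕ → Lat d → ℝ} {C : ℝ≥0} (hU : ∀ k, Admissible ω (ε k) (U k) C) {ι : Type*}
    (S : Finset ι) (c : ι → ℝ) {v : ι → Sp d → ℝ} (hv : ∀ j, IsTest (v j)) {φ : ι → Field d}
    (hcov : ∀ j, MemCov P (φ j)) (ht : ∀ j, Tame (weight ω (φ j)))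
    (herg : ∀ j k, ErgodicLimit P (density (φ j) (φ k)) ω) {N : ℝ} (hN0 : 0 ≤ N)
    (hN : ∑ j ∈ S, ∑ k ∈ S, c j * c k *
      (covInner P (φ j) (φ k) * ∫ x in cube d, v j x * v k x) = N ^ 2) {δ : ℝ} (hδ : 0 < δ) :
    ∀ᶠ k in atTop, |∑ j ∈ S, c j * pairing ω (ε k) (U k) (v j) (φ j)| ≤
      ((C : ℝ) + 1) / 2 * N + δ := by
  have h1 : Tendsto (fun k => ∑ j ∈ S, c j * (pairing ω (ε k) (U k) (v j) (φ j) -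
      pairingQ ω (ε k) (U k) (v j) (φ j))) atTop (𝓝 0) := by
    have := tendsto_finsetSum S fun j _ => by
      obtain ⟨K, hK⟩ := (hv j).exists_bound
      exact (tendsto_pairing_sub_pairingQ (ht j) (fun x z => by
        rw [covariant_flip (hcov j).covariant, neg_sq]) (herg j j) h0 hU hK).const_mul (c j)
    simpa using this
  -- the optimal weight is `s = N`; the second summand keeps `s` positive
  obtain ⟨s, hs⟩ : ∃ s : ℝ, s = N + δ / (C + 1) := ⟨_, rfl⟩
  have hs0 : 0 < s := by rw [hs]; positivity
  have h2 : Tendsto (fun n => (s * C + s⁻¹ * ∑ j ∈ S, ∑ k ∈ S, c j * c k *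
      (ε n ^ d * ∑ x ∈ latQ d (ε n), v j (scaled (ε n) x) * v k (scaled (ε n) x) *
        density (φ j) (φ k) (shift x ω))) / 2) atTop (𝓝 ((s * C + s⁻¹ * N ^ 2) / 2)) := by
    rw [← hN]
    refine (tendsto_const_nhds.add ((tendsto_finsetSum S fun j _ =>
      tendsto_finsetSum S fun k _ => ?_).const_mul _)).div_const 2
    exact ((herg j k).tendsto_latQ (v := fun x => v j x * v k x)
      ((hv j).1.continuous.mul (hv k).1.continuous) (fun k => (hU k).pos) h0).const_mul _
  have hlt : (s * C + s⁻¹ * N ^ 2) / 2 < ((C : ℝ) + 1) / 2 * N + 3 * δ / 4 := by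
    have h3 : s⁻¹ * N ^ 2 ≤ N := by
      rw [inv_mul_le_iff₀ hs0, pow_two]
      gcongr
      rw [hs]
      exact le_add_of_nonneg_right (by positivity)
    have h4 : δ / (C + 1) * C ≤ δ := by
      rw [div_mul_eq_mul_div, div_le_iff₀ (by positivity)]
      nlinarith
    have h5 : s * C ≤ N * C + δ := by rw [hs, add_mul]; linarith
    linarith
  filter_upwards [h2.eventually (gt_mem_nhds hlt),
    (nhds_basis_zero_abs_lt ℝ).tendsto_right_iff.1 h1 (δ / 4) (by positivity)] with k hk1 hk2
  have h6 := abs_sum_pairingQ_le (hU k) S c v φ (fun j _ => ht j) hs0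
  have h7 : ∑ j ∈ S, c j * pairing ω (ε k) (U k) (v j) (φ j) =
      ∑ j ∈ S, c j * (pairing ω (ε k) (U k) (v j) (φ j) - pairingQ ω (ε k) (U k) (v j) (φ j)) +
      ∑ j ∈ S, c j * pairingQ ω (ε k) (U k) (v j) (φ j) := by
    rw [← Finset.sum_add_distrib]
    exact Finset.sum_congr rfl fun j _ => by ring
  rw [h7]
  have h8 := abs_add_le (∑ j ∈ S, c j * (pairing ω (ε k) (U k) (v j) (φ j) -
    pairingQ ω (ε k) (U k) (v j) (φ j))) (∑ j ∈ S, c j * pairingQ ω (ε k) (U k) (v j) (φ j))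
  have h9 : |∑ j ∈ S, c j * (pairing ω (ε k) (U k) (v j) (φ j) -
    pairingQ ω (ε k) (U k) (v j) (φ j))| < δ / 4 := hk2
  linarith

/-- Compactness: along a subsequence the pairings with all test functions and all fields of the
family converge to the pairings with an element of `L²(Q; L²(edgeMeasure P))`. -/
theorem exists_pairing_limit [IsProbabilityMeasure P] (hmom : UpperMoment P)
    (hstat : Stationary P) {ω : Env d} {ε : ℕ → ℝ} (h0 : Tendsto ε atTop (𝓝 0))
    {U : ℕ → Lat d → ℝ} {C : ℝ≥0} (hU : ∀ k, Admissible ω (ε k) (U k) C) {Ψ : Set (Field d)}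
    (hcov : ∀ φ ∈ Ψ, MemCov P φ) (ht : ∀ φ ∈ Ψ, Tame (weight ω φ))
    (herg : ∀ φ ∈ Ψ, ∀ ψ ∈ Ψ, ErgodicLimit P (density φ ψ) ω) :
    ∃ (σ : ℕ → ℕ) (w : Lp ℝ 2 (cubeEdge P)), StrictMono σ ∧
      ∀ v, IsTest v → ∀ φ ∈ Ψ, Tendsto (fun k => pairing ω (ε (σ k)) (U (σ k)) v φ) atTop
        (𝓝 (∫ q, w q * tens v φ q ∂(cubeEdge P))) := by
  have := isFiniteMeasure_edgeMeasure hmom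
  have : Fact ((2 : ℝ≥0∞) ≠ ∞) := ⟨by simp⟩
  have : SigmaFinite (cubeEdge P) := inferInstance
  have : SecondCountableTopology (Lp ℝ 2 (cubeEdge P)) := Lp.SecondCountableTopology
  -- the functionals are extended linearly to formal combinations of pairs of a test function and a
  -- field, whose norm is that of the corresponding combination of tensor products
  let ι := {v : Sp d → ℝ // IsTest v} × {φ // φ ∈ Ψ}
  have hT : ∀ i : ι, MemLp (tens i.1.1 i.2.1) 2 (cubeEdge P) := fun i =>
    memLp_tens (i.1.2.memLp_cube 2) (hcov _ i.2.2).memLp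
  let T : ι → Lp ℝ 2 (cubeEdge P) := fun i => (hT i).toLp _
  have hTT : ∀ i i' : ι, inner ℝ (T i) (T i') =
      covInner P i.2.1 i'.2.1 * ∫ x in cube d, i.1.1 x * i'.1.1 x := fun i i' => by
    rw [inner_toLp, integral_tens_mul_tens hmom hstat _ _ (hcov _ i.2.2) (hcov _ i'.2.2), mul_comm]
  obtain ⟨σ, w, hσ, hw⟩ := exists_weak_limit (Finsupp.linearCombination ℝ T)
    (fun k => Finsupp.linearCombination ℝ fun i : ι => pairing ω (ε k) (U k) i.1.1 i.2.1)
    (((C : ℝ) + 1) / 2) (fun c δ hδ => by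
      have := eventually_abs_sum_pairing_le (P := P) h0 hU c.support c
        (v := fun i : ι => i.1.1) (fun i => i.1.2) (φ := fun i => i.2.1)
        (fun i => hcov _ i.2.2) (fun i => ht _ i.2.2) (fun i i' => herg _ i.2.2 _ i'.2.2)
        (norm_nonneg (Finsupp.linearCombination ℝ T c)) (by
          rw [← real_inner_self_eq_norm_sq, Finsupp.linearCombination_apply, Finsupp.sum,
            sum_inner]
          refine Finset.sum_congr rfl fun i _ => ?_
          rw [inner_sum]
          refine Finset.sum_congr rfl fun i' _ => ?_
          rw [real_inner_smul_left, real_inner_smul_right, hTT]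
          ring) hδ
      simpa only [Finsupp.linearCombination_apply, Finsupp.sum, smul_eq_mul] using this)
  refine ⟨σ, w, hσ, fun v hv φ hφ => ?_⟩
  have h1 := hw (Finsupp.single (⟨⟨v, hv⟩, ⟨φ, hφ⟩⟩ : ι) 1)
  simp only [Finsupp.linearCombination_single, one_smul] at h1
  have h2 : inner ℝ w (T (⟨⟨v, hv⟩, ⟨φ, hφ⟩⟩ : ι)) = ∫ q, w q * tens v φ q ∂(cubeEdge P) := by
    have := inner_toLp (Lp.memLp w) (hT (⟨⟨v, hv⟩, ⟨φ, hφ⟩⟩ : ι))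
    rwa [Lp.toLp_coeFn] at this
  rwa [h2] at h1

/-! ### Weak compactness of the interpolations -/

theorem abs_interp_le {ε : ℝ} (hε : 0 < ε) {U : Lat d → ℝ} {K : ℝ} (hK : ∀ x, |U x| ≤ K)
    (x : Sp d) : |interp ε U x| ≤ K := by
  by_cases h : ∃ z, x ∈ cell ε z
  · obtain ⟨z, hz⟩ := h
    rw [interp_of_mem_cell hε hz]
    exact hK z
  · push Not at h
    simp only [interp, Set.indicator_of_notMem (h _), mul_zero, tsum_zero, abs_zero]
    exact (abs_nonneg _).trans (hK 0)

theorem interp_eq_zero {ε : ℝ} (hε : 0 < ε) {U : Lat d → ℝ} (hU : SuppInCube ε U) {x : Sp d}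
    {i : Fin d} (hx : 1 + ε ≤ |x i|) : interp ε U x = 0 := by
  rw [interp]
  refine (tsum_congr fun z => ?_).trans tsum_zero
  by_cases hz : x ∈ cell ε z
  · by_contra hne
    have h1 := hU z (fun h => hne (by rw [h, zero_mul])) i
    rw [scaled_apply] at h1
    have h2 := hz i
    rw [Set.mem_Ioc] at h2
    have h3 : |x i - ε * (z i : ℝ)| ≤ ε / 2 := abs_le.2 ⟨h2.1.le, h2.2⟩
    have h4 := abs_sub_abs_le_abs_sub (x i) (ε * (z i : ℝ))
    linarith
  · simp [hz]

theorem volume_abs_le_lt_top (r : ℝ) : volume {x : Sp d | ∀ i, |x i| ≤ r} < ∞ :=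
  (isBounded_abs_le r).measure_lt_top

theorem measurableSet_abs_le (r : ℝ) : MeasurableSet {x : Sp d | ∀ i, |x i| ≤ r} := by
  have : {x : Sp d | ∀ i, |x i| ≤ r} = ⋂ i, (fun x : Sp d => |x i|) ⁻¹' Set.Iic r := by
    ext x; simp
  rw [this]
  exact MeasurableSet.iInter fun i => (continuous_coord i).abs.measurable measurableSet_Iic

/-- The interpolations of functions bounded by `K` are dominated by a fixed function. -/
theorem abs_interp_le_indicator {ε : ℝ} (hε : 0 < ε) (hε1 : ε ≤ 1) {U : Lat d → ℝ}
    (hU : SuppInCube ε U) {K : ℝ} (hK : ∀ x, |U x| ≤ K) (x : Sp d) :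
    |interp ε U x| ≤ {x : Sp d | ∀ i, |x i| ≤ 2}.indicator (fun _ => K) x := by
  by_cases hx : x ∈ {x : Sp d | ∀ i, |x i| ≤ 2}
  · rw [Set.indicator_of_mem hx]
    exact abs_interp_le hε hK x
  · rw [Set.indicator_of_notMem hx]
    simp only [Set.mem_ofPred_eq, not_forall, not_le] at hx
    obtain ⟨i, hi⟩ := hx
    rw [interp_eq_zero hε hU (i := i) (by linarith), abs_zero]

theorem memLp_indicator_abs_le (K r : ℝ) (p : ℝ≥0∞) :
    MemLp ({x : Sp d | ∀ i, |x i| ≤ r}.indicator fun _ => K) p :=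
  memLp_indicator_const p (measurableSet_abs_le r) K (Or.inr (volume_abs_le_lt_top r).ne)

theorem memLp_interp {ε : ℝ} (hε : 0 < ε) (hε1 : ε ≤ 1) {U : Lat d → ℝ}
    (hU : SuppInCube ε U) {K : ℝ} (hK : ∀ x, |U x| ≤ K) (p : ℝ≥0∞) : MemLp (interp ε U) p :=
  (memLp_indicator_abs_le K 2 p).mono' (measurable_interp hε hU).aestronglyMeasurable
    (Eventually.of_forall (abs_interp_le_indicator hε hε1 hU hK))

/-- The interpolations are bounded in `L²`, since they are uniformly bounded and supported in a
fixed cube. -/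
theorem exists_weakL2_limit {ε : ℕ → ℝ} (hε : ∀ k, 0 < ε k ∧ ε k ≤ 1) {U : ℕ → Lat d → ℝ}
    (hU : ∀ k, SuppInCube (ε k) (U k)) {K : ℝ} (hK : ∀ k x, |U k x| ≤ K) :
    ∃ (σ : ℕ → ℕ) (u : Sp d → ℝ), StrictMono σ ∧ MemLp u 2 ∧
      WeakL2 (fun k => interp (ε (σ k)) (U (σ k))) u := by
  have hmem := fun k => memLp_interp (hε k).1 (hε k).2 (hU k) (hK k) 2
  have hD := memLp_indicator_abs_le (d := d) K 2 2
  have : Fact ((2 : ℝ≥0∞) ≠ ∞) := ⟨by simp⟩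
  obtain ⟨σ, w, hσ, hw⟩ := exists_weak_limit
    (LinearMap.id : Lp ℝ 2 (volume : Measure (Sp d)) →ₗ[ℝ] _)
    (fun k => ((innerSL ℝ ((hmem k).toLp _)) : Lp ℝ 2 (volume : Measure (Sp d)) →ₗ[ℝ] ℝ))
    ‖hD.toLp _‖ (fun g δ hδ => Eventually.of_forall fun k => by
      have h1 : ‖(hmem k).toLp _‖ ≤ ‖hD.toLp _‖ := by
        refine Lp.norm_le_norm_of_ae_le ?_
        filter_upwards [(hmem k).coeFn_toLp, hD.coeFn_toLp] with x hx1 hx2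
        rw [hx1, hx2]
        exact (abs_interp_le_indicator (hε k).1 (hε k).2 (hU k) (hK k) x).trans (le_abs_self _)
      have h2 := norm_inner_le_norm (𝕜 := ℝ) ((hmem k).toLp _) g
      have h3 := mul_le_mul_of_nonneg_right h1 (norm_nonneg g)
      change |inner ℝ ((hmem k).toLp _) g| ≤ _ * ‖g‖ + δ
      rw [Real.norm_eq_abs] at h2
      linarith)
  refine ⟨σ, w, hσ, Lp.memLp w, fun g hg => ?_⟩
  have h1 := hw (hg.toLp g)
  have h2 : inner ℝ w (hg.toLp g) = ∫ x, w x * g x := by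
    have := inner_toLp (Lp.memLp w) hg
    rwa [Lp.toLp_coeFn] at this
  change Tendsto (fun k => inner ℝ ((hmem (σ k)).toLp _) (hg.toLp g)) atTop
    (𝓝 (inner ℝ w (hg.toLp g))) at h1
  rw [h2] at h1
  exact h1.congr fun k => inner_toLp (hmem (σ k)) hg

theorem WeakL2.subseq {f : ℕ → Sp d → ℝ} {u : Sp d → ℝ} (h : WeakL2 f u) {σ : ℕ → ℕ}
    (hσ : StrictMono σ) : WeakL2 (fun k => f (σ k)) u := fun g hg =>
  (h g hg).comp hσ.tendsto_atTop

/-- The weak limit vanishes outside of the closed cube. -/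
theorem WeakL2.ae_eq_zero {ε : ℕ → ℝ} (hε : ∀ k, 0 < ε k) (h0 : Tendsto ε atTop (𝓝 0))
    {U : ℕ → Lat d → ℝ} (hU : ∀ k, SuppInCube (ε k) (U k)) {u : Sp d → ℝ} (hu : MemLp u 2)
    (h : WeakL2 (fun k => interp (ε k) (U k)) u) : ∀ᵐ x, (∃ i, 1 < |x i|) → u x = 0 := by
  have key : ∀ n : ℕ, ∀ i : Fin d, ∀ᵐ x, 1 + 1 / ((n : ℝ) + 1) ≤ |x i| → u x = 0 := by
    intro n i
    have hn : (0 : ℝ) < 1 / ((n : ℝ) + 1) := by positivity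
    obtain ⟨A, hAd⟩ : ∃ A : Set (Sp d), A = {x | 1 + 1 / ((n : ℝ) + 1) ≤ |x i|} := ⟨_, rfl⟩
    have hA : MeasurableSet A := by
      rw [hAd]; exact measurableSet_le measurable_const (continuous_coord i).abs.measurable
    -- test with the restriction of the weak limit itself to `A`
    have h1 := h _ (hu.indicator hA)
    have h2 : Tendsto (fun k => ∫ x, interp (ε k) (U k) x *
        A.indicator u x) atTop (𝓝 0) := by
      refine tendsto_const_nhds.congr' ?_
      filter_upwards [h0.eventually (gt_mem_nhds hn)] with k hk
      refine (integral_eq_zero_of_ae (Eventually.of_forall fun x => ?_)).symm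
      by_cases hx : x ∈ A
      · have : interp (ε k) (U k) x = 0 :=
          interp_eq_zero (hε k) (hU k) (i := i) (by
            rw [hAd, Set.mem_ofPred_eq] at hx; linarith)
        simp [this]
      · simp [hx]
    have h3 := tendsto_nhds_unique h1 h2
    have h4 : ∀ x, u x * A.indicator u x =
        A.indicator u x ^ 2 := fun x => by
      by_cases hx : x ∈ A <;> simp [hx, pow_two]
    simp_rw [h4] at h3
    rw [integral_eq_zero_iff_of_nonneg (fun x => sq_nonneg _) (hu.indicator hA).integrable_sq] at h3
    filter_upwards [h3] with x hx hxi
    have hx' : x ∈ A := by rw [hAd]; exact hxi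
    simpa [Set.indicator_of_mem hx'] using hx
  filter_upwards [ae_all_iff.2 fun n => ae_all_iff.2 (key n)] with x hx
  rintro ⟨i, hi⟩
  obtain ⟨n, hn⟩ := exists_nat_one_div_lt (sub_pos.2 hi)
  exact hx n i (by linarith)

/-! ### Structure of the two-scale limit -/

theorem sq_integral_mul_le {α : Type*} [MeasurableSpace α] {m : Measure α} {f g : α → ℝ}
    (hf : MemLp f 2 m) (hg : MemLp g 2 m) :
    (∫ a, f a * g a ∂m) ^ 2 ≤ (∫ a, f a ^ 2 ∂m) * ∫ a, g a ^ 2 ∂m := by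
  have h := real_inner_mul_inner_self_le (hf.toLp f) (hg.toLp g)
  rw [inner_toLp hf hg, inner_toLp hf hf, inner_toLp hg hg] at h
  simpa only [pow_two] using h

theorem integrable_mul_two {α : Type*} [MeasurableSpace α] {m : Measure α} {f g : α → ℝ}
    (hf : MemLp f 2 m) (hg : MemLp g 2 m) : Integrable (fun a => f a * g a) m :=
  hf.integrable_mul hg

theorem covInner_self [SFinite P] (hmom : UpperMoment P) (hstat : Stationary P) {φ : Field d}
    (hφ : MemCov P φ) : covInner P φ φ = (covNormSq P φ).toReal := by
  rw [covInner_eq_integral hmom hstat hφ.memLp hφ.memLp, covNormSq_eq_lintegral hφ.measurable,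
    ← integral_toReal]
  · refine integral_congr_ae (Eventually.of_forall fun p => ?_)
    dsimp only
    rw [ENNReal.toReal_ofReal (sq_nonneg _), pow_two]
  · exact ((measurable_uncurry hφ.measurable).pow_const 2).ennreal_ofReal.aemeasurable
  · exact Eventually.of_forall fun p => ENNReal.ofReal_lt_top

theorem memPot_zero (hmom : UpperMoment P) : MemPot P (0 : Field d) := by
  have : (0 : Field d) = grad fun _ => 0 := by
    funext ω z; simp [grad]
  rw [this]
  exact memPot_grad hmom isLocal_zero

/-- Integrating a square integrable function against a field yields a square integrable function
of the macroscopic variable. -/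
theorem memLp_integral_section {X Y : Type*} [MeasurableSpace X] [MeasurableSpace Y]
    {μ : Measure X} {ρ : Measure Y} [SFinite μ] [SFinite ρ] {w : X × Y → ℝ} {b : Y → ℝ}
    (hw : MemLp w 2 (μ.prod ρ)) (hb : MemLp b 2 ρ) :
    MemLp (fun x => ∫ y, w (x, y) * b y ∂ρ) 2 μ := by
  have hm : AEStronglyMeasurable (fun x => ∫ y, w (x, y) * b y ∂ρ) μ :=
    AEStronglyMeasurable.integral_prod_right' (f := fun q : X × Y => w q * b q.2)
      (hw.aestronglyMeasurable.mul hb.aestronglyMeasurable.comp_snd)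
  rw [memLp_two_iff_integrable_sq hm]
  have hsq := hw.integrable_sq
  refine (hsq.integral_prod_left.mul_const (∫ y, b y ^ 2 ∂ρ)).mono' (hm.pow 2) ?_
  filter_upwards [hsq.prod_right_ae, hw.aestronglyMeasurable.prodMk_left] with x h1 h2
  rw [Real.norm_of_nonneg (sq_nonneg _)]
  exact sq_integral_mul_le ((memLp_two_iff_integrable_sq h2).2 h1) hb

theorem integral_mul_tens [SFinite P] {w : Sp d × (Env d × Lat d) → ℝ}
    (hw : MemLp w 2 (cubeEdge P)) {v : Sp d → ℝ} (hv : MemLp v 2 (volume.restrict (cube d)))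
    {φ : Field d} (hφ : MemLp (fun p : Env d × Lat d => φ p.1 p.2) 2 (edgeMeasure P)) :
    ∫ q, w q * tens v φ q ∂(cubeEdge P) =
      ∫ x in cube d, v x * ∫ p, w (x, p) * φ p.1 p.2 ∂(edgeMeasure P) := by
  rw [integral_prod _ (integrable_mul_two hw (memLp_tens hv hφ))]
  refine integral_congr_ae (Eventually.of_forall fun x => ?_)
  simp only [tens]
  rw [← integral_const_mul]
  refine integral_congr_ae (Eventually.of_forall fun p => ?_)
  simp only
  ring

theorem integral_mul_tens_eq_covInner [SFinite P] (hmom : UpperMoment P) (hstat : Stationary P)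
    {F : Sp d → Field d} (hF : ∀ᵐ x ∂(volume.restrict (cube d)), MemCov P (F x))
    (hF2 : MemLp (fun q : Sp d × (Env d × Lat d) => F q.1 q.2.1 q.2.2) 2 (cubeEdge P))
    {v : Sp d → ℝ} (hv : MemLp v 2 (volume.restrict (cube d))) {φ : Field d} (hφ : MemCov P φ) :
    ∫ q, F q.1 q.2.1 q.2.2 * tens v φ q ∂(cubeEdge P) =
      ∫ x in cube d, v x * covInner P (F x) φ := by
  rw [integral_mul_tens (w := fun q => F q.1 q.2.1 q.2.2) hF2 hv hφ.memLp]
  refine integral_congr_ae ?_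
  filter_upwards [hF] with x hx
  rw [covInner_eq_integral hmom hstat hx.memLp hφ.memLp]

/-- The extension by zero of a square integrable field valued function on the cube belongs to the
Bochner space on `ℝ^d`. -/
theorem memBochner_extend [SFinite P] {X : Field d → Prop} (hX : X 0) {F : Sp d → Field d}
    (hFm : ∀ z, Measurable fun q : Sp d × Env d => F q.1 q.2 z)
    (hF : ∀ᵐ x ∂(volume.restrict (cube d)), X (F x))
    (hF2 : MemLp (fun q : Sp d × (Env d × Lat d) => F q.1 q.2.1 q.2.2) 2 (cubeEdge P))
    {F' : Sp d → Field d} (h1 : ∀ x ∈ cube d, F' x = F x) (h0 : ∀ x ∉ cube d, F' x = 0) :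
    MemBochner P X F' := by
  classical
  refine ⟨fun z => ?_, ?_, ?_⟩
  · have : (fun q : Sp d × Env d => F' q.1 q.2 z) =
        (Prod.fst ⁻¹' cube d).indicator fun q : Sp d × Env d => F q.1 q.2 z := by
      funext q
      by_cases hq : q.1 ∈ cube d
      · rw [Set.indicator_of_mem (by exact hq), h1 _ hq]
      · rw [Set.indicator_of_notMem (by exact hq), h0 _ hq]; rfl
    rw [this]
    exact (hFm z).indicator (measurable_fst measurableSet_cube)
  · rw [ae_restrict_iff' measurableSet_cube] at hF
    filter_upwards [hF] with x hx
    by_cases hq : x ∈ cube d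
    · rw [h1 x hq]; exact hx hq
    · rw [h0 x hq]; exact hX
  · have : (fun x => covNormSq P (F' x)) = (cube d).indicator fun x => covNormSq P (F x) := by
      funext x
      by_cases hq : x ∈ cube d
      · rw [Set.indicator_of_mem hq, h1 x hq]
      · rw [Set.indicator_of_notMem hq, h0 x hq]; simp [covNormSq]
    rw [this, lintegral_indicator measurableSet_cube, lintegral_covNormSq hFm]
    exact ENNReal.pow_lt_top hF2.2

/-- The projection of a function onto the closed span of the gradients, as a family of potential
fields. -/
theorem exists_potential_part [IsProbabilityMeasure P] (hmom : UpperMoment P)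
    (hstat : Stationary P) (hconn : ∀ᵐ ω ∂P, OpenConnected ω) {f : Sp d × (Env d × Lat d) → ℝ}
    (hf : MemLp f 2 (cubeEdge P)) :
    ∃ V : Sp d → Field d, (∀ z, Measurable fun q : Sp d × Env d => V q.1 q.2 z) ∧
      (∀ᵐ x ∂(volume.restrict (cube d)), MemPot P (V x)) ∧
      MemLp (fun q : Sp d × (Env d × Lat d) => V q.1 q.2.1 q.2.2) 2 (cubeEdge P) ∧
      ∀ v, IsTest v → ∀ g, IsLocal g →
        ∫ q, (f q - V q.1 q.2.1 q.2.2) * tens v (grad g) q ∂(cubeEdge P) = 0 := by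
  let K := (gradSpace (volume.restrict (cube d)) P).topologicalClosure
  obtain ⟨V, hVm, -, hV, hpot, -⟩ := exists_memPot_of_mem_closure hstat hconn
    (K.starProjection_apply_mem (hf.toLp f))
  refine ⟨V, hVm, hpot, (Lp.memLp _).ae_eq hV, fun v hv g hg => ?_⟩
  have hT := memLp_tens (hv.memLp_cube 2) (memCov_grad hmom hg).memLp
  have hmem : hT.toLp _ ∈ K := by
    refine Submodule.le_topologicalClosure _ ⟨fun x ω => v x * g ω, fun x => hg.const_mul _,
      (hv.1.continuous.measurable.comp measurable_fst).mul (hg.measurable.comp measurable_snd), ?_⟩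
    filter_upwards [hT.coeFn_toLp] with q hq
    rw [hq]
    simp only [tens, grad]
    ring
  have h0 := (Submodule.mem_orthogonal _ _).1
    (K.sub_starProjection_mem_orthogonal (hf.toLp f)) _ hmem
  rw [L2.inner_def] at h0
  rw [← h0]
  refine integral_congr_ae ?_
  filter_upwards [hT.coeFn_toLp, hf.coeFn_toLp, hV,
    Lp.coeFn_sub (hf.toLp f) (K.starProjection (hf.toLp f))] with q h1 h2 h3 h4
  rw [h4]
  simp only [Pi.sub_apply, h1, h2, h3]
  simp

/-- Orthogonality to products with a test function passes to limits of fields in `L²_cov`. -/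
theorem integral_mul_tens_eq_zero_of_approx [SFinite P] (hmom : UpperMoment P)
    (hstat : Stationary P) {R : Sp d × (Env d × Lat d) → ℝ} (hR : MemLp R 2 (cubeEdge P))
    {v : Sp d → ℝ} (hv : MemLp v 2 (volume.restrict (cube d))) {φ : Field d} (hφ : MemCov P φ)
    (h : ∀ δ : ℝ≥0∞, 0 < δ → ∃ ψ, MemCov P ψ ∧ covNormSq P (φ - ψ) < δ ∧
      ∫ q, R q * tens v ψ q ∂(cubeEdge P) = 0) : ∫ q, R q * tens v φ q ∂(cubeEdge P) = 0 := by
  obtain ⟨A, hA⟩ : ∃ A, A = (∫ q, R q ^ 2 ∂(cubeEdge P)) * ∫ x in cube d, v x * v x := ⟨_, rfl⟩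
  have hA0 : 0 ≤ A := by
    rw [hA]
    exact mul_nonneg (integral_nonneg fun _ => sq_nonneg _)
      (integral_nonneg fun _ => mul_self_nonneg _)
  have hle : ∀ δ : ℝ, 0 < δ → (∫ q, R q * tens v φ q ∂(cubeEdge P)) ^ 2 ≤ 0 + δ := by
    intro δ hδ
    obtain ⟨ψ, hψ, hd, h0⟩ := h (ENNReal.ofReal (δ / (A + 1))) (by positivity)
    have hsub := hφ.sub hψ
    have e : ∫ q, R q * tens v φ q ∂(cubeEdge P) =
        ∫ q, R q * tens v (φ - ψ) q ∂(cubeEdge P) := by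
      rw [← sub_zero (∫ q, R q * tens v φ q ∂(cubeEdge P)), ← h0, ← integral_sub
        (integrable_mul_two hR (memLp_tens hv hφ.memLp))
        (integrable_mul_two hR (memLp_tens hv hψ.memLp))]
      refine integral_congr_ae (Eventually.of_forall fun q => ?_)
      simp only [tens, Pi.sub_apply]
      ring
    have h2 : (covNormSq P (φ - ψ)).toReal ≤ δ / (A + 1) :=
      ENNReal.toReal_le_of_le_ofReal (by positivity) hd.le
    rw [e, zero_add]
    calc (∫ q, R q * tens v (φ - ψ) q ∂(cubeEdge P)) ^ 2
        ≤ (∫ q, R q ^ 2 ∂(cubeEdge P)) * ∫ q, tens v (φ - ψ) q ^ 2 ∂(cubeEdge P) :=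
          sq_integral_mul_le hR (memLp_tens hv hsub.memLp)
      _ = A * (covNormSq P (φ - ψ)).toReal := by
          simp_rw [pow_two (tens v (φ - ψ) _)]
          rw [integral_tens_mul_tens hmom hstat _ _ hsub hsub, covInner_self hmom hstat hsub, hA,
            mul_assoc]
      _ ≤ A * (δ / (A + 1)) := by gcongr
      _ = A / (A + 1) * δ := by ring
      _ ≤ δ := by
          refine mul_le_of_le_one_left hδ.le ?_
          rw [div_le_one (by positivity)]
          linarith
  have := le_of_forall_pos_le_add hle
  exact pow_eq_zero_iff two_ne_zero |>.1 (le_antisymm this (sq_nonneg _))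

theorem integral_mul_tens_eq_zero_of_span
    {R : Sp d × (Env d × Lat d) → ℝ} (hR : MemLp R 2 (cubeEdge P))
    {v : Sp d → ℝ} (hv : MemLp v 2 (volume.restrict (cube d))) {Ψ : Set (Field d)}
    (hΨ : ∀ ψ ∈ Ψ, MemCov P ψ ∧ ∫ q, R q * tens v ψ q ∂(cubeEdge P) = 0) {φ : Field d}
    (hφ : φ ∈ Submodule.span ℝ Ψ) :
    MemCov P φ ∧ ∫ q, R q * tens v φ q ∂(cubeEdge P) = 0 := by
  induction hφ using Submodule.span_induction with
  | mem φ h => exact hΨ φ h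
  | zero =>
    refine ⟨memCov_zero, ?_⟩
    simp [tens]
  | add φ ψ _ _ h1 h2 =>
    refine ⟨h1.1.add h2.1, ?_⟩
    rw [← add_zero (0 : ℝ)]
    nth_rw 1 [← h1.2]
    rw [← h2.2, ← integral_add (integrable_mul_two hR (memLp_tens hv h1.1.memLp))
      (integrable_mul_two hR (memLp_tens hv h2.1.memLp))]
    refine integral_congr_ae (Eventually.of_forall fun q => ?_)
    simp only [tens, Pi.add_apply]
    ring
  | smul c φ _ h1 =>
    refine ⟨h1.1.smul c, ?_⟩
    rw [← mul_zero c, ← h1.2, ← integral_const_mul]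
    refine integral_congr_ae (Eventually.of_forall fun q => ?_)
    simp only [tens, Pi.smul_apply, smul_eq_mul]
    ring

/-- A function orthogonal to the products of test functions with gradients and with the solenoidal
test fields is orthogonal to the products with all square integrable covariant fields. -/
theorem integral_mul_tens_eq_zero [IsProbabilityMeasure P] (hmom : UpperMoment P)
    (hstat : Stationary P) (hconn : ∀ᵐ ω ∂P, OpenConnected ω) {Φsol Φpot : Set (Field d)}
    (hΦ : IsTestFamily P Φsol Φpot) {R : Sp d × (Env d × Lat d) → ℝ} (hR : MemLp R 2 (cubeEdge P))
    {v : Sp d → ℝ} (hv : MemLp v 2 (volume.restrict (cube d)))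
    (hpot : ∀ g, IsLocal g → ∫ q, R q * tens v (grad g) q ∂(cubeEdge P) = 0)
    (hsol : ∀ b ∈ Φsol, ∫ q, R q * tens v b q ∂(cubeEdge P) = 0) {φ : Field d}
    (hφ : MemCov P φ) : ∫ q, R q * tens v φ q ∂(cubeEdge P) = 0 := by
  obtain ⟨p, s, hp, hs, rfl⟩ := exists_memPot_add_memSol hmom hstat hconn hφ
  have h1 : ∫ q, R q * tens v p q ∂(cubeEdge P) = 0 :=
    integral_mul_tens_eq_zero_of_approx hmom hstat hR hv hp.1 fun δ hδ => by
      obtain ⟨g, hg, hd⟩ := hp.2 δ hδ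
      exact ⟨grad g, memCov_grad hmom hg, hd, hpot g hg⟩
  have h2 : ∫ q, R q * tens v s q ∂(cubeEdge P) = 0 :=
    integral_mul_tens_eq_zero_of_approx hmom hstat hR hv hs.1 fun δ hδ => by
      obtain ⟨b, hb, hd⟩ := hΦ.sol_dense s hs δ hδ
      obtain ⟨h3, h4⟩ := integral_mul_tens_eq_zero_of_span hR hv
        (fun b hb => ⟨(hΦ.sol_mem b hb).1, hsol b hb⟩) hb
      exact ⟨b, h3, hd, h4⟩
  rw [← add_zero (0 : ℝ)]
  nth_rw 1 [← h1]
  rw [← h2, ← integral_add (integrable_mul_two hR (memLp_tens hv hp.1.memLp))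
    (integrable_mul_two hR (memLp_tens hv hs.1.memLp))]
  refine integral_congr_ae (Eventually.of_forall fun q => ?_)
  simp only [tens, Pi.add_apply]
  ring

theorem setIntegral_eq_of_extend {F F' : Sp d → Field d} (h1 : ∀ x ∈ cube d, F' x = F x)
    (h0 : ∀ x ∉ cube d, F' x = 0) (v : Sp d → ℝ) (φ : Field d) :
    ∫ x in cube d, v x * covInner P (F x) φ = ∫ x, v x * covInner P (F' x) φ := by
  rw [← integral_indicator measurableSet_cube]
  refine integral_congr_ae (Eventually.of_forall fun x => ?_)
  by_cases hx : x ∈ cube d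
  · simp only [Set.indicator_of_mem hx, h1 x hx]
  · simp only [Set.indicator_of_notMem hx, h0 x hx]
    simp [covInner, density]

/-- A function `w` whose products with solenoidal fields are weak derivatives of `u` is of the form
`G(x) · z + V(x, ω, z)`, up to a part which is not seen by covariant fields, where `G` is the weak
gradient of `u` and `V` is potential. -/
theorem exists_gradient_decomposition [IsProbabilityMeasure P] (hmom : UpperMoment P)
    (hstat : Stationary P) {l : ℕ} {ν : Env d → ℝ≥0∞} (hν : IsResistance P l ν)
    {Φsol Φpot : Set (Field d)} (hΦ : IsTestFamily P Φsol Φpot)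
    (w : Lp ℝ 2 (cubeEdge P)) (u : Sp d → ℝ)
    (hsol : ∀ v, IsTest v → ∀ b ∈ Φsol, ∫ q, w q * tens v b q ∂(cubeEdge P) =
      -∑ j, covInner P (coordField j) b * ∫ x, u x * pderiv j v x) :
    ∃ (G : Sp d → Sp d) (V : Sp d → Field d), MemLp G 2 ∧ (∀ x ∉ cube d, G x = 0) ∧
      (∀ v, IsTest v → ∀ i, ∫ x, u x * pderiv i v x = -∫ x, G x i * v x) ∧
      MemBochner P (MemPot P) V ∧
      MemBochner P (MemCov P) (fun x ω z => (∑ i, G x i * (z i : ℝ)) + V x ω z) ∧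
      ∀ v, IsTest v → ∀ φ, MemCov P φ → ∫ q, w q * tens v φ q ∂(cubeEdge P) =
        ∫ x, v x * covInner P (fun ω z => (∑ i, G x i * (z i : ℝ)) + V x ω z) φ := by
  classical
  have hconn := ae_connected hν hstat
  have hcoord := memCov_coordField hmom (P := P)
  choose c hcs hc using exists_dual_combination hmom hstat hν hΦ
  have hwm := Lp.stronglyMeasurable w
  have hw := Lp.memLp w
  -- the gradient, as a combination of the pairings with solenoidal fields
  let g : Fin d → Sp d → ℝ := fun i x =>
    ∑ b ∈ (c i).support, c i b * ∫ p, w (x, p) * b p.1 p.2 ∂(edgeMeasure P)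
  have hbL : ∀ i, ∀ b ∈ (c i).support, MemCov P b := fun i b hb =>
    (hΦ.sol_mem b (hcs i hb)).1
  have hgm : ∀ i, Measurable (g i) := fun i => by
    refine Finset.measurable_sum _ fun b hb => Measurable.const_mul ?_ _
    exact (StronglyMeasurable.integral_prod_right' (f := fun q : Sp d × (Env d × Lat d) =>
      w q * b q.2.1 q.2.2) (hwm.mul ((measurable_uncurry
        (hbL i b hb).measurable).comp measurable_snd).stronglyMeasurable)).measurable
  have hg2 : ∀ i, MemLp (g i) 2 (volume.restrict (cube d)) := fun i =>
    memLp_finsetSum _ fun b hb =>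
      (memLp_integral_section (b := fun p : Env d × Lat d => b p.1 p.2) hw
        (hbL i b hb).memLp).const_mul _
  have hgv : ∀ v, IsTest v → ∀ i, ∫ x, u x * pderiv i v x = -∫ x in cube d, g i x * v x := by
    intro v hv i
    have h1 : ∫ x in cube d, g i x * v x =
        ∑ b ∈ (c i).support, c i b * ∫ q, w q * tens v b q ∂(cubeEdge P) := by
      have hint : ∀ b ∈ (c i).support, Integrable (fun x => c i b *
          (v x * ∫ p, w (x, p) * b p.1 p.2 ∂(edgeMeasure P))) (volume.restrict (cube d)) :=
        fun b hb => (integrable_mul_two (hv.memLp_cube 2) (memLp_integral_section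
          (b := fun p : Env d × Lat d => b p.1 p.2) hw (hbL i b hb).memLp)).const_mul _
      have e : ∀ x, g i x * v x = ∑ b ∈ (c i).support, c i b *
          (v x * ∫ p, w (x, p) * b p.1 p.2 ∂(edgeMeasure P)) := fun x => by
        simp only [g]
        rw [Finset.sum_mul]
        exact Finset.sum_congr rfl fun b _ => by ring
      simp_rw [e]
      rw [integral_finsetSum _ hint]
      refine Finset.sum_congr rfl fun b hb => ?_
      rw [integral_const_mul, integral_mul_tens hw (hv.memLp_cube 2) (hbL i b hb).memLp]
    rw [h1]
    have h2 : ∑ b ∈ (c i).support, c i b * ∫ q, w q * tens v b q ∂(cubeEdge P) =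
        -∑ j, ((c i).sum fun b r => r * covInner P (coordField j) b) *
          ∫ x, u x * pderiv j v x := by
      simp only [Finsupp.sum, Finset.sum_mul]
      rw [Finset.sum_comm, ← Finset.sum_neg_distrib]
      refine Finset.sum_congr rfl fun b hb => ?_
      rw [hsol v hv b (hcs i hb), mul_neg, Finset.mul_sum]
      congr 1
      exact Finset.sum_congr rfl fun j _ => by ring
    rw [h2]
    simp only [hc]
    simp
  -- the potential part
  let Gz : Sp d × (Env d × Lat d) → ℝ := fun q => ∑ i, tens (g i) (coordField i) q
  have hGz : MemLp Gz 2 (cubeEdge P) :=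
    memLp_finsetSum _ fun i _ => memLp_tens (hg2 i) (hcoord i).memLp
  obtain ⟨V, hVm, hVp, hV2, hVo⟩ := exists_potential_part hmom hstat hconn (hw.sub hGz)
  let F : Sp d → Field d := fun x ω z => (∑ i, g i x * (z i : ℝ)) + V x ω z
  have hFm : ∀ z, Measurable fun q : Sp d × Env d => F q.1 q.2 z := fun z =>
    (Finset.measurable_sum _ fun i _ => ((hgm i).comp measurable_fst).mul_const _).add (hVm z)
  have hF2 : MemLp (fun q : Sp d × (Env d × Lat d) => F q.1 q.2.1 q.2.2) 2 (cubeEdge P) :=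
    hGz.add hV2
  have hFc : ∀ᵐ x ∂(volume.restrict (cube d)), MemCov P (F x) := by
    filter_upwards [hVp] with x hx
    exact (memCov_linField hmom fun i => g i x).add hx.1
  -- the remainder is orthogonal to all covariant fields
  have hR : MemLp (fun q : Sp d × (Env d × Lat d) => w q - Gz q - V q.1 q.2.1 q.2.2) 2
      (cubeEdge P) := (hw.sub hGz).sub hV2
  have hR0 : ∀ v, IsTest v → ∀ φ, MemCov P φ →
      ∫ q, (w q - Gz q - V q.1 q.2.1 q.2.2) * tens v φ q ∂(cubeEdge P) = 0 := by
    intro v hv φ hφ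
    have hv2 := hv.memLp_cube 2
    refine integral_mul_tens_eq_zero hmom hstat hconn hΦ hR hv2 (hVo v hv) (fun b hb => ?_) hφ
    have hbS := hΦ.sol_mem b hb
    have hbT := memLp_tens hv2 hbS.1.memLp
    have h1 : ∫ q, V q.1 q.2.1 q.2.2 * tens v b q ∂(cubeEdge P) = 0 := by
      rw [integral_mul_tens_eq_covInner hmom hstat (hVp.mono fun x hx => hx.1) hV2 hv2 hbS.1]
      refine integral_eq_zero_of_ae ?_
      filter_upwards [hVp] with x hx
      have : covInner P (V x) b = covInner P b (V x) := by
        simp only [covInner, density, mul_comm]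
      rw [this, hbS.2 _ hx, mul_zero, Pi.zero_apply]
    have h2 : ∫ q, Gz q * tens v b q ∂(cubeEdge P) = ∫ q, w q * tens v b q ∂(cubeEdge P) := by
      simp only [Gz, Finset.sum_mul]
      rw [integral_finsetSum _ fun i _ =>
        integrable_mul_two (memLp_tens (hg2 i) (hcoord i).memLp) hbT, hsol v hv b hb,
        ← Finset.sum_neg_distrib]
      refine Finset.sum_congr rfl fun i _ => ?_
      rw [integral_tens_mul_tens hmom hstat _ _ (hcoord i) hbS.1, hgv v hv i]
      ring
    have e : ∀ q, (w q - Gz q - V q.1 q.2.1 q.2.2) * tens v b q =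
        w q * tens v b q - Gz q * tens v b q - V q.1 q.2.1 q.2.2 * tens v b q := fun q => by ring
    simp_rw [e]
    have hi : Integrable (fun q => w q * tens v b q - Gz q * tens v b q) (cubeEdge P) :=
      (integrable_mul_two hw hbT).sub (integrable_mul_two hGz hbT)
    rw [integral_sub hi (integrable_mul_two hV2 hbT),
      integral_sub (integrable_mul_two hw hbT) (integrable_mul_two hGz hbT),
      h1, h2]
    ring
  -- extension by zero to `ℝ^d`
  let G : Sp d → Sp d := fun x => if x ∈ cube d then WithLp.toLp 2 fun i => g i x else 0
  let V' : Sp d → Field d := fun x => if x ∈ cube d then V x else 0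
  have hG1 : ∀ x ∈ cube d, ∀ i, G x i = g i x := fun x hx i => by simp [G, hx]
  have hG0 : ∀ x ∉ cube d, G x = 0 := fun x hx => by simp [G, hx]
  have hF1 : ∀ x ∈ cube d, (fun (ω : Env d) (z : Lat d) => (∑ i, G x i * (z i : ℝ)) + V' x ω z) =
      F x := fun x hx => by
    funext ω z
    simp only [hG1 x hx, F, V', if_pos hx]
  have hF0 : ∀ x ∉ cube d, (fun (ω : Env d) (z : Lat d) => (∑ i, G x i * (z i : ℝ)) + V' x ω z) =
      0 := fun x hx => by
    funext ω z
    simp [hG0 x hx, V', if_neg hx]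
  refine ⟨G, V', ?_, hG0, fun v hv i => ?_, ?_, ?_, fun v hv φ hφ => ?_⟩
  · refine MemLp.of_eval_piLp fun i => ?_
    have : (fun x => G x i) = (cube d).indicator (g i) := by
      funext x
      by_cases hx : x ∈ cube d
      · rw [Set.indicator_of_mem hx, hG1 x hx]
      · rw [Set.indicator_of_notMem hx, hG0 x hx]; rfl
    rw [this]
    exact (memLp_indicator_iff_restrict measurableSet_cube).2 (hg2 i)
  · rw [hgv v hv i, ← integral_indicator measurableSet_cube]
    congr 1
    refine integral_congr_ae (Eventually.of_forall fun x => ?_)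
    by_cases hx : x ∈ cube d
    · simp only [Set.indicator_of_mem hx, hG1 x hx]
    · simp only [Set.indicator_of_notMem hx, hG0 x hx]; simp
  · exact memBochner_extend (memPot_zero hmom) hVm hVp hV2 (fun x hx => if_pos hx)
      fun x hx => if_neg hx
  · exact memBochner_extend memCov_zero hFm hFc hF2 hF1 hF0
  · have hφT := memLp_tens (hv.memLp_cube 2) hφ.memLp
    rw [← setIntegral_eq_of_extend hF1 hF0, ← integral_mul_tens_eq_covInner hmom hstat hFc hF2
      (hv.memLp_cube 2) hφ, ← sub_eq_zero, ← integral_sub (integrable_mul_two hw hφT)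
      (integrable_mul_two hF2 hφT), ← hR0 v hv φ hφ]
    refine integral_congr_ae (Eventually.of_forall fun q => ?_)
    simp only [F, Gz, tens, coordField]
    ring

/-! ### Dilations and mollifications in `L²` -/

theorem map_smul_sub {κ : ℝ} (hκ : κ ≠ 0) (y : Sp d) :
    Measure.map (fun x : Sp d => κ • x - y) volume = ENNReal.ofReal |(κ ^ d)⁻¹| • volume := by
  have h : (fun x : Sp d => κ • x - y) = (fun x => x - y) ∘ fun x => κ • x := rfl
  rw [h, ← Measure.map_map (measurable_sub_const y) (measurable_const_smul κ),
    Measure.map_addHaar_smul volume hκ, Measure.map_smul]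
  simp [map_sub_right_eq_self]

/-- Dilations by a factor of at least one half and translations are bounded on `L²`; the constant is
not optimal. -/
theorem eLpNorm_comp_affine_le {E : Type*} [NormedAddCommGroup E] {h : Sp d → E}
    (hh : AEStronglyMeasurable h volume) {κ : ℝ} (hκ : 1 / 2 ≤ κ) (y : Sp d) :
    eLpNorm (fun x => h (κ • x - y)) 2 volume ≤ 2 ^ d * eLpNorm h 2 volume := by
  have h0 : 0 < κ := by linarith
  have hm := map_smul_sub h0.ne' y
  have h1 : AEStronglyMeasurable h (Measure.map (fun x : Sp d => κ • x - y) volume) := by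
    rw [hm]; exact hh.mono_ac Measure.smul_absolutelyContinuous
  have hT : Measurable fun x : Sp d => κ • x - y := (measurable_const_smul κ).sub_const y
  have h2 := eLpNorm_map_measure (p := 2) h1 hT.aemeasurable
  rw [hm, eLpNorm_smul_measure_of_ne_top (by simp)] at h2
  change eLpNorm (h ∘ fun x => κ • x - y) 2 volume ≤ _
  rw [← h2, smul_eq_mul]
  gcongr
  have h3 : ENNReal.ofReal |(κ ^ d)⁻¹| ≤ 2 ^ d := by
    rw [abs_of_nonneg (by positivity)]
    refine (ENNReal.ofReal_le_ofReal (q := 2 ^ d) ?_).trans_eq (by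
      rw [ENNReal.ofReal_pow (by norm_num)]; simp)
    rw [← inv_pow]
    refine pow_le_pow_left₀ (by positivity) ?_ d
    rw [inv_le_comm₀ h0 (by norm_num)]
    linarith
  have h4 : (1 : ℝ≥0∞) ≤ 2 ^ d := one_le_pow₀ (by norm_num)
  calc ENNReal.ofReal |(κ ^ d)⁻¹| ^ (1 / (2 : ℝ≥0∞)).toReal
      ≤ ((2 : ℝ≥0∞) ^ d) ^ (1 / (2 : ℝ≥0∞)).toReal := by gcongr
    _ ≤ ((2 : ℝ≥0∞) ^ d) ^ (1 : ℝ) := by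
        refine ENNReal.rpow_le_rpow_of_exponent_le h4 ?_
        norm_num
    _ = 2 ^ d := ENNReal.rpow_one _

theorem memLp_comp_affine {E : Type*} [NormedAddCommGroup E] {h : Sp d → E}
    (hh : MemLp h 2 volume) {κ : ℝ} (hκ : 1 / 2 ≤ κ) (y : Sp d) :
    MemLp (fun x => h (κ • x - y)) 2 volume := by
  have h0 : 0 < κ := by linarith
  have hT : Measurable fun x : Sp d => κ • x - y := (measurable_const_smul κ).sub_const y
  refine ⟨AEStronglyMeasurable.comp_measurable (f := fun x : Sp d => κ • x - y) ?_ hT,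
    (eLpNorm_comp_affine_le hh.1 hκ y).trans_lt ?_⟩
  · rw [map_smul_sub h0.ne' y]
    exact hh.1.mono_ac Measure.smul_absolutelyContinuous
  · exact ENNReal.mul_lt_top (by simp) hh.2

/-- Continuity at the identity of the action of dilations and translations on `L²`. -/
theorem exists_eLpNorm_comp_affine_sub_le {h : Sp d → ℝ} (hh : MemLp h 2 volume) {δ : ℝ≥0∞}
    (hδ : δ ≠ 0) : ∃ s₀ : ℝ, 0 < s₀ ∧ ∀ (κ : ℝ) (y : Sp d), |κ - 1| ≤ s₀ → ‖y‖ ≤ s₀ →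
      eLpNorm (fun x => h (κ • x - y) - h x) 2 volume ≤ δ := by
  obtain ⟨a, ha, haδ⟩ := ENNReal.exists_nnreal_pos_mul_lt (a := 2 ^ d + 1 + 1) (by simp) hδ
  have ha0 : (a : ℝ≥0∞) ≠ 0 := by exact_mod_cast ha.ne'
  -- approximate by a continuous function of compact support, which is uniformly continuous
  obtain ⟨g, hgs, hga, hgc, hg2⟩ := hh.exists_hasCompactSupport_eLpNorm_sub_le (by simp) ha0
  obtain ⟨R, hR0, hR⟩ : ∃ R : ℝ, 0 < R ∧ ∀ x, R < ‖x‖ → g x = 0 := by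
    obtain ⟨R, hR⟩ := hgs.isCompact.isBounded.exists_norm_le
    refine ⟨max R 1, by positivity, fun x hx => ?_⟩
    by_contra h
    exact absurd (hR x (subset_tsupport g h)) (not_le.2 ((le_max_left _ _).trans_lt hx))
  -- contains the supports of `g` and of its small dilations and translations
  let B := Metric.closedBall (0 : Sp d) (2 * R + 2)
  have hB : volume B < ∞ := measure_closedBall_lt_top
  obtain ⟨c, hc, hcB⟩ := ENNReal.exists_nnreal_pos_mul_lt
    (a := volume B ^ (1 / (2 : ℝ≥0∞).toReal)) (ENNReal.rpow_ne_top_of_nonneg (by simp) hB.ne) ha0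
  obtain ⟨r, hr, hgr⟩ := Metric.uniformContinuous_iff.1
    (hgs.uniformContinuous_of_continuous hgc) c hc
  refine ⟨min (1 / 2) (r / (2 * (2 * R + 3))), by positivity, fun κ y hκ hy => ?_⟩
  have hκ1 := hκ.trans (min_le_left _ _)
  have hκ2 := hκ.trans (min_le_right _ _)
  have hy1 := hy.trans (min_le_left _ _)
  have hy2 := hy.trans (min_le_right _ _)
  have hκh : 1 / 2 ≤ κ := by
    have := (abs_le.1 hκ1).1
    linarith
  have hmid : eLpNorm (fun x => g (κ • x - y) - g x) 2 volume ≤ a := by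
    refine le_trans ?_ hcB.le
    have h1 : ∀ x, ‖g (κ • x - y) - g x‖ ≤ ‖B.indicator (fun _ => (c : ℝ)) x‖ := by
      intro x
      by_cases hx : x ∈ B
      · rw [Set.indicator_of_mem hx, Real.norm_of_nonneg c.coe_nonneg, ← dist_eq_norm]
        refine (hgr ?_).le
        have hxn : ‖x‖ ≤ 2 * R + 2 := by simpa [B] using hx
        have e : κ • x - y - x = (κ - 1) • x - y := by rw [sub_smul, one_smul]; abel
        rw [dist_eq_norm, e]
        calc ‖(κ - 1) • x - y‖ ≤ |κ - 1| * ‖x‖ + ‖y‖ := by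
              refine (norm_sub_le _ _).trans_eq ?_
              rw [norm_smul, Real.norm_eq_abs]
          _ ≤ r / (2 * (2 * R + 3)) * (2 * R + 2) + r / (2 * (2 * R + 3)) := by gcongr
          _ = r / 2 := by field_simp; ring
          _ < r := by linarith
      · have hxn : 2 * R + 2 < ‖x‖ := by simpa [B] using hx
        have h2 : R < ‖κ • x - y‖ := by
          have h3 := norm_sub_norm_le (κ • x) y
          rw [norm_smul, Real.norm_of_nonneg (by linarith)] at h3
          have h4 : 1 / 2 * ‖x‖ ≤ κ * ‖x‖ := by gcongr
          linarith
        rw [hR _ h2, hR x (by linarith)]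
        simp
    refine (eLpNorm_mono h1).trans_eq ?_
    rw [eLpNorm_indicator_const Metric.isClosed_closedBall.measurableSet (by simp) (by simp)]
    congr 1
    simp
  have hhg := hh.sub hg2
  have e : (fun x => h (κ • x - y) - h x) =
      (fun x => (h - g) (κ • x - y)) + (fun x => g (κ • x - y) - g x) - (h - g) := by
    funext x
    simp only [Pi.sub_apply, Pi.add_apply]
    ring
  have m1 := memLp_comp_affine hhg hκh y
  have m2 : MemLp (fun x => g (κ • x - y) - g x) 2 volume := (memLp_comp_affine hg2 hκh y).sub hg2
  rw [e]
  calc _ ≤ eLpNorm ((fun x => (h - g) (κ • x - y)) + (fun x => g (κ • x - y) - g x)) 2 volume +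
        eLpNorm (h - g) 2 volume := eLpNorm_sub_le (m1.add m2).1 hhg.1 (by simp)
    _ ≤ 2 ^ d * a + a + a := by
        gcongr
        refine (eLpNorm_add_le m1.1 m2.1 (by simp)).trans ?_
        gcongr
        exact (eLpNorm_comp_affine_le hhg.1 hκh y).trans (by gcongr)
    _ = a * (2 ^ d + 1 + 1) := by ring
    _ ≤ δ := haδ.le

/-- An average of functions of `L²`-norm at most `B` has `L²`-norm at most `B`. -/
theorem eLpNorm_integral_le {X Y : Type*} [MeasurableSpace X] [MeasurableSpace Y] {μ : Measure X}
    [SFinite μ] {π : Measure Y} [IsProbabilityMeasure π] {g : X → Y → ℝ}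
    (hg : Measurable (Function.uncurry g)) {B : ℝ≥0∞}
    (hB : ∀ᵐ y ∂π, eLpNorm (fun x => g x y) 2 μ ≤ B) :
    eLpNorm (fun x => ∫ y, g x y ∂π) 2 μ ≤ B := by
  -- Jensen's inequality for the square
  have h1 : ∀ x, ‖∫ y, g x y ∂π‖ₑ ^ (2 : ℝ) ≤ ∫⁻ y, ‖g x y‖ₑ ^ (2 : ℝ) ∂π := fun x => by
    have hm : Measurable (g x) := hg.of_uncurry_left
    have h2 := eLpNorm_le_eLpNorm_of_exponent_le (p := 1) (q := 2) (by norm_num)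
      (hm.aestronglyMeasurable (μ := π))
    rw [eLpNorm_one_eq_lintegral_enorm] at h2
    have h3 := (enorm_integral_le_lintegral_enorm (μ := π) (g x)).trans h2
    calc ‖∫ y, g x y ∂π‖ₑ ^ (2 : ℝ) ≤ eLpNorm (g x) 2 π ^ (2 : ℝ) := by gcongr
      _ = ∫⁻ y, ‖g x y‖ₑ ^ (2 : ℝ) ∂π := by
        rw [ENNReal.rpow_ofNat, eLpNorm_two_sq]
        simp_rw [ofReal_sq_eq]
  have h4 : eLpNorm (fun x => ∫ y, g x y ∂π) 2 μ ^ 2 ≤ B ^ 2 := by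
    rw [eLpNorm_two_sq]
    simp_rw [ofReal_sq_eq]
    refine (lintegral_mono h1).trans ?_
    have hm2 : Measurable (Function.uncurry fun x y => ‖g x y‖ₑ ^ (2 : ℝ)) :=
      hg.enorm.pow_const _
    rw [lintegral_lintegral_swap hm2.aemeasurable]
    calc ∫⁻ y, ∫⁻ x, ‖g x y‖ₑ ^ (2 : ℝ) ∂μ ∂π ≤ ∫⁻ _, B ^ 2 ∂π := by
          refine lintegral_mono_ae (hB.mono fun y hy => ?_)
          simp_rw [← ofReal_sq_eq]
          rw [← eLpNorm_two_sq]
          gcongr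
      _ = B ^ 2 := by simp
  exact (ENNReal.pow_le_pow_left_iff two_ne_zero).1 h4

/-! ### Functions with a weak gradient in `L²` that vanish outside the cube -/

/-- The convolution of `h` with the kernel `η`. -/
def mollify (η h : Sp d → ℝ) : Sp d → ℝ :=
  convolution h η (ContinuousLinearMap.mul ℝ ℝ) volume

theorem mollify_apply (η h : Sp d → ℝ) (x : Sp d) : mollify η h x = ∫ t, h (x - t) * η t :=
  convolution_mul_swap

theorem contDiff_mollify {η h : Sp d → ℝ} (hη : IsTest η) (hh : MemLp h 2) :
    ContDiff ℝ (⊤ : ℕ∞) (mollify η h) :=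
  hη.2.contDiff_convolution_right _ (hh.locallyIntegrable (by norm_num)) hη.1

theorem integrable_mollify {η h : Sp d → ℝ} (hη : IsTest η) (hh : MemLp h 2) (x : Sp d) :
    Integrable fun t => h (x - t) * η t :=
  (hη.2.convolutionExists_right (ContinuousLinearMap.mul ℝ ℝ)
    (hh.locallyIntegrable (by norm_num)) hη.1.continuous x).integrable_swap

theorem IsTest.comp_sub_left {η : Sp d → ℝ} (hη : IsTest η) (x : Sp d) :
    IsTest fun t => η (x - t) :=
  ⟨hη.1.comp (contDiff_const.sub contDiff_id),
    hη.2.comp_homeomorph (Homeomorph.subLeft x)⟩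

theorem pderiv_comp_sub_left {η : Sp d → ℝ} (hη : IsTest η) (x t : Sp d) (i : Fin d) :
    pderiv i (fun t => η (x - t)) t = -pderiv i η (x - t) := by
  have h1 : HasFDerivAt η (fderiv ℝ η (x - t)) (x - t) :=
    ((hη.1.differentiable (by simp)) _).hasFDerivAt
  have h2 : HasFDerivAt (fun t => x - t) (-(ContinuousLinearMap.id ℝ (Sp d))) t :=
    (hasFDerivAt_id t).const_sub x
  have h3 := h1.comp t h2
  change fderiv ℝ (η ∘ fun t => x - t) t _ = _
  rw [h3.fderiv]
  simp [pderiv]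

/-- Mollification commutes with weak differentiation. -/
theorem pderiv_mollify {η u : Sp d → ℝ} {g : Sp d → ℝ} (hη : IsTest η) (hu : MemLp u 2) {i : Fin d}
    (hw : ∀ v, IsTest v → ∫ x, u x * pderiv i v x = -∫ x, g x * v x) (x : Sp d) :
    pderiv i (mollify η u) x = mollify η g x := by
  have hloc := hu.locallyIntegrable (p := 2) (by norm_num)
  have h1 := hη.2.hasFDerivAt_convolution_right (ContinuousLinearMap.mul ℝ ℝ) hloc
    (hη.1.of_le (by simp)) x
  have h2 := convolution_precompR_apply (ContinuousLinearMap.mul ℝ ℝ) hloc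
    (hη.2.fderiv (𝕜 := ℝ)) (hη.1.continuous_fderiv (by simp)) x (EuclideanSpace.single i (1 : ℝ))
  have h3 := hw _ (hη.comp_sub_left x)
  simp_rw [pderiv_comp_sub_left hη] at h3
  unfold pderiv
  rw [mollify, h1.fderiv, h2, convolution_mul]
  unfold mollify
  rw [convolution_mul, ← neg_inj, ← h3, ← integral_neg]
  simp only [mul_neg, pderiv]

/-- A mollified dilation is close to `h` if all dilations and translations involved are. -/
theorem eLpNorm_mollify_sub_le {η h : Sp d → ℝ} (hη : IsTest η) (hη0 : ∀ x, 0 ≤ η x)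
    (hη1 : ∫ x, η x = 1) (hh : MemLp h 2) {κ : ℝ} (hκ : 1 / 2 ≤ κ) {B : ℝ≥0∞}
    (hB : ∀ y, η y ≠ 0 → eLpNorm (fun x => h (κ • x - y) - h x) 2 volume ≤ B) :
    eLpNorm (fun x => mollify η h (κ • x) - h x) 2 volume ≤ B := by
  obtain ⟨h', hm, he⟩ : ∃ h' : Sp d → ℝ, Measurable h' ∧ h =ᵐ[volume] h' :=
    ⟨_, hh.1.aemeasurable.measurable_mk, hh.1.aemeasurable.ae_eq_mk⟩
  have hh' : MemLp h' 2 := hh.ae_eq he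
  have h0 : 0 < κ := by linarith
  have hqmp : ∀ y, Measure.QuasiMeasurePreserving (fun x : Sp d => κ • x - y) volume volume :=
    fun y => ⟨(measurable_const_smul κ).sub_const y, by
      rw [map_smul_sub h0.ne' y]; exact Measure.smul_absolutelyContinuous⟩
  have hmol : ∀ x, mollify η h x = mollify η h' x := fun x => by
    simp only [mollify, convolution_mul]
    refine integral_congr_ae (he.mono fun t ht => ?_)
    simp only [ht]
  have hcont : Measurable fun y => ENNReal.ofReal (η y) := hη.1.continuous.measurable.ennreal_ofReal
  -- the mollification is an average over translations with respect to the probability density `η`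
  let π : Measure (Sp d) := volume.withDensity fun y => ENNReal.ofReal (η y)
  have hint : Integrable η := hη.1.continuous.integrable_of_hasCompactSupport hη.2
  have hπ : IsProbabilityMeasure π := ⟨by
    simp only [π, withDensity_apply _ MeasurableSet.univ, Measure.restrict_univ]
    rw [← ofReal_integral_eq_lintegral_ofReal hint (Eventually.of_forall hη0), hη1]
    simp⟩
  have hπi : ∀ g : Sp d → ℝ, ∫ y, g y ∂π = ∫ y, η y * g y := fun g => by
    rw [integral_withDensity_eq_integral_toReal_smul hcont
      (Eventually.of_forall fun y => ENNReal.ofReal_lt_top)]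
    simp only [ENNReal.toReal_ofReal (hη0 _), smul_eq_mul]
  have h1 : (fun x => mollify η h (κ • x) - h x) =ᵐ[volume]
      fun x => ∫ y, (h' (κ • x - y) - h' x) ∂π := by
    filter_upwards [he] with x hx
    have h2 := integrable_mollify hη hh' (κ • x)
    rw [hmol, hx, hπi, mollify_apply]
    have e : ∀ y, η y * (h' (κ • x - y) - h' x) = h' (κ • x - y) * η y - h' x * η y :=
      fun y => by ring
    simp_rw [e]
    rw [integral_sub h2 (hint.const_mul _), integral_const_mul, hη1, mul_one]
  rw [eLpNorm_congr_ae h1]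
  refine eLpNorm_integral_le (g := fun x y => h' (κ • x - y) - h' x) ?_ ?_
  · refine (hm.comp ?_).sub (hm.comp measurable_fst)
    exact (measurable_fst.const_smul κ).sub measurable_snd
  · rw [ae_withDensity_iff hcont]
    refine Eventually.of_forall fun y hy => ?_
    have hy' : η y ≠ 0 := fun h => hy (by simp [h])
    refine (eLpNorm_congr_ae ?_).trans_le (hB y hy')
    filter_upwards [he, (hqmp y).ae_eq_comp he] with x hx hx2
    simp only [Function.comp_apply] at hx2
    rw [hx, hx2]

theorem eLpNorm_le_sum_coord {F : Sp d → Sp d} (hF : ∀ i, AEStronglyMeasurable (fun x => F x i)) :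
    eLpNorm F 2 volume ≤ ∑ i, eLpNorm (fun x => F x i) 2 volume := by
  have e : F = ∑ i, fun x => F x i • EuclideanSpace.single i (1 : ℝ) := by
    funext x
    ext j
    simp [Finset.sum_apply, Pi.single_apply]
  conv_lhs => rw [e]
  refine (eLpNorm_sum_le (fun i _ => (hF i).smul_const _) (by norm_num)).trans_eq ?_
  refine Finset.sum_congr rfl fun i _ => eLpNorm_congr_norm_ae (Eventually.of_forall fun x => ?_)
  simp [norm_smul]

theorem gradient_apply {f : Sp d → ℝ} (x : Sp d) (i : Fin d) : gradient f x i = pderiv i f x := by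
  have h := inner_gradient_left (𝕜 := ℝ) (f := f) (x := x) (y := EuclideanSpace.single i (1 : ℝ))
  rw [pderiv, ← h, EuclideanSpace.inner_single_right]
  simp

/-- A function in `L²(ℝ^d)` that vanishes outside the closed cube and has a weak gradient in `L²`
belongs to `H¹₀(Q)`: dilating it moves its support into the interior of the cube, and mollifying
the dilation makes it smooth. -/
theorem isH10_of_weak_gradient {u : Sp d → ℝ} {G : Sp d → Sp d} (hu : MemLp u 2) (hG : MemLp G 2)
    (hu0 : ∀ᵐ x, (∃ i, 1 < |x i|) → u x = 0)
    (hw : ∀ v, IsTest v → ∀ i, ∫ x, u x * pderiv i v x = -∫ x, G x i * v x) : IsH10 u G := by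
  have hGi : ∀ i, MemLp (fun x => G x i) 2 := fun i => hG.eval_piLp i
  -- approximation up to an error that is a multiple of `δ`
  have key : ∀ δ : ℝ≥0, 0 < δ → ∃ f : Sp d → ℝ,
      (ContDiff ℝ (⊤ : ℕ∞) f ∧ HasCompactSupport f ∧ tsupport f ⊆ cube d) ∧
      eLpNorm (f - u) 2 volume ≤ δ * (1 + ∑ i, (2 + eLpNorm (fun x => G x i) 2 volume)) ∧
      eLpNorm (gradient f - G) 2 volume ≤
        δ * (1 + ∑ i, (2 + eLpNorm (fun x => G x i) 2 volume)) := by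
    intro δ hδ
    have hδ0 : (δ : ℝ≥0∞) ≠ 0 := by exact_mod_cast hδ.ne'
    obtain ⟨s₀, hs₀, hsu⟩ := exists_eLpNorm_comp_affine_sub_le hu hδ0
    choose s₁ hs₁ hsG using fun i => exists_eLpNorm_comp_affine_sub_le (hGi i) hδ0
    obtain ⟨s, hs, hss₀, hss₁, hsδ, hs1⟩ : ∃ s : ℝ, 0 < s ∧ s ≤ s₀ ∧ (∀ i, s ≤ s₁ i) ∧ s ≤ δ ∧
        s ≤ 1 := by
      have h1 : ∀ᶠ s : ℝ in 𝓝[>] 0, ∀ i, s ≤ s₁ i :=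
        eventually_all.2 fun i => mem_of_superset (Ioc_mem_nhdsGT (hs₁ i)) fun _ h => h.2
      have h2 : ∀ a : ℝ, 0 < a → ∀ᶠ s : ℝ in 𝓝[>] 0, s ≤ a := fun a ha =>
        mem_of_superset (Ioc_mem_nhdsGT ha) fun _ h => h.2
      obtain ⟨s, h3, h4, h5, h6, h7⟩ := ((h2 s₀ hs₀).and (h1.and ((h2 δ hδ).and ((h2 1 one_pos).and
        self_mem_nhdsWithin)))).exists
      exact ⟨s, h7, h3, h4, h5, h6⟩
    let φ : ContDiffBump (0 : Sp d) := ⟨s / 4, s / 2, by positivity, by linarith⟩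
    let η : Sp d → ℝ := φ.normed volume
    have hη : IsTest η := ⟨φ.contDiff_normed, φ.hasCompactSupport_normed⟩
    have hη0 : ∀ x, 0 ≤ η x := φ.nonneg_normed
    have hη1 : ∫ x, η x = 1 := φ.integral_normed
    have hηs : ∀ y, η y ≠ 0 → ‖y‖ < s / 2 := fun y hy => by
      have : y ∈ Function.support η := hy
      rw [φ.support_normed_eq] at this
      simpa using this
    -- dilation by `1 + s` with a kernel of radius `s / 2`: since `(1 + s / 2) / (1 + s) < 1`, the
    -- support lies in the open cube
    let κ := 1 + s
    have hκ : 1 / 2 ≤ κ := by simp only [κ]; linarith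
    have hκ0 : 0 < κ := by linarith
    have hκ1 : |κ - 1| ≤ s := by simp [κ, abs_of_pos hs]
    let f : Sp d → ℝ := fun x => mollify η u (κ • x)
    have hfs : ContDiff ℝ (⊤ : ℕ∞) f := (contDiff_mollify hη hu).comp (contDiff_const_smul κ)
    have hsub : tsupport f ⊆ {x : Sp d | ∀ i, |x i| ≤ (1 + s / 2) / κ} := by
      refine closure_minimal (fun x hx i => ?_) ?_
      · by_contra! hc
        refine hx ?_
        change mollify η u (κ • x) = 0
        rw [mollify, convolution_mul]
        refine integral_eq_zero_of_ae (hu0.mono fun t ht => ?_)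
        by_cases hη2 : η (κ • x - t) = 0
        · simp [hη2]
        · have h1 := hηs _ hη2
          have h2 : |κ * x i - t i| ≤ ‖κ • x - t‖ := by
            have := PiLp.norm_apply_le (κ • x - t) i
            simpa using this
          rw [div_lt_iff₀ hκ0] at hc
          have h3 : |κ * x i| ≤ |κ * x i - t i| + |t i| := by
            have := abs_add_le (κ * x i - t i) (t i)
            simpa using this
          rw [abs_mul, abs_of_pos hκ0] at h3
          have h4 : u t = 0 := ht ⟨i, by linarith⟩
          simp [h4]
      · simp only [Set.ofPred_forall]
        exact isClosed_iInter fun i => isClosed_le (continuous_coord i).abs continuous_const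
    have hr : (1 + s / 2) / κ < 1 := by
      rw [div_lt_one hκ0]; simp only [κ]; linarith
    refine ⟨f, ⟨hfs, ?_, hsub.trans fun x hx i => (hx i).trans_lt hr⟩, ?_, ?_⟩
    · exact Metric.isCompact_of_isClosed_isBounded (isClosed_tsupport f)
        ((isBounded_abs_le _).subset hsub)
    · refine (eLpNorm_mollify_sub_le hη hη0 hη1 hu hκ fun y hy =>
        hsu κ y (hκ1.trans hss₀) ((hηs y hy).le.trans (by linarith))).trans ?_
      exact le_mul_of_one_le_right' le_self_add
    -- the chain rule produces the factor `κ = 1 + s` in the gradient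
    · have hcoord : ∀ x i, (gradient f - G) x i =
          κ * (mollify η (fun x => G x i) (κ • x) - G x i) + s * G x i := fun x i => by
        rw [Pi.sub_apply, PiLp.sub_apply, gradient_apply, pderiv, fderiv_comp_smul]
        have := pderiv_mollify hη hu (fun v hv => hw v hv i) (κ • x)
        rw [pderiv] at this
        rw [FunLike.coe_smul, Pi.smul_apply, this, smul_eq_mul]
        simp only [κ]
        ring
      have hm1 : ∀ i, AEStronglyMeasurable (fun x =>
          mollify η (fun x => G x i) (κ • x) - G x i) volume := fun i =>
        (((contDiff_mollify hη (hGi i)).continuous.comp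
          (continuous_const_smul κ)).aestronglyMeasurable).sub (hGi i).1
      have hm2 : ∀ i, AEStronglyMeasurable (fun x =>
          κ * (mollify η (fun x => G x i) (κ • x) - G x i) + s * G x i) volume := fun i =>
        ((hm1 i).const_mul κ).add ((hGi i).1.const_mul s)
      have hκ2 : ‖κ‖ₑ ≤ 2 := by
        rw [Real.enorm_of_nonneg hκ0.le]
        exact (ENNReal.ofReal_le_ofReal (by simp only [κ]; linarith : κ ≤ 2)).trans_eq (by simp)
      have hs2 : ‖s‖ₑ ≤ δ := by
        rw [Real.enorm_of_nonneg hs.le]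
        exact (ENNReal.ofReal_le_ofReal hsδ).trans_eq (by simp)
      refine (eLpNorm_le_sum_coord fun i => (hm2 i).congr
        (Eventually.of_forall fun x => (hcoord x i).symm)).trans ?_
      simp_rw [hcoord]
      refine le_trans ?_ (mul_le_mul_right le_add_self _)
      rw [Finset.mul_sum]
      refine Finset.sum_le_sum fun i _ => ?_
      refine (eLpNorm_add_le ((hm1 i).const_mul κ) ((hGi i).1.const_mul s) (by norm_num)).trans ?_
      change eLpNorm (κ • _) 2 volume + eLpNorm (s • _) 2 volume ≤ _
      rw [eLpNorm_const_smul, eLpNorm_const_smul, mul_add, mul_comm (δ : ℝ≥0∞) 2]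
      gcongr
      exact eLpNorm_mollify_sub_le hη hη0 hη1 (hGi i) hκ fun y hy =>
        hsG i κ y (hκ1.trans (hss₁ i)) ((hηs y hy).le.trans (by linarith [hss₁ i]))
  choose f hf hf1 hf2 using fun n : ℕ => key (1 / ((n : ℝ≥0) + 1)) (by positivity)
  have hlim : Tendsto (fun n : ℕ => ((1 / ((n : ℝ≥0) + 1) : ℝ≥0) : ℝ≥0∞) *
      (1 + ∑ i, (2 + eLpNorm (fun x => G x i) 2 volume))) atTop (𝓝 0) := by
    have h1 : Tendsto (fun n : ℕ => 1 / ((n : ℝ≥0) + 1)) atTop (𝓝 0) :=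
      tendsto_one_div_add_atTop_nhds_zero_nat
    have h2 := ENNReal.Tendsto.mul_const (ENNReal.tendsto_coe.2 h1)
      (b := 1 + ∑ i, (2 + eLpNorm (fun x => G x i) 2 volume)) (Or.inr ?_)
    · simpa using h2
    · refine ENNReal.add_ne_top.2 ⟨by simp, ?_⟩
      exact (ENNReal.sum_lt_top.2 fun i _ => ENNReal.add_lt_top.2 ⟨by simp, (hGi i).2⟩).ne
  exact ⟨hu, hG, f, hf, tendsto_of_tendsto_of_tendsto_of_le_of_le tendsto_const_nhds hlim
    (fun _ => zero_le) hf1, tendsto_of_tendsto_of_tendsto_of_le_of_le tendsto_const_nhds hlim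
    (fun _ => zero_le) hf2⟩

/-! ### Strong convergence under the compact embedding -/

theorem interp_dilate {ε ε' : ℝ} (hε : 0 < ε) (hε' : 0 < ε') (U : Lat d → ℝ) (x : Sp d) :
    interp ε U x = interp ε' U ((ε' / ε) • x) := by
  unfold interp
  congr 1
  funext z
  congr 1
  have : x ∈ cell ε z ↔ (ε' / ε) • x ∈ cell ε' z := by
    simp only [cell, Set.mem_ofPred_eq, Set.mem_Ioc, PiLp.smul_apply, smul_eq_mul]
    refine forall_congr' fun i => ?_
    have e : ε' / ε * x i - ε' * z i = ε' / ε * (x i - ε * z i) := by field_simp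
    have h0 : 0 < ε' / ε := by positivity
    have e1 : -(ε' / 2) = ε' / ε * -(ε / 2) := by field_simp
    have e2 : ε' / 2 = ε' / ε * (ε / 2) := by field_simp
    rw [e, e1, e2, mul_lt_mul_iff_right₀ h0, mul_le_mul_iff_right₀ h0]
  by_cases hx : x ∈ cell ε z
  · rw [Set.indicator_of_mem hx, Set.indicator_of_mem (this.1 hx)]
  · rw [Set.indicator_of_notMem hx, Set.indicator_of_notMem fun h => hx (this.2 h)]

theorem SuppInCube.mono {ε ε' : ℝ} (hε' : 0 ≤ ε') (h : ε' ≤ ε) {U : Lat d → ℝ}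
    (hU : SuppInCube ε U) : SuppInCube ε' U := by
  intro x hx i
  refine lt_of_le_of_lt ?_ (hU x hx i)
  simp only [scaled, abs_mul]
  gcongr

/-- Decreasing the lattice spacing by a factor of at most two increases the energy at most fourfold,
because of the factor `ε⁻²` in the squared discrete derivatives. -/
theorem gradEnergy_le_four_mul {ε ε' : ℝ} (hε' : 0 < ε') (h1 : ε' ≤ ε) (h2 : ε ≤ 2 * ε')
    (ω : Env d) (U : Lat d → ℝ) : gradEnergy ω ε' U ≤ 4 * gradEnergy ω ε U := by
  unfold gradEnergy
  rw [mul_left_comm]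
  refine mul_le_mul' (ENNReal.ofReal_le_ofReal (by gcongr)) ?_
  rw [← ENNReal.tsum_mul_left]
  refine ENNReal.tsum_le_tsum fun x => ?_
  rw [← ENNReal.tsum_mul_left]
  refine ENNReal.tsum_le_tsum fun z => ?_
  rw [mul_left_comm]
  gcongr
  have e4 : (4 : ℝ≥0∞) = ENNReal.ofReal 4 := by simp
  rw [e4, ← ENNReal.ofReal_mul (by norm_num)]
  refine ENNReal.ofReal_le_ofReal ?_
  simp only [discDeriv, div_pow]
  have h0 : 0 < ε := hε'.trans_le h1
  rw [div_le_iff₀ (by positivity), mul_assoc, div_mul_eq_mul_div, ← mul_div_assoc,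
    le_div_iff₀ (by positivity)]
  have h3 : ε ^ 2 ≤ 4 * ε' ^ 2 := by nlinarith
  nlinarith [sq_nonneg (U (x + z) - U x), mul_le_mul_of_nonneg_left h3
    (sq_nonneg (U (x + z) - U x))]

/-- Weak and strong limits in `L²` agree. -/
theorem WeakL2.ae_eq_of_tendsto {f : ℕ → Sp d → ℝ} {u u' : Sp d → ℝ} (hf : ∀ k, MemLp (f k) 2)
    (hu : MemLp u 2) (hu' : MemLp u' 2) (hw : WeakL2 f u)
    (hs : Tendsto (fun k => eLpNorm (f k - u') 2 volume) atTop (𝓝 0)) : u =ᵐ[volume] u' := by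
  have hg := hu.sub hu'
  have h1 : Tendsto (fun k => (hf k).toLp (f k)) atTop (𝓝 (hu'.toLp u')) :=
    (Lp.tendsto_Lp_iff_tendsto_eLpNorm'' _ _ _ _).2 hs
  have h2 : Tendsto (fun k => inner ℝ ((hf k).toLp (f k)) (hg.toLp _)) atTop
      (𝓝 (inner ℝ (hu'.toLp u') (hg.toLp _))) := h1.inner tendsto_const_nhds
  simp_rw [inner_toLp] at h2
  have h3 := tendsto_nhds_unique (hw _ hg) h2
  have h4 : inner ℝ (hg.toLp _) (hg.toLp _) = 0 := by
    rw [inner_toLp]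
    have hi1 := integrable_mul_two hu hg
    have hi2 := integrable_mul_two hu' hg
    have h5 := integral_sub hi1 hi2
    rw [h3, sub_self] at h5
    rw [← h5]
    refine integral_congr_ae (Eventually.of_forall fun x => ?_)
    simp only [Pi.sub_apply]
    ring
  rw [inner_self_eq_zero, Lp.eq_zero_iff_ae_eq_zero] at h4
  filter_upwards [hg.coeFn_toLp, h4] with x hx1 hx2
  rw [hx1] at hx2
  simpa [sub_eq_zero] using hx2

/-- The compact embedding is only assumed along `ε⁻¹ ∈ ℕ`; replacing `ε` by `1 / ⌈1 / ε⌉` amounts to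
a dilation by a factor that tends to one. -/
theorem tendsto_interp_of_compactEmbedding {ω : Env d} (hω : CompactEmbedding ω) {ε : ℕ → ℝ}
    (hε : ∀ k, 0 < ε k ∧ ε k ≤ 1) (h0 : Tendsto ε atTop (𝓝 0)) {U : ℕ → Lat d → ℝ}
    (hU : ∀ k, SuppInCube (ε k) (U k)) {K : ℝ} (hK : ∀ k x, |U k x| ≤ K) {C : ℝ≥0}
    (hC : ∀ k, gradEnergy ω (ε k) (U k) ≤ C) {u : Sp d → ℝ} (hu : MemLp u 2)
    (hw : WeakL2 (fun k => interp (ε k) (U k)) u) :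
    Tendsto (fun k => eLpNorm (interp (ε k) (U k) - u) 2 volume) atTop (𝓝 0) := by
  refine tendsto_of_subseq_tendsto fun ns hns => ?_
  let n : ℕ → ℕ := fun k => ⌈(ε (ns k))⁻¹⌉₊
  have hε0 : Tendsto (fun k => ε (ns k)) atTop (𝓝 0) := h0.comp hns
  have hn1 : ∀ k, 1 ≤ n k := fun k => Nat.one_le_ceil_iff.2 (inv_pos.2 (hε _).1)
  have hnp : ∀ k, (0 : ℝ) < n k := fun k => by exact_mod_cast hn1 k
  have hnl : ∀ k, (ε (ns k))⁻¹ ≤ n k := fun k => Nat.le_ceil _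
  have hnu : ∀ k, (n k : ℝ) < (ε (ns k))⁻¹ + 1 := fun k =>
    Nat.ceil_lt_add_one (inv_pos.2 (hε _).1).le
  have hn : Tendsto n atTop atTop := by
    refine tendsto_nat_ceil_atTop.comp (tendsto_inv_nhdsGT_zero.comp ?_)
    exact tendsto_nhdsWithin_iff.2 ⟨hε0, Eventually.of_forall fun k => (hε _).1⟩
  have hle : ∀ k, 1 / (n k : ℝ) ≤ ε (ns k) := fun k => by
    rw [one_div]; exact inv_le_of_inv_le₀ (hε _).1 (hnl k)
  have hge : ∀ k, ε (ns k) ≤ (1 + ε (ns k)) * (1 / (n k : ℝ)) := fun k => by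
    have h1 := (hε (ns k)).1
    have h2 := mul_lt_mul_of_pos_left (hnu k) h1
    rw [mul_add, mul_inv_cancel₀ h1.ne'] at h2
    rw [mul_one_div, le_div_iff₀ (hnp k)]
    linarith
  have hge2 : ∀ k, ε (ns k) ≤ 2 * (1 / (n k : ℝ)) := fun k => (hge k).trans (by
    gcongr; linarith [(hε (ns k)).2])
  -- strong convergence of the dilated functions along a further subsequence
  obtain ⟨σ, u', hσ, hu', hlim⟩ := hω n (fun k => U (ns k)) hn1 hn
    (fun k => (hU (ns k)).mono (by positivity) (hle k)) ⟨4 * C, fun k => by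
      refine ENNReal.half_le_self.trans ?_
      refine (gradEnergy_le_four_mul (one_div_pos.2 (hnp k)) (hle k) (hge2 k) _ _).trans ?_
      push_cast
      gcongr
      exact hC _⟩
  refine ⟨σ, ?_⟩
  -- undo the dilation
  let κ : ℕ → ℝ := fun k => 1 / (n (σ k) : ℝ) / ε (ns (σ k))
  have hκ : ∀ k, 1 / 2 ≤ κ k := fun k => by
    rw [le_div_iff₀ (hε _).1]; linarith [hge2 (σ k)]
  have hκ1 : ∀ k, |κ k - 1| ≤ ε (ns (σ k)) := fun k => by
    have h1 := (hε (ns (σ k))).1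
    have h2 : κ k ≤ 1 := (div_le_one h1).2 (hle _)
    rw [abs_sub_comm, abs_of_nonneg (by linarith)]
    have h3 : 1 ≤ (1 + ε (ns (σ k))) * κ k := by
      simp only [κ]
      rw [← mul_div_assoc, le_div_iff₀ h1, one_mul]
      exact hge _
    nlinarith
  have hmem : ∀ k, MemLp (interp (ε k) (U k)) 2 := fun k =>
    memLp_interp (hε k).1 (hε k).2 (hU k) (hK k) 2
  have hmem' : ∀ k, MemLp (interp (1 / (n (σ k) : ℝ)) (U (ns (σ k)))) 2 := fun k =>
    memLp_interp (one_div_pos.2 (hnp _)) ((hle _).trans (hε _).2)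
      ((hU _).mono (one_div_pos.2 (hnp _)).le (hle _)) (hK _) 2
  have hdil : Tendsto (fun k => eLpNorm (fun x => u' (κ k • x - 0) - u' x) 2 volume) atTop
      (𝓝 0) := by
    refine ENNReal.tendsto_nhds_zero.2 fun δ hδ => ?_
    obtain ⟨s, hs, h⟩ := exists_eLpNorm_comp_affine_sub_le hu' hδ.ne'
    filter_upwards [(hε0.comp hσ.tendsto_atTop).eventually (ge_mem_nhds hs)] with k hk
    exact h _ _ ((hκ1 k).trans hk) (by simpa using hs.le)
  have hstrong : Tendsto (fun k => eLpNorm (interp (ε (ns (σ k))) (U (ns (σ k))) - u') 2 volume)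
      atTop (𝓝 0) := by
    have h1 := (ENNReal.Tendsto.const_mul hlim (a := 2 ^ d) (Or.inr (by simp))).add hdil
    rw [mul_zero, add_zero] at h1
    refine tendsto_of_tendsto_of_tendsto_of_le_of_le tendsto_const_nhds h1 (fun _ => zero_le)
      fun k => ?_
    have hd := (hmem' k).sub hu'
    have e : interp (ε (ns (σ k))) (U (ns (σ k))) - u' =
        (fun x => (interp (1 / (n (σ k) : ℝ)) (U (ns (σ k))) - u') (κ k • x - 0)) +
          fun x => u' (κ k • x - 0) - u' x := by
      funext x
      simp only [Pi.sub_apply, Pi.add_apply, sub_zero]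
      rw [interp_dilate (hε _).1 (one_div_pos.2 (hnp (σ k)))]
      ring
    rw [e]
    refine (eLpNorm_add_le (memLp_comp_affine hd (hκ k) 0).1
      ((memLp_comp_affine hu' (hκ k) 0).sub hu').1 (by norm_num)).trans ?_
    exact add_le_add (eLpNorm_comp_affine_le hd.1 (hκ k) 0) le_rfl
  have hw' : WeakL2 (fun k => interp (ε (ns (σ k))) (U (ns (σ k)))) u := fun g hg =>
    (hw g hg).comp (hns.comp hσ.tendsto_atTop)
  -- the strong limit is the weak one, so that it does not depend on the subsequence
  have hae := hw'.ae_eq_of_tendsto (fun k => hmem _) hu hu' hstrong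
  refine hstrong.congr fun k => eLpNorm_congr_ae ?_
  filter_upwards [hae] with x hx
  simp [hx]

/-! ### Two-scale limits of gradients -/

/-- The covariant test fields: `Φ` without the constant `1`, which is not covariant. -/
def covTestSet (Φsol Φpot : Set (Field d)) : Set (Field d) :=
  Φsol ∪ Φpot ∪ Set.range coordField

/-- The almost sure properties of an environment, beyond typicality, that the compactness argument
uses. -/
structure Regular (P : Measure (Env d)) (ν : Env d → ℝ≥0∞) (Φsol Φpot : Set (Field d))
    (ω : Env d) : Prop where
  cond_lt_top : ∀ x z, cond ω x z < ∞
  tame : ∀ φ ∈ covTestSet Φsol Φpot, Tame (weight ω φ)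
  cobdryApprox : ∀ b ∈ Φsol, ∀ i,
    CobdryApprox (density (coordField i) b) (covInner P (coordField i) b) ω
  resistance : ∃ A : ℝ≥0, ∀ N, ∑ x ∈ box d N, ν (shift x ω) ≤ A * (box d N).card

theorem IsTestFamily.memCov (hmom : UpperMoment P) {Φsol Φpot : Set (Field d)}
    (hΦ : IsTestFamily P Φsol Φpot) : ∀ φ ∈ covTestSet Φsol Φpot, MemCov P φ := by
  rintro φ ((hφ | hφ) | ⟨i, rfl⟩)
  · exact (hΦ.sol_mem φ hφ).1
  · obtain ⟨g, hg, rfl⟩ := hΦ.pot_mem φ hφ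
    exact memCov_grad hmom hg
  · exact memCov_coordField hmom i

theorem ae_cobdryApprox_density [IsProbabilityMeasure P] (hmom : UpperMoment P)
    (hstat : Stationary P) (herg : ShiftErgodic P) {φ ψ : Field d} (hφ : MemCov P φ)
    (hψ : MemCov P ψ) : ∀ᵐ ω ∂P, CobdryApprox (density φ ψ) (covInner P φ ψ) ω := by
  have h1 := hφ.measurable
  have h2 := hψ.measurable
  have hm : Measurable (density φ ψ) := by
    refine Measurable.tsum fun z => ?_
    exact (measurable_cond 0 z).ennreal_toReal.mul ((h1 z).mul (h2 z))
  exact ae_cobdryApprox hstat herg hm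
    (integrable_tsum_of_integrable_edgeMeasure hmom hstat (integrable_mul_two hφ.memLp hψ.memLp))

/-- `Regular` concerns countably many fields only, so that a single null set has to be discarded,
independently of the lattice functions. -/
theorem ae_regular [IsProbabilityMeasure P] (hmom : UpperMoment P) (hstat : Stationary P)
    (herg : ShiftErgodic P) {l : ℕ} {ν : Env d → ℝ≥0∞} (hν : IsResistance P l ν)
    {Φsol Φpot : Set (Field d)} (hΦ : IsTestFamily P Φsol Φpot) :
    ∀ᵐ ω ∂P, Regular P ν Φsol Φpot ω := by
  have hcov := hΦ.memCov hmom
  have hc : (covTestSet Φsol Φpot).Countable :=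
    (hΦ.countable_sol.union hΦ.countable_pot).union (Set.countable_range _)
  have h1 := (ae_ball_iff hc).2 fun φ hφ =>
    ae_tame hmom hstat (hcov φ hφ).measurable (hcov φ hφ).norm_lt_top
  have h2 := (ae_ball_iff hΦ.countable_sol).2 fun b hb => ae_all_iff.2 fun i =>
    ae_cobdryApprox_density hmom hstat herg (memCov_coordField hmom i) (hΦ.sol_mem b hb).1
  filter_upwards [ae_cond_lt_top hmom hstat, h1, h2,
    ae_exists_forall_sum_box_le_of_lt_top hstat hν.measurable hν.lintegral_lt_top]
    with ω h3 h4 h5 h6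
  exact ⟨h3, h4, h5, h6⟩

/-- Weakly convergent lattice functions of bounded energy: along a subsequence the gradients
two-scale converge, and the weak limit belongs to `H¹₀(Q)`. -/
theorem exists_twoScale_limit (hd : 1 ≤ d) [IsProbabilityMeasure P] (hmom : UpperMoment P)
    (hstat : Stationary P) {l : ℕ} {ν : Env d → ℝ≥0∞} (hν : IsResistance P l ν)
    {Φsol Φpot : Set (Field d)} (hΦ : IsTestFamily P Φsol Φpot) {ω : Env d}
    (hω : Regular P ν Φsol Φpot ω) (htyp : Typical P Φsol Φpot ω) {ε : ℕ → ℝ}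
    (h0 : Tendsto ε atTop (𝓝 0)) {U : ℕ → Lat d → ℝ} {C : ℝ≥0}
    (hU : ∀ k, Admissible ω (ε k) (U k) C) {K : ℝ} (hK : ∀ k x, |U k x| ≤ K)
    {u : Sp d → ℝ} (hu : MemLp u 2) (hw : WeakL2 (fun k => interp (ε k) (U k)) u) :
    ∃ (σ : ℕ → ℕ) (G : Sp d → Sp d) (V : Sp d → Field d),
      StrictMono σ ∧ IsH10 u G ∧ MemBochner P (MemPot P) V ∧
      TwoScale P (testSet Φsol Φpot) ω (fun k => ε (σ k))
        (fun k => discDeriv (ε (σ k)) (U (σ k)))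
        (fun x ω' z => (∑ i, G x i * (z i : ℝ)) + V x ω' z) := by
  have hcov := hΦ.memCov hmom
  have hsub : covTestSet Φsol Φpot ⊆ testSet Φsol Φpot := Set.subset_union_left
  have hsolsub : ∀ b ∈ Φsol, b ∈ covTestSet Φsol Φpot := fun b hb => Or.inl (Or.inl hb)
  obtain ⟨σ, w, hσ, hlim⟩ := exists_pairing_limit hmom hstat h0 hU hcov hω.tame
    fun φ hφ ψ hψ => htyp.erg_product φ (hsub hφ) ψ (hsub hψ)
  have h0' := h0.comp hσ.tendsto_atTop
  have hdiff := fun i => tendsto_tsum_abs_diff h0 hU hν hω.resistance i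
  -- the two-scale limit against solenoidal fields is a weak derivative of `u`
  have hsol : ∀ v, IsTest v → ∀ b ∈ Φsol, ∫ q, w q * tens v b q ∂(cubeEdge P) =
      -∑ j, covInner P (coordField j) b * ∫ x, u x * pderiv j v x := fun v hv b hb =>
    tendsto_nhds_unique (hlim v hv b (hsolsub b hb))
      ((tendsto_pairing_sol h0 hU hK hdiff (hΦ.sol_mem b hb).1.covariant
        (hω.tame b (hsolsub b hb)) (htyp.div_free b hb) (hω.cobdryApprox b hb) hv fun i =>
          hw _ ((hv.pderiv i).1.continuous.memLp_of_hasCompactSupport (hv.pderiv i).2)).comp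
        hσ.tendsto_atTop)
  obtain ⟨G, V, hG, -, hGu, hV, hGV, hid⟩ :=
    exists_gradient_decomposition hmom hstat hν hΦ w u hsol
  refine ⟨σ, G, V, hσ, isH10_of_weak_gradient hu hG
    (hw.ae_eq_zero (fun k => (hU k).pos) h0 (fun k => (hU k).supp) hu) hGu, hV, hGV, ?_⟩
  rintro v hv1 hv2 φ (hφ | rfl)
  · have h := hlim v ⟨hv1, hv2⟩ φ hφ
    rw [hid v ⟨hv1, hv2⟩ φ (hcov φ hφ)] at h
    exact h
  · -- the constant field pairs to zero with every covariant field
    have hi : ∫ x, v x * covInner P (fun ω' z => (∑ i, G x i * (z i : ℝ)) + V x ω' z)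
        (fun _ _ => 1) = 0 := by
      refine integral_eq_zero_of_ae (hGV.mem.mono fun x hx => ?_)
      dsimp only
      rw [hx.covInner_one hmom hstat, mul_zero, Pi.zero_apply]
    rw [hi]
    exact (tendsto_pairing_one h0 hU (hω.tame _ (Or.inr ⟨⟨0, hd⟩, rfl⟩)) ⟨hv1, hv2⟩).comp
      hσ.tendsto_atTop

end RCM

end

theorem mainTheorem12 (d : ℕ) (hd : 1 ≤ d)
    (P : Measure (RCM.Env d)) [IsProbabilityMeasure P]
    (hstat : RCM.Stationary P) (herg : RCM.ShiftErgodic P)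
    (hmom : RCM.UpperMoment P) (hlow : RCM.LowerMoment P)
    (Φsol Φpot : Set (RCM.Field d)) (hΦ : RCM.IsTestFamily P Φsol Φpot) :
    ∀ᵐ ω ∂P, RCM.Typical P Φsol Φpot ω → RCM.UniformPoincare ω →
      ∀ (ε : ℕ → ℝ) (U : ℕ → RCM.Lat d → ℝ),
        (∀ k, 0 < ε k ∧ ε k ≤ 1) → Tendsto ε atTop (𝓝 0) →
        (∀ k, RCM.SuppInCube (ε k) (U k)) →
        (∃ C : ℝ≥0, ∀ k,
          RCM.gradEnergy ω (ε k) (U k) + ⨆ x, ENNReal.ofReal |U k x| ≤ C) →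
        ∃ (σ : ℕ → ℕ) (u : RCM.Sp d → ℝ) (G : RCM.Sp d → RCM.Sp d)
          (V : RCM.Sp d → RCM.Field d),
          StrictMono σ ∧ RCM.IsH10 u G ∧ RCM.MemBochner P (RCM.MemPot P) V ∧
          RCM.WeakL2 (fun k => RCM.interp (ε (σ k)) (U (σ k))) u ∧
          RCM.TwoScale P (RCM.testSet Φsol Φpot) ω (fun k => ε (σ k))
            (fun k => RCM.discDeriv (ε (σ k)) (U (σ k)))
            (fun x ω' z => (∑ i, G x i * (z i : ℝ)) + V x ω' z) ∧
          (RCM.CompactEmbedding ω →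
            Tendsto (fun k => eLpNorm (RCM.interp (ε (σ k)) (U (σ k)) - u) 2 volume)
              atTop (𝓝 0)) := by
  obtain ⟨l, ν, hν⟩ := RCM.exists_isResistance hlow
  filter_upwards [RCM.ae_regular hmom hstat herg hν hΦ] with ω hω htyp _ ε U hε h0 hU ⟨C, hC⟩
  have hE : ∀ k, RCM.gradEnergy ω (ε k) (U k) ≤ C := fun k => le_self_add.trans (hC k)
  have hK : ∀ k x, |U k x| ≤ C := fun k x => by
    have h1 : ENNReal.ofReal |U k x| ≤ C :=
      (le_iSup (fun x => ENNReal.ofReal |U k x|) x).trans (le_add_self.trans (hC k))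
    rw [← ENNReal.ofReal_coe_nnreal] at h1
    exact (ENNReal.ofReal_le_ofReal_iff C.coe_nonneg).1 h1
  have hA : ∀ k, RCM.Admissible ω (ε k) (U k) C := fun k =>
    ⟨hω.cond_lt_top, (hε k).1, (hε k).2, hU k, hE k⟩
  obtain ⟨σ, u, hσ, hu, hw⟩ := RCM.exists_weakL2_limit hε hU hK
  have h0σ : Tendsto (fun k => ε (σ k)) atTop (𝓝 0) := h0.comp hσ.tendsto_atTop
  obtain ⟨ρ, G, V, hρ, hH, hV, hT⟩ := RCM.exists_twoScale_limit hd hmom hstat hν hΦ hω htyp h0σ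
    (fun k => hA (σ k)) (fun k => hK (σ k)) hu hw
  refine ⟨fun k => σ (ρ k), u, G, V, hσ.comp hρ, hH, hV, hw.subseq hρ, hT, fun hc => ?_⟩
  exact RCM.tendsto_interp_of_compactEmbedding hc (fun k => hε _) (h0σ.comp hρ.tendsto_atTop)
    (fun k => hU _) (fun k => hK _) (fun k => hE _) hu (hw.subseq hρ)
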